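/- **Setting.** Work on the square lattice with vertices $(1+i)\delta(\mathbb Z+i\mathbb Z)$ (up to translation); edges join nearest vertices and have directions $o\in\{(\pm1\pm i)/\sqrt2\}$. Let $V$ be a finite set of vertices and $\Omega_\delta$ the domain with vertex set $V$, whose edges are all lattice edges with both endpoints in $V$ and whose faces are the unit squares with all four sides in $\Omega_\delta$. Medial vertices are midpoints of edges, boundary edges (those with exactly one endpoint in $V$) included. Fix a face $a$ of $\Omega_\delta$; medial vertices $b$ are lifted to the double cover $[\Omega_\delta,a]$ ramified at the centre of $a$. A double orientation $(\sqrt o)^2$ of $b$ is a unit vector $o$ along its edge together with a chosen square root $\sqrt o$; write $b^{o}$ for the doubly oriented point. Put $\beta_c=\tfrac12\ln(\sqrt2+1)$ and $\alpha=e^{-2\beta_c}=\sqrt2-1$. **Spinor.** For $b_1^{o_1},\dots,b_{N}^{o_{N}}$ over distinct medial vertices, $\mathcal C(b_1^{o_1},\dots,b_N^{o_N})$ is the set of $\gamma$ consisting of the half-edges from $b_j$ in direction $o_j$ to a vertex of $V$ and of edges of $\Omega_\delta$ other than those of the $b_j$, such that every vertex has even degree; $\#\gamma$ counts half-edges with weight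 $\frac12$. An admissible choice of walks $\gamma_1,\dots,\gamma_{N/2}$ in $\gamma$ consists of edge-disjoint walks linking the $b_j$ in pairs, which always turn at vertices of degree $4$ of $\gamma$; each walk is traversed from its endpoint of larger index to its endpoint of smaller index. For a walk $w$ from $x^{o}$ to $y^{o'}$, with total rotation $W(w)$ from $o$ to $-o'$, put $\psi(w)=i\frac{\sqrt{o'}}{\sqrt o}e^{-iW(w)/2}\operatorname{Sheet}(w)$, where $\operatorname{Sheet}(w)=1$ if the lift of $w$ starting at the lifted point $x$ ends at the lifted point $y$, and $-1$ otherwise. Let $c$ be the crossing signature of the pairing, $\#L(\cdot,a)$ the number of loops around $a$, and $$\mathbf Z_{[\Omega_\delta,a]}[\sigma_a]=\sum_{\gamma\in\mathcal C(\emptyset)}\alpha^{\#\gamma}(-1)^{\#L(\gamma,a)},$$ $$F^{\{e_1^{s_1},\dots,e_k^{s_k}\}}_{[\Omega_\delta,a]}(b_1^{o_1},\dots,b_N^{o_N})=\frac1{\mathbf Z_{[\Omega_\delta,a]}[\sigma_a]}\sum_{\gamma}\alpha^{\#\gamma}(-1)^{\#L(\gamma\setminus\cup\gamma_i,a)}(-1)^{c(\gamma_1,\dots,\gamma_{N/2})}\prod_i\psi(\gamma_i),$$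 where $\gamma$ runs over the elements of $\mathcal C(b_1^{o_1},\dots,b_N^{o_N})$ with $e_j\notin\gamma$ if $s_j=+$ and $e_j\in\gamma$ if $s_j=-$. **Full-plane spinor.** $F_{[\mathbb C_\delta,a]}(x^{o},y^{o'})$, for $x,y$ over distinct medial vertices, is the limit of $F_{[\Lambda_n,a]}(x^{o},y^{o'})$ over the growing squares $\Lambda_n$ around $a$. For $F$ either of the two-point spinors, $H(x^{o},z)=\sum_{o'}\frac{i}{\sqrt{o'}}F(x^{o},z^{o'})$, the sum being over the two orientations of $z$. At a corner (a point at distance $\delta/2$ from a vertex $v$, in direction $\kappa\in\{\pm1,\pm i\}$ from $v$), s-holomorphicity means that the orthogonal projections to $\kappa^{-1/2}\mathbb R$ of the values at the two adjacent medial vertices agree. For an edge $e$ with orientation $q$, let $H^+$ (resp. $H^-$) be the value at $e$ that makes $H_{[\mathbb C_\delta,a]}(e^{q},\cdot)$ s-holomorphic at the two corners in front of $e$ (resp. at the two behind), and $$\tilde\mu_e=-i\,(i\sqrt q)\,(H^++H^-)=\sqrt q\,(H^++H^-).$$ For two doubly oriented points $x^{\xi},x^{\xi'}$ at the same medial vertex,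 $F^{[\mathbb C_\delta,a]}_{[\Omega_\delta,a]}(x^{\xi},x^{\xi'})$ is the real number $r$ such that $\frac{i}{\sqrt{\xi'}}r$ is the projection to $\frac{i}{\sqrt{\xi'}}\mathbb R$ of the value at $x$ of the s-holomorphic extension to $x$ of $H_{[\Omega_\delta,a]}(x^{\xi},\cdot)-H_{[\mathbb C_\delta,a]}(x^{\xi},\cdot)$. **Fused spinor.** It is defined inductively by $$F^{[e_1,\dots,e_m]\{\dots\}}_{[\Omega_\delta,a]}(\dots)=F^{[e_1,\dots,e_{m-1}]\{\dots,e_m^+\}}_{[\Omega_\delta,a]}(\dots)-\frac{1+\tilde\mu_{e_m}}2F^{[e_1,\dots,e_{m-1}]\{\dots\}}_{[\Omega_\delta,a]}(\dots).$$ **Proposition.** Let $e_1,\dots,e_m$ be distinct edges of $\Omega_\delta$, and let $b_1^{o_1},\dots,b_{2n}^{o_{2n}}$ be doubly oriented points of the double cover over distinct medial vertices which are not the midpoints of $e_1,\dots,e_m$. Then for every choice of double orientations $(\sqrt{q_i})^2$ of the $e_i$ (and of lifts of their midpoints) $$F^{[e_1,\dots,e_m]}_{[\Omega_\delta,a]}(b_1^{o_1},\dots,b_{2n}^{o_{2n}})=\operatorname{Pfaff}\Big(\mathbf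 A_{[\Omega_\delta,a]}\big(e_1^{(\sqrt{q_1})^2},\dots,e_m^{(\sqrt{q_m})^2},e_m^{(i\sqrt{q_m})^2},\dots,e_1^{(i\sqrt{q_1})^2},b_1^{o_1},\dots,b_{2n}^{o_{2n}}\big)\Big),$$ where $$\big(\mathbf A_{[\Omega_\delta,a]}(x_1^{\xi_1},\dots,x_{2p}^{\xi_{2p}})\big)_{jk}=\begin{cases}F^{[\mathbb C_\delta,a]}_{[\Omega_\delta,a]}(x_j^{\xi_j},x_k^{\xi_k})&\text{if }x_j=x_k,\ \sqrt{\xi_j}\ne\sqrt{\xi_k},\\F_{[\Omega_\delta,a]}(x_j^{\xi_j},x_k^{\xi_k})&\text{if }x_j\ne x_k,\\0&\text{otherwise.}\end{cases}$$ Moreover, if $\Omega_\delta$ has no holes (any two lattice vertices outside $V$ are joined by a chain of vertices outside $V$, consecutive ones being corners of a common unit square), then for the critical Ising model on the faces of $\Omega_\delta$ with plus boundary conditions, and with the energy density $\epsilon(e)=\tilde\mu_e-\sigma_x\sigma_y$, where $x,y$ are the two faces incident to $e$, one has $\mathbb E_{\Omega_\delta}[\sigma_a]>0$ and $$\frac{\mathbb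 E_{\Omega_\delta}[\sigma_a\,\epsilon(e_1)\cdots\epsilon(e_m)]}{\mathbb E_{\Omega_\delta}[\sigma_a]}=(-1)^m2^m\operatorname{Pfaff}\Big(\mathbf A_{[\Omega_\delta,a]}\big(e_1^{(\sqrt{q_1})^2},\dots,e_m^{(\sqrt{q_m})^2},e_m^{(i\sqrt{q_m})^2},\dots,e_1^{(i\sqrt{q_1})^2}\big)\Big).$$ -/

import Mathlib

open scoped BigOperators

noncomputable section

namespace IsingSpinor

/-! ## The lattice

The vertex `(m, n) : ℤ × ℤ` stands for the point `δ (1 + i) (m + n i)` of the rotated square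
lattice of mesh size `√2 δ` (up to a translation of the lattice). None of the quantities below
depends on `δ`. -/

abbrev Vtx := ℤ × ℤ

/-- An edge of the lattice, which is also its midpoint (a medial vertex): `(v, false)` is the edge
from `v` to `v + (1, 0)`, and `(v, true)` is the edge from `v` to `v + (0, 1)`. -/
abbrev Edge := (ℤ × ℤ) × Bool

/-- A face (unit square), given by its lower left vertex. -/
abbrev Face := ℤ × ℤ

/-- The four directions, in counterclockwise order. -/
def dirVec (d : Fin 4) : Vtx := ![(1, 0), (0, 1), (-1, 0), (0, -1)] d

/-- The direction `d` as a complex unit vector in the rotated lattice; one of `(±1 ± i)/√2`. -/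
def orient (d : Fin 4) : ℂ := Complex.exp (Complex.I * (Real.pi / 4)) * Complex.I ^ (d : ℕ)

/-- The edge that leaves the vertex `v` in direction `d`. -/
def edgeOf (v : Vtx) (d : Fin 4) : Edge :=
  ![(v, false), (v, true), (v + (-1, 0), false), (v + (0, -1), true)] d

/-- The second endpoint of an edge (the first one is `e.1`). -/
def Edge.snd' (e : Edge) : Vtx := e.1 + if e.2 then (0, 1) else (1, 0)

/-- The edges of the domain with vertex set `V`: all lattice edges with both endpoints in `V`. -/
def edges (V : Finset Vtx) : Finset Edge := (V ×ˢ Finset.univ).filter fun e => Edge.snd' e ∈ V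

/-- `e` is an edge or a boundary edge of the domain: at least one endpoint is in `V`. -/
def Touches (V : Finset Vtx) (e : Edge) : Prop := e.1 ∈ V ∨ Edge.snd' e ∈ V

/-- The faces of the domain: the unit squares whose four sides are edges of the domain. -/
def faces (V : Finset Vtx) : Finset Face :=
  V.filter fun v => v + (1, 0) ∈ V ∧ v + (0, 1) ∈ V ∧ v + (1, 1) ∈ V

/-- The domain has no holes: the complement of `V` is connected, where two vertices of the
complement are joined if they are corners of a common unit square (such a square is not a face of
the domain). -/
def NoHoles (V : Finset Vtx) : Prop :=
  ∀ u, u ∉ V → ∀ w, w ∉ V →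
    Relation.ReflTransGen (fun p q : Vtx => q ∉ V ∧ |q.1 - p.1| ≤ 1 ∧ |q.2 - p.2| ≤ 1) u w

/-! ## The double cover ramified at the centre of the face `a`

The double cover is glued from two copies (the sheets `1` and `-1`) of the plane slit along a curve
from the centre of `a` to infinity. The curve is the horizontal line to the right in `ℤ × ℤ`,
at height `a.2 + 3/4`; thus it crosses the edges `((k, a.2), true)` with `k ≥ a.1 + 1`, each one
between its midpoint and its upper endpoint. -/

/-- `-1` if the half-edge from the vertex `v` to the midpoint of the edge in direction `d` crosses
the slit, `1` otherwise. -/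
def halfCut (a : Face) (v : Vtx) (d : Fin 4) : ℤ :=
  if d = 3 ∧ v.2 = a.2 + 1 ∧ a.1 + 1 ≤ v.1 then -1 else 1

/-- `-1` if the edge `e` crosses the slit, `1` otherwise. -/
def edgeCut (a : Face) (e : Edge) : ℤ :=
  if e.2 = true ∧ e.1.2 = a.2 ∧ a.1 + 1 ≤ e.1.1 then -1 else 1

/-- A doubly oriented medial vertex `b^{(√o)²}` of the double cover: the medial vertex is the
midpoint of the edge that leaves `tail` in direction `dir`, its orientation is `o = orient dir`,
`root` is the chosen square root of `o`, and `sheet` tells which of the two lifts is meant. -/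
structure OPoint where
  tail : Vtx
  dir : Fin 4
  root : ℂ
  root_sq : root ^ 2 = orient dir
  sheet : ℤˣ

namespace OPoint

/-- The (projection to the plane of the) medial vertex. -/
def edge (x : OPoint) : Edge := edgeOf x.tail x.dir

/-- The endpoint of the edge towards which the orientation points. -/
def head (x : OPoint) : Vtx := x.tail + dirVec x.dir

/-- From `b^{(√o)²}` to `b^{(i√o)²}`: the same lifted medial vertex with opposite orientation. -/
def flip (x : OPoint) : OPoint where
  tail := x.head
  dir := x.dir + 2
  root := Complex.I * x.root
  root_sq := by
    rw [mul_pow, x.root_sq, Complex.I_sq]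
    have h : ∀ d : Fin 4, (-1 : ℂ) * orient d = orient (d + 2) := by
      intro d
      have h3 : Complex.I ^ 3 = -Complex.I := Complex.I_pow_three
      fin_cases d <;> simp [orient, h3]
    exact h x.dir
  sheet := x.sheet

/-- The doubly oriented medial vertex with a standard choice of the square root. -/
def std (v : Vtx) (d : Fin 4) (s : ℤˣ) : OPoint where
  tail := v
  dir := d
  root := Complex.exp (Complex.I * (Real.pi / 8)) * Complex.exp (Complex.I * (Real.pi / 4)) ^ (d : ℕ)
  root_sq := by
    have h1 : Complex.exp (Complex.I * (Real.pi / 8)) ^ 2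
        = Complex.exp (Complex.I * (Real.pi / 4)) := by
      rw [← Complex.exp_nat_mul]; congr 1; push_cast; ring
    have h2 : Complex.exp (Complex.I * (Real.pi / 4)) ^ 2 = Complex.I := by
      rw [← Complex.exp_nat_mul]
      have : ((2 : ℕ) : ℂ) * (Complex.I * (Real.pi / 4)) = (Real.pi / 2 : ℂ) * Complex.I := by
        push_cast; ring
      rw [this, Complex.exp_pi_div_two_mul_I]
    rw [mul_pow, h1, ← pow_mul, mul_comm (d : ℕ) 2, pow_mul, h2]
    rfl
  sheet := s

end OPoint

/-! ## Walks -/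

/-- Where one arrives from `v` after the steps `ds`. -/
def walkEnd : Vtx → List (Fin 4) → Vtx
  | v, [] => v
  | v, d :: ds => walkEnd (v + dirVec d) ds

/-- The edges traversed from `v` by the steps `ds`. -/
def walkEdges : Vtx → List (Fin 4) → List Edge
  | _, [] => []
  | v, d :: ds => edgeOf v d :: walkEdges (v + dirVec d) ds

/-- The angle from direction `d` to direction `d'`, in units of `π / 2` (U-turns do not occur). -/
def turn (d d' : Fin 4) : ℤ := if d' = d + 1 then 1 else if d' = d + 3 then -1 else 0

/-- Total rotation, in units of `π / 2`, of a walk that comes in direction `d`, makes the steps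
`ds`, and leaves in direction `d'`. -/
def winding : Fin 4 → List (Fin 4) → Fin 4 → ℤ
  | d, [], d' => turn d d'
  | d, f :: fs, d' => turn d f + winding f fs d'

/-- The walk that arrives at `v` in direction `d`, makes the steps `ds`, and leaves in direction
`d'`, never goes straight through a vertex with `deg = 4`. -/
def TurnsAtAmbiguity (deg : Vtx → ℕ) : Vtx → Fin 4 → List (Fin 4) → Fin 4 → Prop
  | v, d, [], d' => deg v = 4 → d ≠ d'
  | v, d, f :: fs, d' => (deg v = 4 → d ≠ f) ∧ TurnsAtAmbiguity deg (v + dirVec f) f fs d'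

/-- `sheetSign a x ds y` is `Sheet(w)` for the walk `w` that starts at the lifted medial vertex
`x`, runs along the half-edge to `x.head`, makes the steps `ds` to `y.head`, and then runs along
the half-edge to the medial vertex `y`: it is `1` if the lift of `w` which starts at `x` ends at
the lift `y`, and `-1` if it ends on the other sheet. -/
def sheetSign (a : Face) (x : OPoint) (ds : List (Fin 4)) (y : OPoint) : ℤ :=
  (x.sheet : ℤ) * (y.sheet : ℤ) * halfCut a x.head (x.dir + 2) * halfCut a y.head (y.dir + 2) *
    ((walkEdges x.head ds).map (edgeCut a)).prod

/-- `ψ(w) = i (√o' / √o) exp (-i W(w) / 2) Sheet(w)` for the walk `w` as above. It starts in the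
direction of `o` and ends in the direction of `-o'`. -/
def psi (a : Face) (x : OPoint) (ds : List (Fin 4)) (y : OPoint) : ℂ :=
  Complex.I * (y.root / x.root) *
    Complex.exp (-Complex.I * ((winding x.dir ds (y.dir + 2) : ℝ) * (Real.pi / 2)) / 2) *
    sheetSign a x ds y

/-! ## Configurations -/

/-- Number of edges of `ω` and of half-edges (from the `b i` in direction of their orientation)
at the vertex `v`. -/
def deg {N : ℕ} (b : Fin N → OPoint) (ω : Finset Edge) (v : Vtx) : ℕ :=
  (ω.filter fun e => e.1 = v ∨ Edge.snd' e = v).card +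
    (Finset.univ.filter fun i => (b i).head = v).card

/-- The configurations `γ`: the half-edges from the `b i` to the vertices `(b i).head` of the
domain, together with a set `ω` of edges of the domain not containing any of the edges of the
`b i`, such that every vertex has even degree. A signed edge `(e, true)` (that is, `e⁺`) requires
that `e` is not in `γ`, so that the spins on its two sides agree; `(e, false)` (that is, `e⁻`)
requires that `e` is in `γ`. A configuration is represented by `ω`. -/
def configs (V : Finset Vtx) (s : List (Edge × Bool)) {N : ℕ} (b : Fin N → OPoint) :
    Finset (Finset Edge) :=
  (edges V).powerset.filter fun ω =>
    (∀ i, (b i).head ∈ V) ∧ (∀ i, (b i).edge ∉ ω) ∧ (∀ v ∈ V, Even (deg b ω v)) ∧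
      ∀ e ∈ s, (e.1 ∈ ω ↔ e.2 = false)

/-- A choice of walks: `b i` is linked to `b (partner i)`. The walk is traversed from the endpoint
with the larger index `i` to the one with the smaller index `partner i`, and its steps between
the two half-edges are `path i`. (The values of `path` at the other indices are not used.) -/
structure WalkChoice (N : ℕ) where
  partner : Fin N → Fin N
  path : Fin N → List (Fin 4)

/-- The choice of walks is admissible for the configuration `ω`: the walks link the `b i` in pairs,
use edges of `ω`, each edge at most once in total, and at a vertex with four incident (half-)edges
of the configuration they always turn, so that there are no crossings. -/
structure IsAdmissible {N : ℕ} (b : Fin N → OPoint) (ω : Finset Edge) (c : WalkChoice N) :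
    Prop where
  invol : ∀ i, c.partner (c.partner i) = i
  ne : ∀ i, c.partner i ≠ i
  ends : ∀ i, c.partner i < i → walkEnd (b i).head (c.path i) = (b (c.partner i)).head
  subset : ∀ i, c.partner i < i → ∀ e ∈ walkEdges (b i).head (c.path i), e ∈ ω
  nodup : ∀ i, c.partner i < i → (walkEdges (b i).head (c.path i)).Nodup
  disjoint : ∀ i j, c.partner i < i → c.partner j < j → i ≠ j →
    (walkEdges (b i).head (c.path i)).Disjoint (walkEdges (b j).head (c.path j))
  turns : ∀ i, c.partner i < i →
    TurnsAtAmbiguity (deg b ω) (b i).head (b i).dir (c.path i) ((b (c.partner i)).dir + 2)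

/-- The indices `i` at which a walk starts. -/
def WalkChoice.starts {N : ℕ} (c : WalkChoice N) : Finset (Fin N) :=
  Finset.univ.filter fun i => c.partner i < i

/-- The edges of all the walks. -/
def WalkChoice.used {N : ℕ} (c : WalkChoice N) (b : Fin N → OPoint) : Finset Edge :=
  c.starts.biUnion fun i => (walkEdges (b i).head (c.path i)).toFinset

/-- The crossing signature: the number of crossing pairs of arcs, when the points `1, …, N` of the
real line are linked by arcs in the upper half-plane as the walks link the `b i`. -/
def WalkChoice.crossings {N : ℕ} (c : WalkChoice N) : ℕ :=
  (Finset.univ.filter fun p : Fin N × Fin N =>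
    c.partner p.1 < c.partner p.2 ∧ c.partner p.2 < p.1 ∧ p.1 < p.2).card

/-- `(-1) ^ #L(ω, a)` for a set `ω` of edges with even degrees. A loop surrounds `a` if and only
if it crosses the curve from `a` to infinity an odd number of times, hence the number of loops of
`ω` around `a` has the parity of the number of edges of `ω` which cross the curve. -/
def loopSign (a : Face) (ω : Finset Edge) : ℤ := ∏ e ∈ ω, edgeCut a e

/-- `(-1) ^ #L(γ ∖ ⋃ γ_i, a) * (-1) ^ c(γ_1, …, γ_n) * ∏ ψ(γ_i)` for a choice of walks. -/
def choiceSign (a : Face) {N : ℕ} (b : Fin N → OPoint) (ω : Finset Edge) (c : WalkChoice N) : ℂ :=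
  (loopSign a (ω \ c.used b) : ℂ) * (-1) ^ c.crossings *
    ∏ i ∈ c.starts, psi a (b i) (c.path i) (b (c.partner i))

open scoped Classical in
/-- The phase of a configuration, computed with an admissible choice of walks (its value does not
depend on this choice). -/
def phase (a : Face) {N : ℕ} (b : Fin N → OPoint) (ω : Finset Edge) : ℂ :=
  if h : ∃ c, IsAdmissible b ω c then choiceSign a b ω h.choose else 0

/-! ## The critical Ising model on the faces, with plus boundary conditions -/

/-- The critical inverse temperature `½ ln (√2 + 1)`. -/
def betaC : ℝ := Real.log (Real.sqrt 2 + 1) / 2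

/-- `α = e^{-2β} = √2 - 1`. -/
def alpha : ℝ := Real.exp (-2 * betaC)

/-- The spin of the face `f` when `M` is the set of faces of the domain with spin `-1`. Faces
outside the domain have spin `1`. -/
def spin (M : Finset Face) (f : Face) : ℝ := if f ∈ M then -1 else 1

/-- The product of the spins of the two faces incident to an edge. -/
def edgeSpin (M : Finset Face) (e : Edge) : ℝ :=
  spin M e.1 * spin M (if e.2 then e.1 + (-1, 0) else e.1 + (0, -1))

/-- The weight `e^{-β E(σ)}` at the critical temperature. -/
def boltzmann (V : Finset Vtx) (M : Finset Face) : ℝ :=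
  Real.exp (betaC * ∑ e ∈ edges V, edgeSpin M e)

/-- The expectation of the random variable `X` (a function of the set of minus spins). -/
def expect (V : Finset Vtx) (X : Finset Face → ℝ) : ℝ :=
  (∑ M ∈ (faces V).powerset, X M * boltzmann V M) / ∑ M ∈ (faces V).powerset, boltzmann V M

/-! ## The fermionic spinor -/

/-- The partition function `Z_{[Ω,a]}[σ_a]`. -/
def partitionSpin (V : Finset Vtx) (a : Face) : ℝ :=
  ∑ ω ∈ configs V [] (Fin.elim0 : Fin 0 → OPoint), alpha ^ ω.card * (loopSign a ω : ℝ)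

/-- The restricted multipoint spinor `F_{[Ω,a]}^{{e_1^{s_1}, …}}(b_1, …, b_N)`; half-edges count
one half in the number `#γ` of edges. -/
def spinor (V : Finset Vtx) (a : Face) (s : List (Edge × Bool)) {N : ℕ} (b : Fin N → OPoint) : ℂ :=
  (∑ ω ∈ configs V s b, ((alpha ^ ((ω.card : ℝ) + (N : ℝ) / 2) : ℝ) : ℂ) * phase a b ω) /
    (partitionSpin V a : ℂ)

/-- The two-point spinor `F_{[Ω,a]}(x, y)`. -/
def twoPoint (V : Finset Vtx) (a : Face) (x y : OPoint) : ℂ := spinor V a [] ![x, y]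

/-- The square domain of the lattice vertices around `a` at sup-distance at most `n` from `a`. -/
def box (a : Face) (n : ℕ) : Finset Vtx :=
  Finset.Icc (a.1 - n) (a.1 + 1 + n) ×ˢ Finset.Icc (a.2 - n) (a.2 + 1 + n)

/-- `L` is the infinite-volume limit of the two-point spinors. -/
def IsFullPlaneLimit (a : Face) (L : OPoint → OPoint → ℂ) : Prop :=
  ∀ x y : OPoint, x.edge ≠ y.edge →
    Filter.Tendsto (fun n => twoPoint (box a n) a x y) Filter.atTop (nhds (L x y))

open scoped Classical in
/-- The full-plane two-point spinor `F_{[ℂ,a]}(x, y)`, for `x.edge ≠ y.edge`: the limit of the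
two-point spinors of the growing squares around `a`. This limit exists; the second case only makes
the definition total (it is the spinor of some square which contains the edge of `x`). -/
def fullPlane (a : Face) : OPoint → OPoint → ℂ :=
  if h : ∃ L, IsFullPlaneLimit a L then h.choose
  else fun x y =>
    twoPoint (box a ((x.edge.1.1 - a.1).natAbs + (x.edge.1.2 - a.2).natAbs + 1)) a x y

/-! ## s-holomorphic extension to the diagonal -/

/-- The complex two-point observable `H(x, z)` of a real two-point function `F`, at the lifted
medial vertex `z`: the sum of `(i / √o) F(x, z^{(√o)²})` over the two orientations `o` of `z`. It
depends neither on the orientation nor on the square root in `z`. -/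
def complexObs (F : OPoint → OPoint → ℂ) (x z : OPoint) : ℂ :=
  Complex.I / z.root * F x z + Complex.I / z.flip.root * F x z.flip

/-- The medial vertex next to `x` at the vertex `x.head`: on the left of `x` for `t = 1` and on the
right for `t = 3`, lifted to the double cover by continuity. -/
def nextTo (a : Face) (x : OPoint) (t : Fin 4) : OPoint :=
  OPoint.std x.head (x.dir + t)
    (x.sheet * (if halfCut a x.head (x.dir + 2) = halfCut a x.head (x.dir + t) then 1 else -1))

/-- The unit vector from the vertex `x.head` to the corner between `x` and `nextTo a x t`. -/
def cornerDir (x : OPoint) (t : Fin 4) : ℂ :=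
  (orient (x.dir + 2) + orient (x.dir + t)) / (Real.sqrt 2 : ℂ)

/-- The orthogonal projection of `w` to the line `τ ℝ` with `τ ^ 2 = 1 / κ`, for `|κ| = 1`; this is
the line of the corners that lie in direction `κ` from the nearest vertex. -/
def proj (κ w : ℂ) : ℂ := (w + (starRingEnd ℂ) κ * (starRingEnd ℂ) w) / 2

/-- Given the function `G` on the other medial vertices, the value `h` at `x` makes it
s-holomorphic at the two corners in front of `x`. -/
def IsFrontValue (a : Face) (G : OPoint → ℂ) (x : OPoint) (h : ℂ) : Prop :=
  ∀ t : Fin 4, t = 1 ∨ t = 3 → proj (cornerDir x t) h = proj (cornerDir x t) (G (nextTo a x t))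

/-- The front value at `x` (it exists and is unique). -/
def frontValue (a : Face) (G : OPoint → ℂ) (x : OPoint) : ℂ :=
  Classical.epsilon (IsFrontValue a G x)

/-- The rear value at `x`, given by the two corners on the other side. -/
def rearValue (a : Face) (G : OPoint → ℂ) (x : OPoint) : ℂ := frontValue a G x.flip

/-- The s-holomorphic extension of `G` to `x`: the value that makes `G` s-holomorphic at all the
four corners around `x`. -/
def extension (a : Face) (G : OPoint → ℂ) (x : OPoint) : ℂ :=
  Classical.epsilon fun h => IsFrontValue a G x h ∧ IsFrontValue a G x.flip h

/-- `F_{[Ω,a]}^{[ℂ,a]}(x, y)` for `x`, `y` over the same medial vertex: the component along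
`(i / √o_y) ℝ` of the s-holomorphic extension to `x` of the function
`H_{[Ω,a]}(x, ·) - H_{[ℂ,a]}(x, ·)`. -/
def renormalized (V : Finset Vtx) (a : Face) (x y : OPoint) : ℂ :=
  (((x.sheet : ℤ) * (y.sheet : ℤ) : ℤ) : ℂ) *
    ((y.root / Complex.I *
      extension a (fun z => complexObs (twoPoint V a) x z - complexObs (fullPlane a) x z) x).re : ℂ)

/-- `μ̃_e = -i √o (H⁺ + H⁻)`, where `H⁺` and `H⁻` are the front and rear values at `e` of the
full-plane observable `H_{[ℂ,a]}(e^q, ·)` and `√o = i √q`. -/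
def muTilde (a : Face) (e : Edge) : ℝ :=
  let x := OPoint.std e.1 (if e.2 then 1 else 0) 1
  (-Complex.I * x.flip.root *
    (frontValue a (complexObs (fullPlane a) x) x + rearValue a (complexObs (fullPlane a) x) x)).re

/-- The fused spinor `F_{[Ω,a]}^{[e_1, …, e_m]{…}}(b_1, …, b_N)`, by recursion on `m`. -/
def fused (V : Finset Vtx) (a : Face) {N : ℕ} (b : Fin N → OPoint) :
    (m : ℕ) → (Fin m → Edge) → List (Edge × Bool) → ℂ
  | 0, _, s => spinor V a s b
  | m + 1, e, s =>
    fused V a b m (Fin.init e) ((e (Fin.last m), true) :: s) -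
      ((1 + muTilde a (e (Fin.last m)) : ℝ) : ℂ) / 2 * fused V a b m (Fin.init e) s

/-! ## The Pfaffian -/

/-- The permutations `π` of `0, …, 2p - 1` with `π (2k) < π (2k + 1)` and
`π 0 < π 2 < π 4 < …`; they correspond to the partitions `{{π (2k), π (2k + 1)}}` into pairs. -/
def pairings (p : ℕ) : Finset (Equiv.Perm (Fin (2 * p))) :=
  Finset.univ.filter fun π =>
    (∀ k : Fin p, π ⟨2 * k, by omega⟩ < π ⟨2 * k + 1, by omega⟩) ∧
    ∀ k l : Fin p, k < l → π ⟨2 * k, by omega⟩ < π ⟨2 * l, by omega⟩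

/-- The Pfaffian of a matrix of even size. -/
def pfaffian {p : ℕ} (A : Matrix (Fin (2 * p)) (Fin (2 * p)) ℂ) : ℂ :=
  ∑ π ∈ pairings p, ((Equiv.Perm.sign π : ℤ) : ℂ) *
    ∏ k : Fin p, A (π ⟨2 * k, by omega⟩) (π ⟨2 * k + 1, by omega⟩)

open scoped Classical in
/-- The matrix `𝐀_{[Ω,a]}(x_1, …, x_N)`. -/
def spinorMatrix (V : Finset Vtx) (a : Face) {N : ℕ} (x : Fin N → OPoint) :
    Matrix (Fin N) (Fin N) ℂ := fun j k =>
  if (x j).edge = (x k).edge then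
    if (x j).root = (x k).root then 0 else renormalized V a (x j) (x k)
  else twoPoint V a (x j) (x k)

/-- The list `e_1^{(√q_1)²}, …, e_m^{(√q_m)²}, e_m^{(i√q_m)²}, …, e_1^{(i√q_1)²}, b_1, …, b_{2n}`. -/
def fusedPoints {m n : ℕ} (q : Fin m → OPoint) (b : Fin (2 * n) → OPoint) :
    Fin (2 * (m + n)) → OPoint :=
  fun k => Fin.append (Fin.append q fun i => (q i.rev).flip) b (Fin.cast (by omega) k)

end IsingSpinor

end

open IsingSpinor

/-!
# Fused spinors as Pfaffians

Order the half-edges of the lattice, the four at a vertex counterclockwise, and regard them as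
anticommuting generators with square one; `Mono` is the type of their signed monomials. A
configuration with points `b_1, …, b_N` and edge set `ω` gives the product of the half-edges of the
points, in this order, and of the edges of `ω`, each edge being the product of its two halves. The
sign of this product relative to the sorted product of the same half-edges does not mention any
walks, and it is the phase of the configuration up to the loops of `ω` around `a` and a sign for
each point (`phase_eq`). Indeed, with respect to standard square roots of the four directions, the
factor `exp (-i W / 2)` of a walk is the sign that sorts the two half-edges at each of its vertices
(`winding_phase`); a walk that turns at vertices of degree four does not separate the two other
half-edges there (`walkMono_mul`); and reordering the ends of the walks gives the crossing signature
(`prod_walks`). The loops that remain contribute no sign (`edgesMono_of_even`): an even subgraph of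
the plane is the boundary of a set of faces, and adding a face changes the product of the edges and
the sorted product of the half-edges by the same sign (`IsBoundary.edgesMono_eq`).

Hence the spinors are the correlation functions `corr` of lists of half-edges, which are alternating
(`spinor_eq`). Comparing the configurations which are odd at a vertex `v` before and after adding a
half-edge at `v` gives a linear relation for each pair of consecutive half-edges at `v`
(`corner_relation`). There are as many relations as half-edges, and the two-point correlations solve
them for every right-hand side, so they have only one solution (`eq_zero_of_dirac`). This uses that
the partition function is not zero; it is positive by the high-temperature expansion
(`corr_nil_pos`). Both sides of the expansion of a correlation function in its first point solve the
same relations, and so Wick's formula holds (`corr_wick`): correlation functions are Pfaffians of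
two-point correlations (`pfL_corr`, `pfaffian_eq_pfL`).

For the fusion, let `g` be the correlation of the two halves of an edge `e`, as an entry of the
Pfaffian. Adding `t` to this entry adds `t` times the Pfaffian without the two points
(`pfL_add_entry`). In the original Pfaffian the two halves glue to the edge, with a sign: it counts
the configurations that contain `e`, negatively (`sum_mem_edge_mul`). So the perturbed Pfaffian is
the correlation function with the factor `t - 1[e ∈ ω]` inserted (`pfL_fusionEntry`), while the
recursion for the fused spinors inserts `1[e ∉ ω] - (1 + μ̃_e) / 2`, which is the same for
`t = (1 - μ̃_e) / 2` (`fused_eq`). It remains to see that the renormalized two-point function is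
`g + t`. The linear relations above are s-holomorphicity at the corners (`proj_corner`), with a
defect where the second point passes the first: the observable started at `x` over `e` has the
values `(1 + g) / √o` in front of `e` and `g / √o` behind it (`isFrontValue_self`,
`isFrontValue_flip`). Passing to the limit, the full-plane observable has the values `(1 + L) / √o`
and `L / √o` with a real number `L` (`exists_fullPlane_values`). Hence `μ̃_e = 1 + 2 L`, the
difference of the two observables extends by `(g - L) / √o`, and `g - L = g + (1 - μ̃_e) / 2`
(`renormalized_flip`).

For the Ising model, the spins of the faces of a domain without holes correspond to the even edge
sets of the domain by the low-temperature expansion (`sum_spins`): no loop can surround a point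
outside the domain, so that the faces surrounded by an odd number of loops belong to it
(`loops_eq_one_of_noHoles`). Under this correspondence `σ_a` is the sign of the number of loops
around `a`, and `ε(e)` is `-2` times the factor inserted by the fusion of `e` (`expect_energies`).
-/

noncomputable section

namespace IsingSpinor

/-! ### Signed monomials in anticommuting generators -/

/-- A half-edge: `(v, d)` joins the vertex `v` to the midpoint of the edge leaving `v` in
direction `d`. -/
abbrev Half := Vtx × Fin 4

/-- The sign of the transposition needed to sort the pair `h, k`: it is `-1` if `h` comes after `k`.
Half-edges are ordered by vertex (lexicographically), then by direction. -/
def eps (h k : Half) : ℤˣ :=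
  if h.1 = k.1 then (if k.2 < h.2 then -1 else 1)
  else if k.1.1 < h.1.1 ∨ (k.1.1 = h.1.1 ∧ k.1.2 < h.1.2) then -1 else 1

lemma eps_self (h : Half) : eps h h = 1 := by simp [eps]

lemma eps_swap {h k : Half} (hk : h ≠ k) : eps h k = -eps k h := by
  obtain ⟨⟨a, b⟩, c⟩ := h
  obtain ⟨⟨a', b'⟩, c'⟩ := k
  simp only [eps, Prod.mk.injEq, ne_eq] at hk ⊢
  have e1 : (a = a' ∧ b = b') ↔ (a' = a ∧ b' = b) := by
    constructor <;> rintro ⟨h1, h2⟩ <;> exact ⟨h1.symm, h2.symm⟩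
  by_cases h1 : a = a' ∧ b = b'
  · rw [if_pos h1, if_pos (e1.1 h1)]
    rcases lt_trichotomy c c' with h | h | h
    · rw [if_neg (not_lt.2 h.le), if_pos h]; rfl
    · exact absurd ⟨h1, h⟩ hk
    · rw [if_pos h, if_neg (not_lt.2 h.le)]
  · rw [if_neg h1, if_neg (fun h => h1 (e1.2 h))]
    by_cases h2 : a' < a ∨ a' = a ∧ b' < b
    · rw [if_pos h2, if_neg (by omega)]
    · rw [if_neg h2, if_pos (by omega)]; rfl

/-- Half-edges at different vertices compare like their vertices. -/
lemma eps_of_ne {v w : Vtx} (h : v ≠ w) (d d' f f' : Fin 4) :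
    eps (v, d) (w, f) = eps (v, d') (w, f') := by
  simp [eps, h]

/-- The sign of the permutation that sorts the juxtaposition of the sorted sets `A` and `B`. An
element of both sets contributes `1` with itself, so that its square disappears without a sign. -/
def inv (A B : Finset Half) : ℤˣ := ∏ h ∈ A, ∏ k ∈ B, eps h k

lemma prod_symmDiff_units {ι : Type*} [DecidableEq ι] (A B : Finset ι) (f : ι → ℤˣ) :
    ∏ i ∈ symmDiff A B, f i = (∏ i ∈ A, f i) * ∏ i ∈ B, f i := by
  have h1 := Finset.prod_sdiff (f := f) (Finset.inter_subset_left : A ∩ B ⊆ A)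
  have h2 := Finset.prod_sdiff (f := f) (Finset.inter_subset_right : A ∩ B ⊆ B)
  have h3 : symmDiff A B = (A \ (A ∩ B)) ∪ (B \ (A ∩ B)) := by
    ext x; simp only [Finset.mem_symmDiff, Finset.mem_union, Finset.mem_sdiff, Finset.mem_inter]
    tauto
  have h4 : Disjoint (A \ (A ∩ B)) (B \ (A ∩ B)) := by
    rw [Finset.disjoint_left]
    intro x; simp only [Finset.mem_sdiff, Finset.mem_inter]; tauto
  rw [h3, Finset.prod_union h4, ← h1, ← h2, mul_mul_mul_comm, Int.units_mul_self, mul_one]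

lemma inv_symmDiff_left (A B C : Finset Half) : inv (symmDiff A B) C = inv A C * inv B C :=
  prod_symmDiff_units _ _ _

lemma inv_symmDiff_right (A B C : Finset Half) : inv C (symmDiff A B) = inv C A * inv C B := by
  simp only [inv, prod_symmDiff_units, Finset.prod_mul_distrib]

lemma inv_swap {A B : Finset Half} (h : Disjoint A B) :
    inv A B = (-1) ^ (A.card * B.card) * inv B A := by
  unfold inv
  rw [Finset.prod_comm (s := B)]
  have : ∀ x ∈ A, ∏ k ∈ B, eps x k = (-1) ^ B.card * ∏ k ∈ B, eps k x := by
    intro x hx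
    rw [← Finset.prod_const, ← Finset.prod_mul_distrib]
    refine Finset.prod_congr rfl fun k hk => ?_
    rw [eps_swap (by rintro rfl; exact Finset.disjoint_left.1 h hx hk)]; simp
  rw [Finset.prod_congr rfl this, Finset.prod_mul_distrib, Finset.prod_const, ← pow_mul, mul_comm B.card]

/-- A signed monomial in generators indexed by the half-edges, which anticommute and have
square `1`: the element `sign * ∏ h ∈ support, h`, the factors being in increasing order. -/
@[ext] structure Mono where
  support : Finset Half
  sign : ℤˣ

namespace Mono

instance : Mul Mono := ⟨fun x y =>
  ⟨symmDiff x.support y.support, x.sign * y.sign * inv x.support y.support⟩⟩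

instance : One Mono := ⟨⟨∅, 1⟩⟩

@[simp] lemma support_mul (x y : Mono) : (x * y).support = symmDiff x.support y.support := rfl

lemma sign_mul (x y : Mono) : (x * y).sign = x.sign * y.sign * inv x.support y.support := rfl

@[simp] lemma support_one : (1 : Mono).support = ∅ := rfl

@[simp] lemma sign_one : (1 : Mono).sign = 1 := rfl

instance : Monoid Mono where
  mul_assoc x y z := by
    ext1
    · simp only [support_mul, symmDiff_assoc]
    · simp only [sign_mul, support_mul, inv_symmDiff_left, inv_symmDiff_right]
      simp only [mul_assoc, mul_left_comm, mul_comm]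
  one_mul x := by
    ext1
    · rw [support_mul, support_one, ← Finset.bot_eq_empty, bot_symmDiff]
    · rw [sign_mul]; simp [inv]
  mul_one x := by
    ext1
    · rw [support_mul, support_one, ← Finset.bot_eq_empty, symmDiff_bot]
    · rw [sign_mul]; simp [inv]

instance : MulAction ℤˣ Mono where
  smul s x := ⟨x.support, s * x.sign⟩
  one_smul _ := Mono.ext rfl (one_mul _)
  mul_smul _ _ _ := Mono.ext rfl (mul_assoc _ _ _)

@[simp] lemma support_smul (s : ℤˣ) (x : Mono) : (s • x).support = x.support := rfl

@[simp] lemma sign_smul (s : ℤˣ) (x : Mono) : (s • x).sign = s * x.sign := rfl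

instance : IsScalarTower ℤˣ Mono Mono :=
  ⟨fun _ _ _ => Mono.ext rfl (by simp [sign_mul, mul_assoc])⟩

instance : SMulCommClass ℤˣ Mono Mono :=
  ⟨fun _ _ _ => Mono.ext rfl (by simp [sign_mul, mul_assoc, mul_left_comm])⟩

/-- The generator belonging to a half-edge. -/
def gen (h : Half) : Mono := ⟨{h}, 1⟩

@[simp] lemma support_gen (h : Half) : (gen h).support = {h} := rfl

@[simp] lemma sign_gen (h : Half) : (gen h).sign = 1 := rfl

lemma gen_mul_self (h : Half) : gen h * gen h = 1 := by
  ext1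
  · simp
  · simp [sign_mul, inv, eps_self]

/-- Monomials with disjoint supports commute up to the sign `(-1) ^ (|A| |B|)`. -/
lemma mul_swap {x y : Mono} (h : Disjoint x.support y.support) :
    x * y = (-1 : ℤˣ) ^ (x.support.card * y.support.card) • (y * x) := by
  ext1
  · simp [symmDiff_comm]
  · simp only [sign_mul, sign_smul]
    rw [inv_swap h, mul_comm y.sign]
    simp only [mul_left_comm]

lemma gen_mul_gen {h k : Half} (hk : h ≠ k) : gen h * gen k = (-1 : ℤˣ) • (gen k * gen h) := by
  simpa using mul_swap (x := gen h) (y := gen k) (by simpa using hk)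

lemma commute_of_even {x y : Mono} (h : Disjoint x.support y.support)
    (he : Even x.support.card) : Commute x y := by
  have := mul_swap h
  rwa [Even.neg_one_pow (he.mul_right _), one_smul] at this

end Mono

open Mono

/-- The parity of the number of elements of a set at the vertex `v`, as a sign. -/
def par (v : Vtx) (A : Finset Half) : ℤˣ := ∏ h ∈ A, if h.1 = v then -1 else 1

lemma par_symmDiff (v : Vtx) (A B : Finset Half) :
    par v (symmDiff A B) = par v A * par v B := prod_symmDiff_units _ _ _

lemma par_mul (v : Vtx) (x y : Mono) :
    par v (x * y).support = par v x.support * par v y.support := by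
  rw [support_mul, par_symmDiff]

@[simp] lemma par_empty (v : Vtx) : par v ∅ = 1 := rfl

lemma par_gen (v : Vtx) (h : Half) : par v (gen h).support = if h.1 = v then -1 else 1 := by
  simp [par]

lemma par_eq_prod (v : Vtx) (A : Finset Half) :
    par v A = ∏ d : Fin 4, if (v, d) ∈ A then -1 else 1 := by
  have h1 : par v A = ∏ h ∈ A.filter (fun h => h.1 = v), (-1 : ℤˣ) := by
    rw [par, Finset.prod_filter]
  have h2 : (∏ d : Fin 4, if (v, d) ∈ A then (-1 : ℤˣ) else 1)
      = ∏ d ∈ Finset.univ.filter (fun d => (v, d) ∈ A), (-1 : ℤˣ) := by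
    rw [Finset.prod_filter]
  rw [h1, h2]
  refine Finset.prod_bij' (fun h _ => h.2) (fun d _ => (v, d)) ?_ ?_ ?_ ?_ ?_
  · rintro ⟨w, d⟩ h; simp only [Finset.mem_filter] at h ⊢; obtain ⟨h, rfl⟩ := h; simpa using h
  · intro d h; simpa using h
  · rintro ⟨w, d⟩ h; simp only [Finset.mem_filter] at h ⊢; obtain ⟨h, rfl⟩ := h; rfl
  · intro d h; rfl
  · intros; rfl

lemma par_eq_pow_card (v : Vtx) (A : Finset Half) :
    par v A = (-1) ^ (A.filter fun h => h.1 = v).card := by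
  rw [par, ← Finset.prod_filter, Finset.prod_const]

lemma par_eq_one_iff (v : Vtx) (A : Finset Half) :
    par v A = 1 ↔ Even (A.filter fun h => h.1 = v).card := by
  rw [par_eq_pow_card, neg_one_pow_eq_one_iff_even (by decide)]

/-! ### Edges and their two halves -/

/-- The other half of the same edge. -/
def opp (h : Half) : Half := (h.1 + dirVec h.2, h.2 + 2)

/-- The edge containing a half-edge. -/
def Half.edge (h : Half) : Edge := edgeOf h.1 h.2

/-- The half of `e` at its first endpoint. -/
def half1 (e : Edge) : Half := (e.1, if e.2 then 1 else 0)

/-- The half of `e` at its second endpoint. -/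
def half2 (e : Edge) : Half := (Edge.snd' e, if e.2 then 3 else 2)

lemma opp_opp (h : Half) : opp (opp h) = h := by
  obtain ⟨⟨a, b⟩, d⟩ := h
  fin_cases d <;> simp [opp, dirVec]

lemma opp_ne (h : Half) : opp h ≠ h := by
  obtain ⟨⟨a, b⟩, d⟩ := h
  fin_cases d <;> simp [opp, dirVec]

lemma edge_opp (h : Half) : (opp h).edge = h.edge := by
  obtain ⟨⟨a, b⟩, d⟩ := h
  fin_cases d <;> simp [opp, dirVec, Half.edge, edgeOf]

lemma opp_half1 (e : Edge) : opp (half1 e) = half2 e := by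
  obtain ⟨⟨a, b⟩, d⟩ := e
  cases d <;> simp [opp, dirVec, half1, half2, Edge.snd']

lemma opp_half2 (e : Edge) : opp (half2 e) = half1 e := by rw [← opp_half1, opp_opp]

lemma edge_half1 (e : Edge) : (half1 e).edge = e := by
  obtain ⟨⟨a, b⟩, d⟩ := e
  cases d <;> simp [half1, Half.edge, edgeOf]

lemma edge_half2 (e : Edge) : (half2 e).edge = e := by
  rw [← opp_half1, edge_opp, edge_half1]

lemma half_cases (h : Half) :
    (h = half1 h.edge ∧ (h.2 = 0 ∨ h.2 = 1)) ∨ (h = half2 h.edge ∧ (h.2 = 2 ∨ h.2 = 3)) := by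
  obtain ⟨⟨a, b⟩, d⟩ := h
  fin_cases d <;> simp [half1, half2, Half.edge, edgeOf, Edge.snd']

lemma edge_eq_iff (h k : Half) : h.edge = k.edge ↔ h = k ∨ h = opp k := by
  constructor
  · intro e
    rcases half_cases h with ⟨h1, -⟩ | ⟨h1, -⟩ <;> rcases half_cases k with ⟨k1, -⟩ | ⟨k1, -⟩
    · left; rw [h1, k1, e]
    · right; rw [h1, k1, opp_half2, e]
    · right; rw [h1, k1, opp_half1, e]
    · left; rw [h1, k1, e]
  · rintro (rfl | rfl)
    · rfl
    · rw [edge_opp]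

/-- The half-edges contained in a set of edges. -/
def halves (ω : Finset Edge) : Finset Half := ω.biUnion fun e => {half1 e, half2 e}

lemma mem_halves {ω : Finset Edge} {h : Half} : h ∈ halves ω ↔ h.edge ∈ ω := by
  simp only [halves, Finset.mem_biUnion, Finset.mem_insert, Finset.mem_singleton]
  constructor
  · rintro ⟨e, he, rfl | rfl⟩
    · rwa [edge_half1]
    · rwa [edge_half2]
  · intro he
    refine ⟨h.edge, he, ?_⟩
    rcases half_cases h with ⟨h1, -⟩ | ⟨h1, -⟩
    · exact Or.inl h1
    · exact Or.inr h1

lemma opp_mem_halves {ω : Finset Edge} {h : Half} : opp h ∈ halves ω ↔ h ∈ halves ω := by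
  rw [mem_halves, mem_halves, edge_opp]

lemma halves_symmDiff (ω ω' : Finset Edge) :
    halves (symmDiff ω ω') = symmDiff (halves ω) (halves ω') := by
  ext h; simp [mem_halves, Finset.mem_symmDiff]

/-- The monomial of an edge. The order of the two halves is chosen so that the monomials of the
edges of a loop multiply to the sorted monomial, without a sign (see `IsBoundary.edgesMono_eq`). -/
def edgeMono (e : Edge) : Mono := gen (half2 e) * gen (half1 e)

lemma half1_ne_half2 (e : Edge) : half1 e ≠ half2 e := by
  rw [← opp_half1]; exact (opp_ne _).symm

lemma support_edgeMono (e : Edge) : (edgeMono e).support = halves {e} := by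
  have := half1_ne_half2 e
  ext h
  simp only [edgeMono, support_mul, support_gen, Finset.mem_symmDiff, Finset.mem_singleton, halves,
    Finset.singleton_biUnion, Finset.mem_insert]
  constructor
  · tauto
  · rintro (rfl | rfl)
    · exact Or.inr ⟨rfl, this⟩
    · exact Or.inl ⟨rfl, this.symm⟩

lemma card_edgeMono (e : Edge) : (edgeMono e).support.card = 2 := by
  rw [support_edgeMono, halves, Finset.singleton_biUnion, Finset.card_pair (half1_ne_half2 e)]

lemma edgeMono_mul_self (e : Edge) : edgeMono e * edgeMono e = (-1 : ℤˣ) • 1 := by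
  rw [edgeMono]
  have h := gen_mul_gen (half1_ne_half2 e)
  calc gen (half2 e) * gen (half1 e) * (gen (half2 e) * gen (half1 e))
      = gen (half2 e) * (gen (half1 e) * gen (half2 e)) * gen (half1 e) := by simp only [mul_assoc]
    _ = (-1 : ℤˣ) • (gen (half2 e) * gen (half2 e) * (gen (half1 e) * gen (half1 e))) := by
      rw [h, mul_smul_comm, smul_mul_assoc]; simp only [mul_assoc]
    _ = _ := by rw [gen_mul_self, gen_mul_self, one_mul]

lemma commute_edgeMono_of_notMem {x : Mono} {e : Edge} (h : ∀ k ∈ x.support, k.edge ≠ e) :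
    Commute (edgeMono e) x := by
  refine commute_of_even ?_ (by rw [card_edgeMono]; decide)
  rw [support_edgeMono, Finset.disjoint_left]
  intro k hk hx
  exact h k hx (by simpa [mem_halves] using hk)

lemma commute_edgeMono (e e' : Edge) : Commute (edgeMono e) (edgeMono e') := by
  by_cases h : e = e'
  · subst h; rfl
  · refine commute_edgeMono_of_notMem fun k hk => ?_
    rw [support_edgeMono, mem_halves, Finset.mem_singleton] at hk
    rw [hk]; exact fun he => h he.symm

/-- The product of the monomials of the edges of `ω`. They have even degree and hence commute. -/
def edgesMono (ω : Finset Edge) : Mono :=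
  ω.noncommProd edgeMono fun _ _ _ _ _ => commute_edgeMono _ _

@[simp] lemma edgesMono_empty : edgesMono ∅ = 1 := rfl

lemma edgesMono_insert {ω : Finset Edge} {e : Edge} (h : e ∉ ω) :
    edgesMono (insert e ω) = edgeMono e * edgesMono ω :=
  Finset.noncommProd_insert_of_notMem _ _ _ _ h

lemma edgesMono_union {ω ω' : Finset Edge} (h : Disjoint ω ω') :
    edgesMono (ω ∪ ω') = edgesMono ω * edgesMono ω' :=
  Finset.noncommProd_union_of_disjoint h _ _

lemma edgesMono_toFinset {l : List Edge} (h : l.Nodup) :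
    edgesMono l.toFinset = (l.map edgeMono).prod :=
  Finset.noncommProd_toFinset _ _ _ h

lemma support_edgesMono (ω : Finset Edge) : (edgesMono ω).support = halves ω := by
  induction ω using Finset.induction_on with
  | empty => rfl
  | insert e ω he ih =>
    rw [edgesMono_insert he, support_mul, ih, support_edgeMono, ← halves_symmDiff]
    congr 1
    ext x; simp only [Finset.mem_symmDiff, Finset.mem_singleton, Finset.mem_insert]
    constructor
    · tauto
    · rintro (rfl | h)
      · exact Or.inl ⟨rfl, he⟩
      · exact Or.inr ⟨h, fun e => he (e ▸ h)⟩

lemma commute_edgesMono {x : Mono} {ω : Finset Edge} (h : ∀ k ∈ x.support, k.edge ∉ ω) :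
    Commute (edgesMono ω) x :=
  (Finset.noncommProd_commute _ _ _ _ fun _ he =>
    (commute_edgeMono_of_notMem fun k hk hke => h k hk (hke ▸ he)).symm).symm

lemma edgesMono_commute (ω ω' : Finset Edge) : Commute (edgesMono ω) (edgesMono ω') :=
  (Finset.noncommProd_commute _ _ _ _ fun _ _ =>
    (Finset.noncommProd_commute _ _ _ _ fun e' _ => commute_edgeMono _ e').symm).symm

lemma edgesMono_symmDiff (ω ω' : Finset Edge) :
    edgesMono (symmDiff ω ω') = (-1 : ℤˣ) ^ (ω ∩ ω').card • (edgesMono ω * edgesMono ω') := by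
  have key : ∀ τ : Finset Edge, edgesMono τ * edgesMono τ = (-1 : ℤˣ) ^ τ.card • 1 := by
    intro τ
    induction τ using Finset.induction_on with
    | empty => simp
    | insert e τ he ih =>
      rw [edgesMono_insert he, Finset.card_insert_of_notMem he]
      have hc : Commute (edgesMono τ) (edgeMono e) := by
        have := edgesMono_commute τ {e}
        rwa [edgesMono, edgesMono, Finset.noncommProd_singleton] at this
      rw [mul_assoc, ← mul_assoc (edgesMono τ), hc.eq, mul_assoc, ih, ← mul_assoc,
        edgeMono_mul_self, smul_mul_assoc, mul_smul_comm, one_mul, smul_smul, pow_succ, mul_comm]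
  have h1 : ω = (ω \ ω') ∪ (ω ∩ ω') := (Finset.sdiff_union_inter _ _).symm
  have h2 : ω' = (ω ∩ ω') ∪ (ω' \ ω) := by
    rw [Finset.inter_comm, Finset.union_comm, Finset.sdiff_union_inter]
  have d1 : Disjoint (ω \ ω') (ω ∩ ω') := by
    rw [Finset.disjoint_left]; intro x; simp only [Finset.mem_sdiff, Finset.mem_inter]; tauto
  have d2 : Disjoint (ω ∩ ω') (ω' \ ω) := by
    rw [Finset.disjoint_left]; intro x; simp only [Finset.mem_sdiff, Finset.mem_inter]; tauto
  have e1 : edgesMono ω = edgesMono (ω \ ω') * edgesMono (ω ∩ ω') := by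
    rw [← edgesMono_union d1, ← h1]
  have e2 : edgesMono ω' = edgesMono (ω ∩ ω') * edgesMono (ω' \ ω) := by
    rw [← edgesMono_union d2, ← h2]
  have e3 : edgesMono (symmDiff ω ω') = edgesMono (ω \ ω') * edgesMono (ω' \ ω) := by
    rw [← edgesMono_union disjoint_sdiff_sdiff]; rfl
  rw [e1, e2, e3, mul_assoc, ← mul_assoc (edgesMono (ω ∩ ω')), key, smul_mul_assoc, one_mul,
    mul_smul_comm, smul_smul, Int.units_mul_self, one_smul]

/-- The sign by which the two halves of an edge, starting with the half that leaves its vertex in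
direction `d`, have to be permuted to give the monomial of the edge. -/
def stepSign (d : Fin 4) : ℤˣ := if d = 0 ∨ d = 1 then -1 else 1

lemma edgeMono_eq (h : Half) : edgeMono h.edge = stepSign h.2 • (gen h * gen (opp h)) := by
  rcases half_cases h with ⟨h1, h2⟩ | ⟨h1, h2⟩
  · have hs : stepSign h.2 = -1 := by rw [stepSign, if_pos h2]
    rw [hs]
    have : opp h = half2 h.edge := by conv_lhs => rw [h1, opp_half1]
    rw [this, ← gen_mul_gen (by rw [h1, edge_half1]; exact (half1_ne_half2 _).symm)]
    conv_rhs => rw [h1]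
    rw [edge_half1]; rfl
  · have hs : stepSign h.2 = 1 := by
      rw [stepSign, if_neg]; rcases h2 with h2 | h2 <;> rw [h2] <;> decide
    rw [hs, one_smul]
    have : opp h = half1 h.edge := by conv_lhs => rw [h1, opp_half2]
    rw [this]
    conv_rhs => rw [h1]
    rw [edge_half2]; rfl

open Mono

/-! ### Even subgraphs are boundaries of sets of faces -/

lemma prod_eq_prod_dirs (v : Vtx) (A : Finset Half) (g : Half → ℤˣ)
    (hg : ∀ h, h.1 ≠ v → g h = 1) :
    ∏ h ∈ A, g h = ∏ d : Fin 4, if (v, d) ∈ A then g (v, d) else 1 := by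
  have h1 : ∏ h ∈ A, g h = ∏ h ∈ A.filter (fun h => h.1 = v), g h := by
    rw [Finset.prod_filter]
    refine Finset.prod_congr rfl fun h _ => ?_
    split_ifs with hv
    · rfl
    · exact hg h hv
  rw [h1, ← Finset.prod_filter]
  refine Finset.prod_bij' (fun h _ => h.2) (fun d _ => (v, d)) ?_ ?_ ?_ ?_ ?_
  · rintro ⟨w, d⟩ h; simp only [Finset.mem_filter] at h ⊢; obtain ⟨h, rfl⟩ := h; simpa using h
  · intro d h; simpa using h
  · rintro ⟨w, d⟩ h; simp only [Finset.mem_filter] at h ⊢; obtain ⟨h, rfl⟩ := h; rfl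
  · intro d h; rfl
  · rintro ⟨w, d⟩ h; simp only [Finset.mem_filter] at h; obtain ⟨h, rfl⟩ := h; rfl

/-- A pair of half-edges at one vertex is only permuted non-trivially with half-edges at the same
vertex. -/
lemma inv_pair_right (v : Vtx) {d d' : Fin 4} (hd : d ≠ d') (A : Finset Half) :
    inv A {(v, d), (v, d')} =
      ∏ f : Fin 4, if (v, f) ∈ A then eps (v, f) (v, d) * eps (v, f) (v, d') else 1 := by
  have hne : ((v, d) : Half) ≠ (v, d') := fun h => hd (Prod.mk.inj h).2
  unfold inv
  simp only [Finset.prod_pair hne]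
  refine prod_eq_prod_dirs v A (fun h => eps h (v, d) * eps h (v, d')) ?_
  rintro ⟨w, f⟩ hw
  rw [eps_of_ne hw f f d d', Int.units_mul_self]

lemma inv_pair_left (v : Vtx) {d d' : Fin 4} (hd : d ≠ d') (A : Finset Half) :
    inv {(v, d), (v, d')} A =
      ∏ f : Fin 4, if (v, f) ∈ A then eps (v, d) (v, f) * eps (v, d') (v, f) else 1 := by
  have hne : ((v, d) : Half) ≠ (v, d') := fun h => hd (Prod.mk.inj h).2
  unfold inv
  rw [Finset.prod_pair hne, ← Finset.prod_mul_distrib]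
  refine prod_eq_prod_dirs v A (fun h => eps (v, d) h * eps (v, d') h) ?_
  rintro ⟨w, f⟩ hw
  rw [eps_of_ne (Ne.symm hw) d d' f f, Int.units_mul_self]

lemma gen_mul_gen_eq (v : Vtx) {d d' : Fin 4} (hd : d ≠ d') :
    gen (v, d) * gen (v, d') = ⟨{(v, d), (v, d')}, eps (v, d) (v, d')⟩ := by
  have hne : ((v, d) : Half) ≠ (v, d') := fun h => hd (Prod.mk.inj h).2
  ext1
  · ext x
    simp only [support_mul, support_gen, Finset.mem_symmDiff, Finset.mem_singleton,
      Finset.mem_insert]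
    constructor
    · tauto
    · rintro (rfl | rfl)
      · exact Or.inl ⟨rfl, hne⟩
      · exact Or.inr ⟨rfl, hne.symm⟩
  · simp [sign_mul, inv]

/-- `-1` if the statement holds, `1` otherwise. -/
def sgn (p : Prop) [Decidable p] : ℤˣ := if p then -1 else 1

/-- The four sides of a face. -/
def sides (f : Face) : Finset Edge :=
  {(f, false), (f, true), (f + (0, 1), false), (f + (1, 0), true)}

lemma edgesMono_sides_eq (f : Face) : edgesMono (sides f) =
    gen (f, 0) * gen (f, 1) * (gen (f + (1, 0), 1) * gen (f + (1, 0), 2)) *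
      (gen (f + (1, 1), 2) * gen (f + (1, 1), 3)) *
      (gen (f + (0, 1), 0) * gen (f + (0, 1), 3)) := by
  obtain ⟨x, y⟩ := f
  have h1 : edgesMono (sides (x, y)) = edgeMono ((x, y), false) * (edgeMono ((x + 1, y), true) *
      (edgeMono ((x, y + 1), false) * edgeMono ((x, y), true))) := by
    have : sides (x, y) = insert ((x, y), false) (insert ((x + 1, y), true)
        (insert ((x, y + 1), false) {((x, y), true)})) := by
      ext e; simp [sides]; tauto
    rw [this, edgesMono_insert (by simp), edgesMono_insert (by simp), edgesMono_insert (by simp)]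
    simp [edgesMono]
  rw [h1]
  have b1 : edgeMono ((x, y), false) = (-1 : ℤˣ) • (gen ((x, y), 0) * gen ((x + 1, y), 2)) := by
    simpa [Half.edge, edgeOf, stepSign, opp, dirVec] using edgeMono_eq ((x, y), 0)
  have b2 : edgeMono ((x + 1, y), true)
      = (-1 : ℤˣ) • (gen ((x + 1, y), 1) * gen ((x + 1, y + 1), 3)) := by
    simpa [Half.edge, edgeOf, stepSign, opp, dirVec] using edgeMono_eq ((x + 1, y), 1)
  have b3 : edgeMono ((x, y + 1), false)
      = (gen ((x + 1, y + 1), 2) * gen ((x, y + 1), 0)) := by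
    simpa [Half.edge, edgeOf, stepSign, opp, dirVec] using edgeMono_eq ((x + 1, y + 1), 2)
  have b4 : edgeMono ((x, y), true)
      = (gen ((x, y + 1), 3) * gen ((x, y), 1)) := by
    simpa [Half.edge, edgeOf, stepSign, opp, dirVec] using edgeMono_eq ((x, y + 1), 3)
  rw [b1, b2, b3, b4]
  simp only [smul_mul_assoc, mul_smul_comm, smul_smul, Int.units_mul_self, one_smul]
  simp only [Prod.mk_add_mk, add_zero]
  set A := gen ((x, y), 0)
  set B := gen ((x, y), 1) with hB
  set C := gen ((x + 1, y), 1) with hC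
  set D := gen ((x + 1, y), 2) with hD
  set E := gen ((x + 1, y + 1), 2) with hE
  set F := gen ((x + 1, y + 1), 3) with hF
  set G := gen ((x, y + 1), 0) with hG
  set H := gen ((x, y + 1), 3) with hH
  have e1 : D * C = (-1 : ℤˣ) • (C * D) := gen_mul_gen (by simp)
  have e2 : F * E = (-1 : ℤˣ) • (E * F) := gen_mul_gen (by simp)
  have e3 : Commute B ((C * D) * (E * F) * (G * H)) := by
    have hc : ∀ (v : Vtx) (d d' : Fin 4), v ≠ (x, y) → d ≠ d' →
        Commute B (gen (v, d) * gen (v, d')) := by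
      intro v d d' hv hd
      refine (commute_of_even ?_ ?_).symm
      · rw [gen_mul_gen_eq v hd]; simp [hB, Ne.symm hv]
      · rw [gen_mul_gen_eq v hd]
        rw [Finset.card_pair (fun h => hd (Prod.mk.inj h).2)]; decide
    exact ((hc _ _ _ (by simp) (by decide)).mul_right (hc _ _ _ (by simp) (by decide))).mul_right
      (hc _ _ _ (by simp) (by decide))
  calc A * D * (C * F * (E * G * (H * B)))
      = A * ((D * C) * (F * E) * (G * H) * B) := by simp only [mul_assoc]
    _ = A * ((C * D) * (E * F) * (G * H) * B) := by
      rw [e1, e2]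
      simp only [smul_mul_assoc, mul_smul_comm, smul_smul, Int.units_mul_self, one_smul]
    _ = A * (B * ((C * D) * (E * F) * (G * H))) := by rw [e3.eq]
    _ = _ := by simp only [mul_assoc]

lemma par_halves_sides (f : Face) (v : Vtx) : par v (halves (sides f)) = 1 := by
  rw [← support_edgesMono, edgesMono_sides_eq]
  simp only [par_mul, par_gen, Int.units_mul_self, mul_one]

lemma eps_same (v : Vtx) (d f : Fin 4) : eps (v, d) (v, f) = if f < d then -1 else 1 := by
  simp [eps]

/-- The sign of a corner of a face next to a set which is even at its vertex. -/
lemma inv_corner (v : Vtx) (A : Finset Half) (hA : par v A = 1) :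
    inv A {(v, 0), (v, 1)} = sgn ((v, 1) ∈ A) ∧ inv A {(v, 1), (v, 2)} = sgn ((v, 2) ∈ A) ∧
    inv A {(v, 2), (v, 3)} = sgn ((v, 3) ∈ A) ∧ inv A {(v, 0), (v, 3)} = sgn ((v, 0) ∈ A) := by
  rw [par_eq_prod] at hA
  simp only [inv_pair_right v (show (0 : Fin 4) ≠ 1 by decide),
    inv_pair_right v (show (1 : Fin 4) ≠ 2 by decide),
    inv_pair_right v (show (2 : Fin 4) ≠ 3 by decide),
    inv_pair_right v (show (0 : Fin 4) ≠ 3 by decide), eps_same, Fin.prod_univ_four, sgn] at hA ⊢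
  by_cases h0 : (v, 0) ∈ A <;> by_cases h1 : (v, 1) ∈ A <;> by_cases h2 : (v, 2) ∈ A <;>
    by_cases h3 : (v, 3) ∈ A <;> simp only [h0, h1, h2, h3, if_true, if_false] at hA ⊢ <;>
    revert hA <;> decide

lemma neg_one_pow_card_inter {ι : Type*} [DecidableEq ι] (A B : Finset ι) :
    (-1 : ℤˣ) ^ (A ∩ B).card = ∏ e ∈ B, sgn (e ∈ A) := by
  rw [← Finset.prod_const, Finset.inter_comm, ← Finset.filter_mem_eq_inter, Finset.prod_filter]
  rfl

/-- The effect on the sign of a monomial, even at every vertex, of multiplication by the boundary of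
a face, in terms of the half-edges around that face. -/
lemma sign_mul_sides (A : Finset Half) (hA : ∀ v, par v A = 1) (f : Face) (s : ℤˣ) :
    (⟨A, s⟩ * edgesMono (sides f)).sign = s * (sgn ((f, 1) ∈ A) * sgn ((f + (1, 0), 2) ∈ A) *
      sgn ((f + (1, 1), 3) ∈ A) * sgn ((f + (0, 1), 0) ∈ A)) := by
  have step : ∀ (x y : Mono) (B : Finset Half), y = ⟨B, 1⟩ →
      (x * y).sign = x.sign * inv x.support B := by
    rintro x y B rfl; simp [sign_mul]
  have hlt : ∀ (v : Vtx) (d d' : Fin 4), d < d' → gen (v, d) * gen (v, d') = ⟨{(v, d), (v, d')}, 1⟩ := by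
    intro v d d' hd
    rw [gen_mul_gen_eq v hd.ne, eps_same, if_neg (not_lt.2 hd.le)]
  rw [edgesMono_sides_eq, hlt _ 0 1 (by decide), hlt _ 1 2 (by decide), hlt _ 2 3 (by decide),
    hlt _ 0 3 (by decide), ← mul_assoc, ← mul_assoc, ← mul_assoc]
  rw [step _ _ _ rfl, step _ _ _ rfl, step _ _ _ rfl, step _ _ _ rfl]
  have hout : ∀ (v w : Vtx) (d d' k k' : Fin 4), v ≠ w → d ≠ d' → k ≠ k' →
      inv {(v, d), (v, d')} {(w, k), (w, k')} = 1 := by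
    intro v w d d' k k' hv hd hk
    rw [inv_pair_right w hk]
    refine Finset.prod_eq_one fun j _ => ?_
    rw [if_neg]
    simp [Ne.symm hv]
  simp only [support_mul]
  simp only [inv_symmDiff_left]
  rw [hout _ _ _ _ _ _ (by simp [Prod.ext_iff]) (by decide) (by decide),
    hout _ _ _ _ _ _ (by simp [Prod.ext_iff]) (by decide) (by decide),
    hout _ _ _ _ _ _ (by simp [Prod.ext_iff]) (by decide) (by decide),
    hout _ _ _ _ _ _ (by simp [Prod.ext_iff]) (by decide) (by decide),
    hout _ _ _ _ _ _ (by simp [Prod.ext_iff]) (by decide) (by decide),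
    hout _ _ _ _ _ _ (by simp [Prod.ext_iff]) (by decide) (by decide)]
  rw [(inv_corner f A (hA _)).1, (inv_corner _ A (hA _)).2.1, (inv_corner _ A (hA _)).2.2.1,
    (inv_corner _ A (hA _)).2.2.2]
  simp only [mul_one, mul_assoc]

/-- The set `ω` of edges consists of the sides that separate a face in `M` from one not in `M`. -/
def IsBoundary (M : Finset Face) (ω : Finset Edge) : Prop :=
  ∀ e : Edge, e ∈ ω ↔ ¬(e.1 ∈ M ↔ (if e.2 then e.1 + (-1, 0) else e.1 + (0, -1)) ∈ M)

lemma mem_sides (f : Face) (e : Edge) :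
    e ∈ sides f ↔ e.1 = f ∨ (if e.2 then e.1 + (-1, 0) else e.1 + (0, -1)) = f := by
  obtain ⟨x, y⟩ := f
  obtain ⟨⟨x', y'⟩, d⟩ := e
  cases d <;> simp [sides] <;> omega

/-- The monomials of the edges of an even subgraph multiply to the sorted monomial of its
half-edges. The sign is that of a disjoint union of loops without crossings in the plane: adding
the boundary of a face changes the signs at its corners and at the common edges alike. -/
theorem IsBoundary.edgesMono_eq {M : Finset Face} {ω : Finset Edge} (h : IsBoundary M ω) :
    edgesMono ω = ⟨halves ω, 1⟩ ∧ ∀ v, par v (halves ω) = 1 := by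
  induction M using Finset.induction_on generalizing ω with
  | empty =>
    have : ω = ∅ := by
      ext e; simpa using h e
    subst this
    exact ⟨rfl, fun v => rfl⟩
  | insert f M hf ih =>
    have h' : IsBoundary M (symmDiff ω (sides f)) := by
      intro e
      have he := h e
      have hn : e.1 ≠ (if e.2 then e.1 + (-1, 0) else e.1 + (0, -1)) := by
        obtain ⟨⟨x', y'⟩, d⟩ := e
        cases d <;> simp
      rw [Finset.mem_symmDiff, he, mem_sides]
      simp only [Finset.mem_insert]
      by_cases h1 : e.1 = f
      · rw [h1] at hn ⊢
        have h2 := Ne.symm hn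
        simp only at h2 hn ⊢
        simp only [h2, hf]; tauto
      · by_cases h2 : (if e.2 then e.1 + (-1, 0) else e.1 + (0, -1)) = f
        · simp only [h1, h2, hf]; tauto
        · simp only [h1, h2]; tauto
    obtain ⟨e1, e2⟩ := ih h'
    set τ := symmDiff ω (sides f) with hτ
    have hω : ω = symmDiff τ (sides f) := by
      rw [hτ, symmDiff_symmDiff_cancel_right]
    have hp : ∀ v, par v (halves ω) = 1 := by
      intro v
      rw [hω, halves_symmDiff, par_symmDiff, e2, par_halves_sides, one_mul]
    refine ⟨?_, hp⟩
    ext1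
    · exact support_edgesMono ω
    · rw [hω, edgesMono_symmDiff, sign_smul, e1, sign_mul_sides _ e2, neg_one_pow_card_inter]
      obtain ⟨x, y⟩ := f
      simp only [mem_halves, Half.edge, edgeOf]
      simp [sides]
      generalize sgn (((x, y), false) ∈ τ) = a1
      generalize sgn (((x, y), true) ∈ τ) = a2
      generalize sgn (((x, y + 1), false) ∈ τ) = a3
      generalize sgn (((x + 1, y), true) ∈ τ) = a4
      revert a1 a2 a3 a4
      decide

/-! ### The number of loops around a face -/

/-- The sign `edgeCut` as a unit. -/
def cut (a : Face) (e : Edge) : ℤˣ := sgn (e.2 = true ∧ e.1.2 = a.2 ∧ a.1 + 1 ≤ e.1.1)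

lemma coe_cut (a : Face) (e : Edge) : ((cut a e : ℤˣ) : ℤ) = edgeCut a e := by
  unfold cut sgn edgeCut; split_ifs <;> rfl

/-- The sign `loopSign` as a unit. -/
def loops (a : Face) (ω : Finset Edge) : ℤˣ := ∏ e ∈ ω, cut a e

lemma coe_loops (a : Face) (ω : Finset Edge) : ((loops a ω : ℤˣ) : ℤ) = loopSign a ω := by
  simp [loops, loopSign, ← coe_cut]

lemma loops_vert (ω : Finset Edge) (k n : ℤ) :
    loops (k - 1, n) ω = loops (k, n) ω * sgn (((k, n), true) ∈ ω) := by
  have h : sgn (((k, n), true) ∈ ω) = ∏ e ∈ ω, sgn (e = ((k, n), true)) := by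
    unfold sgn; rw [Finset.prod_ite_eq']
  rw [h, loops, loops, ← Finset.prod_mul_distrib]
  refine Finset.prod_congr rfl ?_
  rintro ⟨⟨x, y⟩, d⟩ -
  simp only [cut, sgn, Prod.mk.injEq]
  cases d
  · simp
  · simp only [true_and, and_true]
    split_ifs <;> first | rfl | omega

lemma exists_bound (ω : Finset Edge) : ∃ B : ℤ, 0 ≤ B ∧ ∀ e ∈ ω, |e.1.1| ≤ B ∧ |e.1.2| ≤ B := by
  refine ⟨∑ e ∈ ω, (|e.1.1| + |e.1.2|), Finset.sum_nonneg fun e _ => by positivity, ?_⟩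
  intro e he
  have := Finset.single_le_sum (f := fun e : Edge => |e.1.1| + |e.1.2|)
    (fun e _ => by positivity) he
  have h1 := abs_nonneg e.1.1
  have h2 := abs_nonneg e.1.2
  omega

lemma loops_eq_one (ω : Finset Edge) (f : Face)
    (h : ∀ e ∈ ω, e.1.2 = f.2 → e.1.1 ≤ f.1) : loops f ω = 1 := by
  refine Finset.prod_eq_one fun e he => ?_
  rw [cut, sgn, if_neg]
  rintro ⟨-, h2, h3⟩
  have := h e he h2
  omega

lemma loops_horiz {ω : Finset Edge} (h : ∀ v, par v (halves ω) = 1) (k n : ℤ) :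
    loops (k, n - 1) ω = loops (k, n) ω * sgn (((k, n), false) ∈ ω) := by
  obtain ⟨B, hB0, hB⟩ := exists_bound ω
  have far : ∀ k n : ℤ, B < k → loops (k, n - 1) ω = loops (k, n) ω * sgn (((k, n), false) ∈ ω) := by
    intro k n hk
    have hb : ∀ e ∈ ω, e.1.1 ≤ k := fun e he => by
      have := le_abs_self e.1.1
      have := (hB e he).1
      omega
    rw [loops_eq_one ω (k, n - 1) fun e he _ => hb e he, loops_eq_one ω (k, n) fun e he _ => hb e he,
      sgn, if_neg]
    · rfl
    · intro he
      have := (hB _ he).1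
      have := le_abs_self k
      simp only at *
      omega
  have step : ∀ k : ℤ, loops (k, n - 1) ω = loops (k, n) ω * sgn (((k, n), false) ∈ ω) →
      loops (k - 1, n - 1) ω = loops (k - 1, n) ω * sgn (((k - 1, n), false) ∈ ω) := by
    intro k ih
    have hp := h (k, n)
    rw [par_eq_prod, Fin.prod_univ_four] at hp
    simp only [mem_halves, Half.edge, edgeOf] at hp
    simp at hp
    rw [loops_vert, loops_vert, ih]
    simp only [sgn, sub_eq_add_neg] at *
    revert hp
    generalize loops (k, n) ω = x
    split_ifs <;> revert x <;> decide
  obtain ⟨m, hm⟩ : ∃ m : ℕ, B < k + m := ⟨(B - k + 1).toNat, by omega⟩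
  have aux : ∀ m : ℕ, ∀ k : ℤ, B < k + m →
      loops (k, n - 1) ω = loops (k, n) ω * sgn (((k, n), false) ∈ ω) := by
    intro m
    induction m with
    | zero => intro k hk; exact far k n (by simpa using hk)
    | succ m ih =>
      intro k hk
      have := step (k + 1) (ih (k + 1) (by push_cast at hk; omega))
      simpa using this
  exact aux m k hm

/-- An even subgraph is the boundary of the set of the faces around which it has an odd number of
loops. -/
lemma exists_boundary {ω : Finset Edge} (h : ∀ v, par v (halves ω) = 1) :
    ∃ M : Finset Face, (∀ f, f ∈ M ↔ loops f ω = -1) ∧ IsBoundary M ω := by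
  obtain ⟨B, hB0, hB⟩ := exists_bound ω
  have hB' : ∀ e ∈ ω, -B ≤ e.1.1 ∧ e.1.1 ≤ B ∧ -B ≤ e.1.2 ∧ e.1.2 ≤ B := fun e he => by
    have := hB e he
    rw [abs_le, abs_le] at this; tauto
  have left : ∀ k n : ℤ, k < -B → loops (k, n) ω = 1 := by
    intro k n hk
    have aux : ∀ m : ℕ, ∀ n : ℤ, B < n + m → loops (k, n) ω = 1 := by
      intro m
      induction m with
      | zero =>
        intro n hn
        refine loops_eq_one ω _ fun e he h2 => ?_
        have := hB' e he
        simp at h2 hn; omega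
      | succ m ih =>
        intro n hn
        have := loops_horiz h k (n + 1)
        rw [ih (n + 1) (by push_cast at hn; omega)] at this
        simp only [add_sub_cancel_right] at this
        rw [this, sgn, if_neg]
        · rfl
        · intro he
          have := hB' _ he
          simp only at this; omega
    exact aux (B - n + 1).toNat n (by omega)
  have key : ∀ f : Face, loops f ω = -1 → f ∈ Finset.Icc (-B) B ×ˢ Finset.Icc (-B) B := by
    rintro ⟨k, n⟩ hf
    have h1 : -B ≤ k := by
      by_contra hk
      rw [left k n (by omega)] at hf; exact absurd hf (by decide)
    have h2 : k ≤ B := by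
      by_contra hk
      rw [loops_eq_one ω (k, n) fun e he _ => by have := hB' e he; simp only; omega] at hf
      exact absurd hf (by decide)
    have h3 : -B ≤ n ∧ n ≤ B := by
      by_contra hk
      rw [loops_eq_one ω (k, n) fun e he h2 => by have := hB' e he; simp only at *; omega] at hf
      exact absurd hf (by decide)
    simp; omega
  refine ⟨(Finset.Icc (-B) B ×ˢ Finset.Icc (-B) B).filter fun f => loops f ω = -1,
    fun f => ?_, ?_⟩
  · rw [Finset.mem_filter]; exact ⟨fun h => h.2, fun h => ⟨key f h, h⟩⟩
  · have hm : ∀ f, f ∈ (Finset.Icc (-B) B ×ˢ Finset.Icc (-B) B).filter (fun f => loops f ω = -1) ↔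
        loops f ω = -1 := fun f => by
      rw [Finset.mem_filter]; exact ⟨fun h => h.2, fun h => ⟨key f h, h⟩⟩
    rintro ⟨⟨k, n⟩, d⟩
    rw [hm, hm]
    cases d
    · have := loops_horiz h k n
      rw [sub_eq_add_neg] at this
      simp only [Prod.mk_add_mk, add_zero, Bool.false_eq_true, if_false]
      rw [this, sgn]
      split_ifs with he <;> simp only [he, true_iff, false_iff] <;>
        generalize loops (k, n) ω = x <;> revert x <;> decide
    · have := loops_vert ω k n
      rw [sub_eq_add_neg] at this
      simp only [Prod.mk_add_mk, add_zero, if_true]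
      rw [this, sgn]
      split_ifs with he <;> simp only [he, true_iff, false_iff] <;>
        generalize loops (k, n) ω = x <;> revert x <;> decide

/-- The monomials of the edges of an even subgraph of the plane multiply to the sorted monomial of
its half-edges. This is where planarity enters. -/
theorem edgesMono_of_even {ω : Finset Edge} (h : ∀ v, par v (halves ω) = 1) :
    edgesMono ω = ⟨halves ω, 1⟩ := by
  obtain ⟨M, -, hM⟩ := exists_boundary h
  exact hM.edgesMono_eq.1

/-! ### The sign of a walk -/

/-- The half-edge of a doubly oriented medial vertex: the one its orientation runs along. -/
def OPoint.half (x : OPoint) : Half := (x.head, x.dir + 2)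

lemma OPoint.opp_half (x : OPoint) : opp x.half = (x.tail, x.dir) := by
  have : x.half = opp (x.tail, x.dir) := rfl
  rw [this, opp_opp]

lemma OPoint.edge_half (x : OPoint) : x.half.edge = x.edge := by
  rw [← edge_opp, x.opp_half]; rfl

lemma OPoint.half_flip (x : OPoint) : x.flip.half = opp x.half := rfl

lemma OPoint.edge_flip (x : OPoint) : x.flip.edge = x.edge := by
  rw [← OPoint.edge_half, x.half_flip, edge_opp, x.edge_half]

/-- The sign of the passage through a vertex that is entered in direction `d` and left in
direction `f`: it sorts the two half-edges involved. -/
def passSign (d f : Fin 4) : ℤˣ := if f < d + 2 then -1 else 1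

/-- The sign of a walk that arrives in direction `d`, makes the steps `ds`, and leaves in
direction `d'`. -/
def walkSign : Fin 4 → List (Fin 4) → Fin 4 → ℤˣ
  | d, [], d' => passSign d d'
  | d, f :: fs, d' => passSign d f * stepSign f * walkSign f fs d'

/-- The product of the half-edges of a walk, in the order in which they are passed. -/
def walkMono (v : Vtx) (d : Fin 4) (ds : List (Fin 4)) (d' : Fin 4) : Mono :=
  gen (v, d + 2) * ((walkEdges v ds).map edgeMono).prod * gen (walkEnd v ds, d')

lemma walkMono_nil (v : Vtx) (d d' : Fin 4) :
    walkMono v d [] d' = gen (v, d + 2) * gen (v, d') := by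
  simp [walkMono, walkEdges, walkEnd]

lemma walkMono_cons (v : Vtx) (d f : Fin 4) (fs : List (Fin 4)) (d' : Fin 4) :
    walkMono v d (f :: fs) d' = stepSign f •
      (gen (v, d + 2) * gen (v, f) * walkMono (v + dirVec f) f fs d') := by
  have := edgeMono_eq (v, f)
  simp only [Half.edge, opp] at this
  simp only [walkMono, walkEdges, walkEnd, List.map_cons, List.prod_cons, this]
  simp only [smul_mul_assoc, mul_smul_comm, mul_assoc]

/-- Number of half-edges of `A` at `v`. -/
def hdeg (A : Finset Half) (v : Vtx) : ℕ := (A.filter fun h => h.1 = v).card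

lemma hdeg_eq (A : Finset Half) (v : Vtx) :
    hdeg A v = (Finset.univ.filter fun d => (v, d) ∈ A).card := by
  refine Finset.card_bij' (fun h _ => h.2) (fun d _ => (v, d)) ?_ ?_ ?_ ?_
  · rintro ⟨w, d⟩ h; simp only [Finset.mem_filter] at h ⊢; obtain ⟨h, rfl⟩ := h; simpa using h
  · intro d h; simpa using h
  · rintro ⟨w, d⟩ h; simp only [Finset.mem_filter] at h ⊢; obtain ⟨h, rfl⟩ := h; rfl
  · intro d h; rfl

lemma hdeg_eq_four {A : Finset Half} {v : Vtx} (h : ∀ d, (v, d) ∈ A) : hdeg A v = 4 := by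
  rw [hdeg_eq]; simp [h]

/-- A passage through `v` can be split off from a set `X` which is even at `v`, provided that it
does not cross `X`. -/
lemma pass_mul {v : Vtx} {d f : Fin 4} {X : Mono} {A : Finset Half} (hdf : d + 2 ≠ f)
    (hX : par v X.support = 1) (hd : (v, d + 2) ∉ X.support) (hf : (v, f) ∉ X.support)
    (hXA : X.support ⊆ A) (hdA : (v, d + 2) ∈ A) (hfA : (v, f) ∈ A)
    (ht : hdeg A v = 4 → d ≠ f) :
    (gen (v, d + 2) * gen (v, f) * X).sign = passSign d f * X.sign := by
  have hs : d = f → ∀ k, (v, k) ∉ X.support := by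
    rintro rfl k hk
    refine ht (hdeg_eq_four fun j => ?_) rfl
    by_cases hj : j = d ∨ j = d + 2
    · rcases hj with rfl | rfl <;> assumption
    · refine hXA ?_
      by_contra hjX
      rw [par_eq_prod, Fin.prod_univ_four] at hX
      have hj' : k ≠ d ∧ k ≠ d + 2 ∧ k ≠ j := by
        refine ⟨?_, ?_, ?_⟩ <;> rintro rfl <;> contradiction
      have aux : ∀ d j k : Fin 4, ¬(j = d ∨ j = d + 2) → (k ≠ d ∧ k ≠ d + 2 ∧ k ≠ j) →
          ∀ m : Fin 4, m = d ∨ m = d + 2 ∨ m = j ∨ m = k := by decide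
      have h2 : ∀ m, ((v, m) ∈ X.support ↔ m = k) := by
        intro m
        rcases aux d j k hj hj' m with rfl | rfl | rfl | rfl
        · simp only [hf, false_iff]; exact hj'.1.symm
        · simp only [hd, false_iff]; exact hj'.2.1.symm
        · simp only [hjX, false_iff]; exact hj'.2.2.symm
        · simp only [hk]
      simp only [h2] at hX
      revert hX
      clear * -
      revert k; decide
  rw [gen_mul_gen_eq v hdf, sign_mul, inv_pair_left v hdf, eps_same]
  rw [par_eq_prod] at hX
  unfold passSign
  simp only [Fin.prod_univ_four, eps_same] at hX ⊢
  have hd' : ∀ k, (v, k) ∈ X.support → k ≠ d + 2 ∧ k ≠ f ∧ d ≠ f := by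
    intro k hk
    refine ⟨?_, ?_, fun h => hs h k hk⟩ <;> rintro rfl <;> contradiction
  have a0 := hd' 0
  have a1 := hd' 1
  have a2 := hd' 2
  have a3 := hd' 3
  generalize X.sign = s
  clear hd' hs hd hf ht hXA hdA hfA
  by_cases h0 : (v, 0) ∈ X.support <;> by_cases h1 : (v, 1) ∈ X.support <;>
    by_cases h2 : (v, 2) ∈ X.support <;> by_cases h3 : (v, 3) ∈ X.support <;>
    simp only [h0, h1, h2, h3, if_true, if_false, forall_true_left, false_imp_iff] at hX a0 a1 a2 a3 ⊢ <;>
    first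
    | (exact absurd hX (by decide))
    | (clear hX h0 h1 h2 h3; revert s d f; decide)

lemma support_walkMono_subset (v : Vtx) (d : Fin 4) (ds : List (Fin 4)) (d' : Fin 4) {h : Half}
    (hh : h ∈ (walkMono v d ds d').support) :
    h = (v, d + 2) ∨ h.edge ∈ walkEdges v ds ∨ h = (walkEnd v ds, d') := by
  have aux : ∀ l : List Edge, ∀ h, h ∈ ((l.map edgeMono).prod).support → h.edge ∈ l := by
    intro l
    induction l with
    | nil => intro h hh; simp at hh
    | cons e l ih =>
      intro h hh
      rw [List.map_cons, List.prod_cons, support_mul, Finset.mem_symmDiff] at hh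
      rcases hh with ⟨h1, -⟩ | ⟨h1, -⟩
      · rw [support_edgeMono, mem_halves, Finset.mem_singleton] at h1
        exact h1 ▸ List.mem_cons_self
      · exact List.mem_cons_of_mem _ (ih h h1)
  unfold walkMono at hh
  simp only [support_mul, support_gen, Finset.mem_symmDiff, Finset.mem_singleton] at hh
  rcases hh with ⟨⟨h1, -⟩ | ⟨h1, -⟩, -⟩ | ⟨h1, -⟩
  · exact Or.inl h1
  · exact Or.inr (Or.inl (aux _ _ h1))
  · exact Or.inr (Or.inr h1)

lemma par_walkMono (w : Vtx) (ds : List (Fin 4)) : ∀ (v : Vtx) (d d' : Fin 4),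
    par w (walkMono v d ds d').support = 1 := by
  induction ds with
  | nil =>
    intro v d d'
    rw [walkMono_nil, par_mul, par_gen, par_gen, Int.units_mul_self]
  | cons f fs ih =>
    intro v d d'
    rw [walkMono_cons, support_smul, par_mul, par_mul, ih, par_gen, par_gen, mul_one,
      Int.units_mul_self]

/-- The condition that a walk uses no half-edge twice. -/
structure IsSimpleWalk (v : Vtx) (d : Fin 4) (ds : List (Fin 4)) (d' : Fin 4) : Prop where
  nodup : (walkEdges v ds).Nodup
  start_notMem : Half.edge (v, d + 2) ∉ walkEdges v ds
  end_notMem : Half.edge (walkEnd v ds, d') ∉ walkEdges v ds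
  ne : ((v, d + 2) : Half) ≠ (walkEnd v ds, d')

lemma IsSimpleWalk.tail {v : Vtx} {d f : Fin 4} {fs : List (Fin 4)} {d' : Fin 4}
    (h : IsSimpleWalk v d (f :: fs) d') : IsSimpleWalk (v + dirVec f) f fs d' := by
  have hn := h.nodup
  have he := h.end_notMem
  simp only [walkEdges, List.nodup_cons, walkEnd, List.mem_cons, not_or] at hn he
  have ho : Half.edge (v + dirVec f, f + 2) = edgeOf v f := edge_opp (v, f)
  refine ⟨hn.2, by rw [ho]; exact hn.1, he.2, fun e => he.1 ?_⟩
  rw [← e, ho]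

lemma IsSimpleWalk.ne_cons {v : Vtx} {d f : Fin 4} {fs : List (Fin 4)} {d' : Fin 4}
    (h : IsSimpleWalk v d (f :: fs) d') : d + 2 ≠ f := by
  have hn := h.start_notMem
  simp only [walkEdges, List.mem_cons, not_or] at hn
  rintro rfl
  exact hn.1 rfl

/-- A simple walk that turns at the ambiguous vertices can be split off from an even set `R` of
remaining half-edges: it contributes the sign of the walk. -/
lemma walkMono_mul {A : Finset Half} {X : Mono} (hX : ∀ w, par w X.support = 1)
    (hXA : X.support ⊆ A) (ds : List (Fin 4)) : ∀ (v : Vtx) (d d' : Fin 4),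
    IsSimpleWalk v d ds d' →
    (∀ h ∈ X.support, h ≠ (v, d + 2) ∧ h.edge ∉ walkEdges v ds ∧ h ≠ (walkEnd v ds, d')) →
    (v, d + 2) ∈ A → (∀ h : Half, h.edge ∈ walkEdges v ds → h ∈ A) → (walkEnd v ds, d') ∈ A →
    TurnsAtAmbiguity (hdeg A) v d ds d' →
    (walkMono v d ds d' * X).sign = walkSign d ds d' * X.sign := by
  induction ds with
  | nil =>
    intro v d d' hw hXd h1 h2 h3 ht
    have hne : d + 2 ≠ d' := fun h => hw.ne (by rw [h]; rfl)
    rw [walkMono_nil]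
    exact pass_mul hne (hX v) (fun h => (hXd _ h).1 rfl) (fun h => (hXd _ h).2.2 rfl) hXA h1 h3 ht
  | cons f fs ih =>
    intro v d d' hw hXd h1 h2 h3 ht
    have ho : Half.edge (v + dirVec f, f + 2) = edgeOf v f := edge_opp (v, f)
    have hs := hw.start_notMem
    have hn := hw.nodup
    have he := hw.end_notMem
    simp only [walkEdges, List.nodup_cons, walkEnd, List.mem_cons, not_or] at hn he hs h2 hXd h3
    have hI := ih (v + dirVec f) f d' hw.tail (fun h hh => ⟨?_, (hXd h hh).2.1.2, (hXd h hh).2.2⟩)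
      (h2 _ (Or.inl ho)) (fun h hh => h2 h (Or.inr hh)) h3 ht.2
    · rw [walkMono_cons, smul_mul_assoc, sign_smul, mul_assoc]
      have hmem : ∀ h ∈ (walkMono (v + dirVec f) f fs d' * X).support,
          h ∈ X.support ∨ h = (v + dirVec f, f + 2) ∨ h.edge ∈ walkEdges (v + dirVec f) fs ∨
            h = (walkEnd (v + dirVec f) fs, d') := by
        intro h hh
        rw [support_mul, Finset.mem_symmDiff] at hh
        rcases hh with ⟨hh, -⟩ | ⟨hh, -⟩
        · exact Or.inr (support_walkMono_subset _ _ _ _ hh)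
        · exact Or.inl hh
      rw [pass_mul (A := A) hw.ne_cons ?_ ?_ ?_ ?_ h1 (h2 _ (Or.inl rfl)) ht.1, hI, walkSign]
      · simp only [mul_assoc, mul_left_comm]
      · rw [par_mul, par_walkMono, hX, one_mul]
      · intro hh
        rcases hmem _ hh with h | h | h | h
        · exact (hXd _ h).1 rfl
        · exact hs.1 (by rw [h, ho])
        · exact hs.2 h
        · exact hw.ne h
      · intro hh
        rcases hmem _ hh with h | h | h | h
        · exact (hXd _ h).2.1.1 rfl
        · exact opp_ne (v, f) h.symm
        · exact hn.1 h
        · exact he.1 (by rw [← h]; rfl)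
      · intro h hh
        rcases hmem _ hh with h | h | h | h
        · exact hXA h
        · rw [h]; exact h2 _ (Or.inl ho)
        · exact h2 _ (Or.inr h)
        · rw [h]; exact h3
    · rintro rfl
      exact (hXd _ hh).2.1.1 ho

/-! ### The phase of a walk -/

/-- The standard square root of the direction `d`. -/
def stdRoot (d : Fin 4) : ℂ :=
  Complex.exp (Complex.I * (Real.pi / 8)) * Complex.exp (Complex.I * (Real.pi / 4)) ^ (d : ℕ)

lemma stdRoot_ne_zero (d : Fin 4) : stdRoot d ≠ 0 :=
  mul_ne_zero (Complex.exp_ne_zero _) (pow_ne_zero _ (Complex.exp_ne_zero _))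

lemma stdRoot_sq (d : Fin 4) : stdRoot d ^ 2 = orient d := (OPoint.std (0, 0) d 1).root_sq

lemma exp_pi_four_sq : Complex.exp (Complex.I * (Real.pi / 4)) ^ 2 = Complex.I := by
  rw [← Complex.exp_nat_mul]
  have : ((2 : ℕ) : ℂ) * (Complex.I * (Real.pi / 4)) = (Real.pi / 2 : ℂ) * Complex.I := by
    push_cast; ring
  rw [this, Complex.exp_pi_div_two_mul_I]

lemma stdRoot_add_two (d : Fin 4) :
    stdRoot (d + 2) = -((stepSign d : ℤ) : ℂ) * Complex.I * stdRoot d := by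
  have h := exp_pi_four_sq
  unfold stdRoot
  generalize Complex.exp (Complex.I * (Real.pi / 4)) = z at *
  have h4 : z ^ 3 = Complex.I * z := by rw [← h]; ring
  have hI := Complex.I_sq
  fin_cases d
  · simp [stepSign]; rw [h]; ring
  · simp [stepSign]; rw [h4]; ring
  · simp [stepSign]; rw [h, mul_comm (Complex.exp _), ← mul_assoc, ← sq, hI]; ring
  · simp [stepSign]; rw [h4]
    linear_combination (Complex.exp (Complex.I * (Real.pi / 8)) * z) * hI

/-- `1` if the chosen square root is the standard one, `-1` otherwise. -/
def OPoint.rootSign (x : OPoint) : ℤˣ := by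
  classical exact if x.root = stdRoot x.dir then 1 else -1

lemma OPoint.root_eq (x : OPoint) : x.root = ((x.rootSign : ℤ) : ℂ) * stdRoot x.dir := by
  have h : x.root ^ 2 = stdRoot x.dir ^ 2 := by rw [x.root_sq, stdRoot_sq]
  unfold OPoint.rootSign
  split_ifs with h1
  · simp [h1]
  · rcases sq_eq_sq_iff_eq_or_eq_neg.1 h with h2 | h2
    · exact absurd h2 h1
    · simp [h2]

/-- A turn changes the standard square root of the direction by its phase and the sign of the
passage through the vertex. -/
lemma turn_phase {d f : Fin 4} (h : d + 2 ≠ f) :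
    Complex.exp (-Complex.I * ((turn d f : ℝ) * (Real.pi / 2)) / 2) * stdRoot f =
      ((stepSign d * passSign d f : ℤˣ) : ℤ) * stdRoot d := by
  have h2 := exp_pi_four_sq
  have e1 : Complex.exp (-Complex.I * (((1 : ℤ) : ℝ) * (Real.pi / 2)) / 2) =
      (Complex.exp (Complex.I * (Real.pi / 4)))⁻¹ := by
    rw [← Complex.exp_neg]; congr 1; push_cast; ring
  have e2 : Complex.exp (-Complex.I * (((-1 : ℤ) : ℝ) * (Real.pi / 2)) / 2) =
      Complex.exp (Complex.I * (Real.pi / 4)) := by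
    congr 1; push_cast; ring
  have e3 : Complex.exp (-Complex.I * (((0 : ℤ) : ℝ) * (Real.pi / 2)) / 2) = 1 := by
    simp
  have hz := Complex.exp_ne_zero (Complex.I * (Real.pi / 4))
  have hI := Complex.I_sq
  unfold stdRoot
  by_cases t1 : f = d + 1
  · rw [turn, if_pos t1, e1]
    subst t1
    generalize Complex.exp (Complex.I * (Real.pi / 4)) = z at *
    fin_cases d <;> simp [stepSign, passSign]
    · field_simp
    · field_simp
    · field_simp
    · field_simp
      have : z ^ 4 = -1 := by rw [show z ^ 4 = (z ^ 2) ^ 2 by ring, h2, hI]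
      rw [this]; simp
  · by_cases t2 : f = d + 3
    · rw [turn, if_neg t1, if_pos t2, e2]
      subst t2
      generalize Complex.exp (Complex.I * (Real.pi / 4)) = z at *
      have : z ^ 4 = -1 := by rw [show z ^ 4 = (z ^ 2) ^ 2 by ring, h2, hI]
      fin_cases d <;> simp [stepSign, passSign]
      · linear_combination Complex.exp (Complex.I * (Real.pi / 8)) * this
      · ring
      · ring
      · ring
    · rw [turn, if_neg t1, if_neg t2, e3]
      have : f = d := by revert h t1 t2; revert d f; decide
      subst this
      revert h; fin_cases f <;> simp [stepSign, passSign]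

/-- The phase `exp (-i W / 2)` of a walk, relative to the standard square roots of its first and
last directions, is the sign that sorts the half-edges at each vertex that the walk passes. -/
lemma winding_phase (ds : List (Fin 4)) : ∀ (v : Vtx) (d d' : Fin 4), IsSimpleWalk v d ds d' →
    Complex.exp (-Complex.I * ((winding d ds d' : ℝ) * (Real.pi / 2)) / 2) * stdRoot d' =
      ((stepSign d * walkSign d ds d' : ℤˣ) : ℤ) * stdRoot d := by
  induction ds with
  | nil =>
    intro v d d' h
    exact turn_phase fun e => h.ne (by rw [e]; rfl)
  | cons f fs ih =>
    intro v d d' h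
    have h1 := turn_phase h.ne_cons
    have h2 := ih _ f d' h.tail
    rw [winding, walkSign]
    have : Complex.exp (-Complex.I * (((turn d f + winding f fs d' : ℤ) : ℝ) * (Real.pi / 2)) / 2) =
        Complex.exp (-Complex.I * ((turn d f : ℝ) * (Real.pi / 2)) / 2) *
        Complex.exp (-Complex.I * ((winding f fs d' : ℝ) * (Real.pi / 2)) / 2) := by
      rw [← Complex.exp_add]; congr 1; push_cast; ring
    rw [this, mul_assoc, h2, mul_left_comm, h1]
    push_cast; ring

/-- The sign `halfCut` as a unit. -/
def hcut (a : Face) (v : Vtx) (d : Fin 4) : ℤˣ := sgn (d = 3 ∧ v.2 = a.2 + 1 ∧ a.1 + 1 ≤ v.1)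

lemma coe_hcut (a : Face) (v : Vtx) (d : Fin 4) : ((hcut a v d : ℤˣ) : ℤ) = halfCut a v d := by
  unfold hcut sgn halfCut; split_ifs <;> rfl

/-- The sign relating a doubly oriented lifted medial vertex to its half-edge: it collects the
choices of the square root and of the lift. -/
def OPoint.gauge (a : Face) (x : OPoint) : ℤˣ :=
  stepSign x.dir * x.rootSign * x.sheet * hcut a x.head (x.dir + 2)

/-- The factor `ψ` of a walk is a sign: apart from the gauge signs of its two ends, it is determined
by the order of the half-edges along the walk and by the edges crossing the slit. -/
lemma psi_eq (a : Face) (x y : OPoint) (ds : List (Fin 4))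
    (h : IsSimpleWalk x.head x.dir ds (y.dir + 2)) :
    psi a x ds y = ((-(x.gauge a * y.gauge a) *
      (((walkEdges x.head ds).map (cut a)).prod * walkSign x.dir ds (y.dir + 2)) : ℤˣ) : ℤ) := by
  have hw := winding_phase ds _ _ _ h
  rw [stdRoot_add_two] at hw
  have hsx := stdRoot_ne_zero x.dir
  have hsy := stdRoot_ne_zero y.dir
  have hu : ∀ u : ℤˣ, ((u : ℤ) : ℂ) * ((u : ℤ) : ℂ) = 1 := by
    intro u; rw [← Int.cast_mul, ← Units.val_mul, Int.units_mul_self]; simp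
  have hu0 : ∀ u : ℤˣ, ((u : ℤ) : ℂ) ≠ 0 := fun u h0 => by simpa [h0] using hu u
  have hI := Complex.I_ne_zero
  have hw' : Complex.exp (-Complex.I * ((winding x.dir ds (y.dir + 2) : ℝ) * (Real.pi / 2)) / 2) =
      ((stepSign x.dir * walkSign x.dir ds (y.dir + 2) : ℤˣ) : ℤ) * stdRoot x.dir /
        (-((stepSign y.dir : ℤ) : ℂ) * Complex.I * stdRoot y.dir) := by
    rw [eq_div_iff (by simp [hu0, hI, hsy]), hw]
  have hsheet : ((sheetSign a x ds y : ℤ) : ℂ) = (((x.sheet * y.sheet * hcut a x.head (x.dir + 2) *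
      hcut a y.head (y.dir + 2) * ((walkEdges x.head ds).map (cut a)).prod : ℤˣ) : ℤ) : ℂ) := by
    rw [sheetSign]
    have : ∀ l : List Edge, (((l.map (cut a)).prod : ℤˣ) : ℤ) = (l.map (edgeCut a)).prod := by
      intro l
      induction l with
      | nil => rfl
      | cons e l ih => simp [ih, coe_cut]
    simp only [Units.val_mul, this, coe_hcut]
  rw [psi, hw', hsheet, x.root_eq, y.root_eq, OPoint.gauge, OPoint.gauge]
  have hx := hu0 x.rootSign
  have hy := hu0 (stepSign y.dir)
  have h1 := hu x.rootSign
  have h2 := hu (stepSign y.dir)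
  push_cast
  field_simp
  rw [← sq] at h1 h2
  rw [h1, h2]; ring

/-! ### The phase of a configuration -/

lemma vertex_opp_ne (h : Half) : (opp h).1 ≠ h.1 := by
  obtain ⟨⟨a, b⟩, d⟩ := h
  fin_cases d <;> simp [opp, dirVec]

/-- All half-edges of a configuration. -/
def occupied {N : ℕ} (b : Fin N → OPoint) (ω : Finset Edge) : Finset Half :=
  halves ω ∪ Finset.univ.image fun i => (b i).half

lemma hdeg_halves (ω : Finset Edge) (v : Vtx) :
    hdeg (halves ω) v = (ω.filter fun e => e.1 = v ∨ Edge.snd' e = v).card := by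
  refine Finset.card_bij (fun h _ => h.edge) ?_ ?_ ?_
  · intro h hh
    simp only [Finset.mem_filter, mem_halves] at hh ⊢
    refine ⟨hh.1, ?_⟩
    rcases half_cases h with ⟨h1, -⟩ | ⟨h1, -⟩
    · left; rw [← hh.2, h1, edge_half1]; rfl
    · right; rw [← hh.2, h1, edge_half2]; rfl
  · intro h hh k hk e
    simp only [Finset.mem_filter] at hh hk
    rcases (edge_eq_iff h k).1 e with e | e
    · exact e
    · exact absurd (by rw [← e, hh.2, hk.2]) (vertex_opp_ne k)
  · intro e he
    simp only [Finset.mem_filter] at he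
    rcases he.2 with h | h
    · exact ⟨half1 e, by simp [mem_halves, edge_half1, he.1]; exact h, edge_half1 e⟩
    · exact ⟨half2 e, by simp [mem_halves, edge_half2, he.1]; exact h, edge_half2 e⟩

lemma half_injective {N : ℕ} {b : Fin N → OPoint}
    (hb : Function.Injective fun j => (b j).edge) : Function.Injective fun j => (b j).half := by
  intro i j h
  apply hb
  simp only [← OPoint.edge_half]
  exact congrArg Half.edge h

lemma hdeg_union {A B : Finset Half} (h : Disjoint A B) (v : Vtx) :
    hdeg (A ∪ B) v = hdeg A v + hdeg B v := by
  unfold hdeg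
  rw [Finset.filter_union, Finset.card_union_of_disjoint]
  exact Finset.disjoint_filter_filter h

lemma deg_eq_hdeg {N : ℕ} {b : Fin N → OPoint} {ω : Finset Edge}
    (hb : Function.Injective fun j => (b j).edge) (hω : ∀ i, (b i).edge ∉ ω) :
    deg b ω = hdeg (occupied b ω) := by
  funext v
  rw [occupied, hdeg_union, hdeg_halves, deg]
  · congr 1
    rw [hdeg, Finset.filter_image, Finset.card_image_of_injective _ (half_injective hb)]
    rfl
  · rw [Finset.disjoint_left]
    intro h hh hk
    obtain ⟨i, -, rfl⟩ := Finset.mem_image.1 hk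
    rw [mem_halves, OPoint.edge_half] at hh
    exact hω i hh

variable {N : ℕ}

/-- The edges of the walks that start at indices in `S`. -/
def WalkChoice.usedOn (c : WalkChoice N) (b : Fin N → OPoint) (S : Finset (Fin N)) : Finset Edge :=
  (S.filter fun i => c.partner i < i).biUnion fun i =>
    (walkEdges (b i).head (c.path i)).toFinset

lemma IsAdmissible.isSimpleWalk {b : Fin N → OPoint} {ω : Finset Edge} {c : WalkChoice N}
    (hb : Function.Injective fun j => (b j).edge) (hω : ∀ i, (b i).edge ∉ ω)
    (hc : IsAdmissible b ω c) {i : Fin N} (hi : c.partner i < i) :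
    IsSimpleWalk (b i).head (b i).dir (c.path i) ((b (c.partner i)).dir + 2) := by
  refine ⟨hc.nodup i hi, fun h => hω i ?_, fun h => hω (c.partner i) ?_, fun h => ?_⟩
  · rw [← OPoint.edge_half]; exact hc.subset i hi _ h
  · rw [← OPoint.edge_half]; rw [hc.ends i hi] at h; exact hc.subset i hi _ h
  · rw [hc.ends i hi] at h
    exact hi.ne' (half_injective hb h)

/-- The crossing signature of the walks that end at indices in `S`. -/
def WalkChoice.crossSign (c : WalkChoice N) (S : Finset (Fin N)) : ℤˣ :=
  ∏ p ∈ S, ∏ r ∈ S, sgn (c.partner p < c.partner r ∧ c.partner r < p ∧ p < r)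

lemma WalkChoice.crossSign_univ (c : WalkChoice N) :
    c.crossSign Finset.univ = (-1) ^ c.crossings := by
  rw [crossSign, crossings, ← Finset.prod_const, Finset.prod_filter, ← Finset.univ_product_univ,
    Finset.prod_product]
  rfl

lemma gen_mul_prod {ι : Type*} (h : ι → Half) (k : Half) (l : List ι) (hl : ∀ i ∈ l, h i ≠ k) :
    gen k * (l.map fun i => gen (h i)).prod =
      (-1 : ℤˣ) ^ l.length • ((l.map fun i => gen (h i)).prod * gen k) := by
  induction l with
  | nil => simp
  | cons i l ih =>
    simp only [List.map_cons, List.prod_cons, List.length_cons]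
    rw [← mul_assoc, gen_mul_gen (hl i List.mem_cons_self).symm, smul_mul_assoc, mul_assoc,
      ih fun j hj => hl j (List.mem_cons_of_mem _ hj), mul_smul_comm, smul_smul, mul_assoc, pow_succ,
      mul_comm]

/-- The number of crossings changes by the number of points between the two ends of the removed
walk, modulo two. -/
lemma crossSign_insert {c : WalkChoice N} (hinv : ∀ i, c.partner (c.partner i) = i)
    (hne : ∀ i, c.partner i ≠ i) {S : Finset (Fin N)} {k : Fin N}
    (hk : ∀ i ∈ S, i < k) (hkj : c.partner k < k) (hj : c.partner k ∉ S)
    (hS : ∀ i ∈ S, c.partner i ∈ S) :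
    c.crossSign (insert k (insert (c.partner k) S)) =
      (-1) ^ (S.filter fun i => c.partner k < i).card * c.crossSign S := by
  set j := c.partner k with hjk
  have hpj : c.partner j = k := hinv k
  have hkS : k ∉ insert j S := by
    simp only [Finset.mem_insert, not_or]
    exact ⟨hkj.ne', fun h => (hk k h).ne rfl⟩
  have hle : ∀ i ∈ insert k (insert j S), i ≤ k := by
    intro i hi
    simp only [Finset.mem_insert] at hi
    rcases hi with rfl | rfl | hi
    exacts [le_rfl, hkj.le, (hk i hi).le]
  unfold WalkChoice.crossSign
  rw [Finset.prod_insert hkS, Finset.prod_insert hj]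
  have t1 : ∏ r ∈ insert k (insert j S), sgn (c.partner k < c.partner r ∧ c.partner r < k ∧ k < r) = 1 := by
    refine Finset.prod_eq_one fun r hr => if_neg ?_
    rintro ⟨-, -, h⟩
    exact (hle r hr).not_gt h
  have t2 : ∏ r ∈ insert k (insert j S), sgn (c.partner j < c.partner r ∧ c.partner r < j ∧ j < r) = 1 := by
    refine Finset.prod_eq_one fun r hr => if_neg ?_
    rintro ⟨h1, h2, -⟩
    rw [hpj] at h1
    exact (h1.trans h2).not_gt hkj
  have t3 : ∀ p ∈ S, ∏ r ∈ insert k (insert j S), sgn (c.partner p < c.partner r ∧ c.partner r < p ∧ p < r)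
      = sgn (c.partner p < j ∧ j < p) *
        ∏ r ∈ S, sgn (c.partner p < c.partner r ∧ c.partner r < p ∧ p < r) := by
    intro p hp
    rw [Finset.prod_insert hkS, Finset.prod_insert hj]
    have : sgn (c.partner p < c.partner j ∧ c.partner j < p ∧ p < j) = 1 := by
      refine if_neg ?_
      rintro ⟨-, h, -⟩
      rw [hpj] at h
      exact (hk p hp).not_gt h
    rw [this, one_mul]
    congr 1
    unfold sgn
    simp only [← hjk, hk p hp, and_true]
  rw [t1, t2, one_mul, one_mul, Finset.prod_congr rfl t3, Finset.prod_mul_distrib]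
  congr 1
  have t4 : ∏ p ∈ S, sgn (c.partner p < j ∧ j < p) =
      ∏ p ∈ S.filter (fun i => j < i), sgn (c.partner p < j) := by
    rw [Finset.prod_filter]
    refine Finset.prod_congr rfl fun p _ => ?_
    unfold sgn; split_ifs <;> first | rfl | tauto
  have t5 : ∏ p ∈ S.filter (fun i => j < i), (if c.partner p < j then (1 : ℤˣ) else -1) = 1 := by
    rw [← Finset.prod_filter_mul_prod_filter_not (S.filter fun i => j < i) (fun p => c.partner p < j)]
    rw [Finset.prod_eq_one (s := Finset.filter (fun p => c.partner p < j) _)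
      fun p hp => if_pos (Finset.mem_filter.1 hp).2, one_mul]
    refine Finset.prod_involution (fun p _ => c.partner p) ?_ ?_ ?_ ?_
    · intro p hp
      simp only [Finset.mem_filter] at hp
      rw [if_neg hp.2, hinv, if_neg (not_lt.2 hp.1.2.le)]; rfl
    · intro p _ _; exact hne p
    · intro p hp
      simp only [Finset.mem_filter] at hp ⊢
      refine ⟨⟨hS p hp.1.1, lt_of_le_of_ne (not_lt.1 hp.2) ?_⟩, ?_⟩
      · intro h
        rw [h, hinv] at hpj
        exact (hk p hp.1.1).ne hpj
      · rw [hinv]; exact not_lt.2 hp.1.2.le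
    · intro p _; exact hinv p
  have t6 : ∏ p ∈ S.filter (fun i => j < i), sgn (c.partner p < j) =
      (∏ p ∈ S.filter (fun i => j < i), (-1 : ℤˣ)) *
        ∏ p ∈ S.filter (fun i => j < i), (if c.partner p < j then (1 : ℤˣ) else -1) := by
    rw [← Finset.prod_mul_distrib]
    refine Finset.prod_congr rfl fun p _ => ?_
    unfold sgn; split_ifs <;> rfl
  rw [t4, t6, t5, mul_one, Finset.prod_const]

/-- The product of the points of all walks, in increasing order, and of the edges of the walks,
is the product of the walks up to the crossing signature; each walk contributes its own sign. -/
lemma prod_walks {b : Fin N → OPoint} {ω : Finset Edge} {c : WalkChoice N}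
    (hb : Function.Injective fun j => (b j).edge) (hω : ∀ i, (b i).edge ∉ ω)
    (hc : IsAdmissible b ω c) (n : ℕ) : ∀ (L : List (Fin N)) (X : Mono), L.length ≤ n →
    L.Pairwise (· < ·) → (∀ i ∈ L, c.partner i ∈ L) →
    (∀ w, par w X.support = 1) → X.support ⊆ occupied b ω →
    (∀ h ∈ X.support, h.edge ∉ c.usedOn b L.toFinset ∧ ∀ i ∈ L, h ≠ (b i).half) →
    ((L.map fun i => gen (b i).half).prod * edgesMono (c.usedOn b L.toFinset) * X).sign =
      c.crossSign L.toFinset * (∏ i ∈ L.toFinset.filter (fun i => c.partner i < i),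
        -walkSign (b i).dir (c.path i) ((b (c.partner i)).dir + 2)) * X.sign := by
  have hinj := half_injective hb
  have husub : ∀ S, c.usedOn b S ⊆ ω := by
    intro S e he
    simp only [WalkChoice.usedOn, Finset.mem_biUnion, Finset.mem_filter, List.mem_toFinset] at he
    obtain ⟨i, hi, he⟩ := he
    exact hc.subset i hi.2 e he
  induction n with
  | zero =>
    intro L X hn _ _ _ _ _
    obtain rfl : L = [] := List.length_eq_zero_iff.1 (by omega)
    simp [WalkChoice.usedOn, WalkChoice.crossSign]
  | succ n ih =>
    intro L X hn hL hcl hX hXA hXd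
    rcases List.eq_nil_or_concat L with rfl | ⟨L0, k, rfl⟩
    · simp [WalkChoice.usedOn, WalkChoice.crossSign]
    rw [List.concat_eq_append] at *
    have hk0 : ∀ i ∈ L0, i < k := fun i hi => (List.pairwise_append.1 hL).2.2 i hi k (by simp)
    have hjL : c.partner k ∈ L0 := by
      have := hcl k (by simp)
      simp only [List.mem_append, List.mem_singleton] at this
      exact this.resolve_right (hc.ne k)
    obtain ⟨L1, L2, rfl⟩ := List.append_of_mem hjL
    set j := c.partner k with hj
    have hjk : j < k := hk0 j hjL
    have hL' := (List.pairwise_append.1 hL).1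
    have hsub : (L1 ++ L2).Sublist (L1 ++ j :: L2) := by simp
    have hpw : (L1 ++ L2).Pairwise (· < ·) := hL'.sublist hsub
    have hnd := hL'.imp (fun h => ne_of_lt h)
    have hjn : j ∉ L1 ++ L2 := by
      have := (List.nodup_middle (l₁ := L1) (l₂ := L2) (a := j)).1 hnd
      exact (List.nodup_cons.1 this).1
    have hcl' : ∀ i ∈ L1 ++ L2, c.partner i ∈ L1 ++ L2 := by
      intro i hi
      have h1 := hcl i (List.mem_append_left _ (hsub.subset hi))
      simp only [List.mem_append, List.mem_cons, List.not_mem_nil, or_false] at h1 ⊢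
      rcases h1 with (h1 | h1 | h1) | h1
      · exact Or.inl h1
      · exfalso
        rw [hj] at h1
        have : i = k := by rw [← hc.invol i, h1, hc.invol]
        exact (hk0 i (hsub.subset hi)).ne this
      · exact Or.inr h1
      · exfalso
        have : i = j := by rw [← hc.invol i, h1]
        exact hjn (this ▸ hi)
    set S := (L1 ++ L2).toFinset with hS
    have hSL : (L1 ++ j :: L2 ++ [k]).toFinset = insert k (insert j S) := by
      ext i; simp [hS]; tauto
    have hjS : j ∉ S := by simpa [hS] using hjn
    have hkS : ∀ i ∈ S, i < k := fun i hi => hk0 i (hsub.subset (by simpa [hS] using hi))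
    have hkS' : k ∉ insert j S := by
      simp only [Finset.mem_insert, not_or]
      exact ⟨hjk.ne', fun h => (hkS k h).ne rfl⟩
    have hfil : (insert k (insert j S)).filter (fun i => c.partner i < i) =
        insert k (S.filter fun i => c.partner i < i) := by
      rw [Finset.filter_insert, if_pos hjk, Finset.filter_insert, if_neg]
      rw [hj, hc.invol]; exact hjk.not_gt
    have hused : c.usedOn b (insert k (insert j S)) =
        c.usedOn b S ∪ (walkEdges (b k).head (c.path k)).toFinset := by
      rw [WalkChoice.usedOn, hfil, Finset.biUnion_insert, Finset.union_comm]; rfl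
    have hdisj : Disjoint (c.usedOn b S) (walkEdges (b k).head (c.path k)).toFinset := by
      rw [Finset.disjoint_left]
      intro e he hek
      simp only [WalkChoice.usedOn, Finset.mem_biUnion, Finset.mem_filter, List.mem_toFinset] at he hek
      obtain ⟨i, hi, he⟩ := he
      exact hc.disjoint i k hi.2 hjk (hkS i hi.1).ne he hek
    have hsw := hc.isSimpleWalk hb hω hjk
    rw [← hj] at hsw
    have hend : ((walkEnd (b k).head (c.path k), (b j).dir + 2) : Half) = (b j).half := by
      rw [hc.ends k hjk]; rfl
    have hwm : walkMono (b k).head (b k).dir (c.path k) ((b j).dir + 2) =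
        gen (b k).half * edgesMono (walkEdges (b k).head (c.path k)).toFinset * gen (b j).half := by
      rw [edgesMono_toFinset (hc.nodup k hjk), walkMono, hend]; rfl
    set W := walkMono (b k).head (b k).dir (c.path k) ((b j).dir + 2) with hW
    have hocc : ∀ i, (b i).half ∈ occupied b ω := fun i =>
      Finset.mem_union_right _ (Finset.mem_image_of_mem _ (Finset.mem_univ i))
    have hkill : ∀ (i : Fin N) (τ : Finset Edge), τ ⊆ ω →
        Commute (edgesMono τ) (gen (b i).half) := by
      intro i τ hτ
      refine commute_edgesMono fun h hh he => hω i ?_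
      rw [support_gen, Finset.mem_singleton] at hh
      rw [← OPoint.edge_half, ← hh]; exact hτ he
    have hwsub : (walkEdges (b k).head (c.path k)).toFinset ⊆ ω := fun e he =>
      hc.subset k hjk e (by simpa using he)
    rw [hSL] at hXd ⊢
    have hXd' := hXd
    rw [hused] at hXd'
    have hXW : ∀ h ∈ X.support, h ≠ ((b k).head, (b k).dir + 2) ∧
        h.edge ∉ walkEdges (b k).head (c.path k) ∧
        h ≠ (walkEnd (b k).head (c.path k), (b j).dir + 2) := by
      intro h hh
      refine ⟨(hXd h hh).2 k (by simp), fun he => (hXd' h hh).1 (by simp [he]), ?_⟩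
      rw [hend]; exact (hXd h hh).2 j (by simp)
    have hsign : (W * X).sign = walkSign (b k).dir (c.path k) ((b j).dir + 2) * X.sign := by
      refine walkMono_mul hX hXA _ _ _ _ hsw hXW (hocc k) ?_ (hend ▸ hocc j) ?_
      · intro h he
        exact Finset.mem_union_left _ (mem_halves.2 (hc.subset k hjk _ he))
      · rw [← deg_eq_hdeg hb hω]; exact hc.turns k hjk
    have hWsupp : ∀ h ∈ (W * X).support, h ∈ X.support ∨ h = (b k).half ∨
        h.edge ∈ walkEdges (b k).head (c.path k) ∨ h = (b j).half := by
      intro h hh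
      rw [support_mul, Finset.mem_symmDiff] at hh
      rcases hh with ⟨hh, -⟩ | ⟨hh, -⟩
      · have := support_walkMono_subset _ _ _ _ hh
        rw [hend] at this
        exact Or.inr this
      · exact Or.inl hh
    have hI := ih (L1 ++ L2) (W * X) (by simp at hn ⊢; omega) hpw hcl' ?_ ?_ ?_
    · rw [← hS] at hI
      have hcard : (S.filter fun i => j < i).card = L2.length := by
        have h1 : S.filter (fun i => j < i) = L2.toFinset := by
          ext i
          simp only [hS, Finset.mem_filter, List.mem_toFinset, List.mem_append]
          constructor
          · rintro ⟨h | h, hi⟩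
            · exact absurd hi ((List.pairwise_append.1 hL').2.2 i h j (by simp)).not_gt
            · exact h
          · intro h
            exact ⟨Or.inr h, List.rel_of_pairwise_cons (List.pairwise_append.1 hL').2.1 h⟩
        rw [h1, List.toFinset_card_of_nodup]
        exact (List.nodup_append.1 (hpw.imp fun h => ne_of_lt h)).2.1
      have hcr := crossSign_insert hc.invol hc.ne hkS hjk hjS
        (fun i hi => by have := hcl' i (by simpa [hS] using hi); simpa [hS] using this)
      rw [← hj, hcard] at hcr
      rw [hcr, hfil, Finset.prod_insert (fun h => hkS' (Finset.mem_insert_of_mem (Finset.mem_filter.1 h).1)),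
        ← hj, hused, edgesMono_union hdisj]
      have hgoal : ((L1 ++ j :: L2 ++ [k]).map fun i => gen (b i).half).prod *
          (edgesMono (c.usedOn b S) * edgesMono (walkEdges (b k).head (c.path k)).toFinset) * X =
          (-(-1 : ℤˣ) ^ L2.length) • (((L1 ++ L2).map fun i => gen (b i).half).prod *
            edgesMono (c.usedOn b S) * (W * X)) := by
        simp only [List.map_append, List.map_cons, List.map_nil, List.prod_append, List.prod_cons,
          List.prod_nil, mul_one]
        set P1 := (L1.map fun i => gen (b i).half).prod
        set P2 := (L2.map fun i => gen (b i).half).prod with hP2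
        set EU := edgesMono (c.usedOn b S)
        set EW := edgesMono (walkEdges (b k).head (c.path k)).toFinset
        have c1 : gen (b j).half * P2 = (-1 : ℤˣ) ^ L2.length • (P2 * gen (b j).half) := by
          refine gen_mul_prod _ _ _ fun i hi he => hjn ?_
          rw [← hinj he]; exact List.mem_append_right _ hi
        have c2 : gen (b j).half * gen (b k).half = (-1 : ℤˣ) • (gen (b k).half * gen (b j).half) :=
          gen_mul_gen fun e => hjk.ne (hinj e)
        have c3 : Commute EU (gen (b j).half) := hkill j _ (husub S)
        have c4 : Commute EU (gen (b k).half) := hkill k _ (husub S)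
        have c5 : Commute EW (gen (b j).half) := hkill j _ hwsub
        rw [hwm]
        calc P1 * (gen (b j).half * P2) * gen (b k).half * (EU * EW) * X
            = (-1 : ℤˣ) ^ L2.length • (P1 * P2 * (gen (b j).half * gen (b k).half) * EU * EW * X) := by
              rw [c1]; simp only [mul_smul_comm, smul_mul_assoc, mul_assoc]
          _ = (-(-1 : ℤˣ) ^ L2.length) • (P1 * P2 * (gen (b k).half * gen (b j).half * EU) * EW * X) := by
              rw [c2]; simp only [mul_smul_comm, smul_mul_assoc, mul_assoc, smul_smul]
              rw [mul_neg_one]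
          _ = (-(-1 : ℤˣ) ^ L2.length) • (P1 * P2 * (EU * gen (b k).half * gen (b j).half) * EW * X) := by
              rw [show gen (b k).half * gen (b j).half * EU = EU * gen (b k).half * gen (b j).half by
                rw [mul_assoc, ← c3.eq, ← mul_assoc, ← c4.eq]]
          _ = (-(-1 : ℤˣ) ^ L2.length) • (P1 * P2 * EU * gen (b k).half * (gen (b j).half * EW) * X) := by
              simp only [mul_assoc]
          _ = _ := by rw [← c5.eq]; simp only [mul_assoc]
      rw [hgoal, sign_smul, hI, hsign]
      simp only [neg_mul, mul_neg, mul_assoc, mul_left_comm, mul_comm]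
    · intro w
      rw [par_mul, hX, par_walkMono, one_mul]
    · intro h hh
      rcases hWsupp h hh with h1 | h1 | h1 | h1
      · exact hXA h1
      · rw [h1]; exact hocc k
      · exact Finset.mem_union_left _ (mem_halves.2 (hc.subset k hjk _ h1))
      · rw [h1]; exact hocc j
    · intro h hh
      rw [← hS]
      rcases hWsupp h hh with h1 | h1 | h1 | h1
      · refine ⟨fun he => (hXd' h h1).1 (Finset.mem_union_left _ he), fun i hi => ?_⟩
        exact (hXd h h1).2 i (List.mem_append_left _ (hsub.subset hi))
      · refine ⟨fun he => hω k ?_, fun i hi he => ?_⟩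
        · rw [← OPoint.edge_half, ← h1]; exact husub S he
        · exact (hkS i (by simpa [hS] using hi)).ne (hinj (show (b i).half = (b k).half by rw [← he, h1]))
      · refine ⟨fun he => Finset.disjoint_left.1 hdisj he (by simpa using h1), fun i hi he => ?_⟩
        rw [he, OPoint.edge_half] at h1
        exact hω i (hc.subset k hjk _ h1)
      · refine ⟨fun he => hω j ?_, fun i hi he => ?_⟩
        · rw [← OPoint.edge_half, ← h1]; exact husub S he
        · exact hjn ((hinj (show (b j).half = (b i).half by rw [← h1, he]) : j = i) ▸ hi)

/-- Every point is the end of exactly one walk. -/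
lemma prod_starts {b : Fin N → OPoint} {ω : Finset Edge} {c : WalkChoice N}
    (hc : IsAdmissible b ω c) (g : Fin N → ℤˣ) :
    ∏ i ∈ c.starts, g i * g (c.partner i) = ∏ i, g i := by
  rw [Finset.prod_mul_distrib, ← Finset.prod_filter_mul_prod_filter_not Finset.univ
    (fun i => c.partner i < i)]
  congr 1
  refine Finset.prod_bij' (fun i _ => c.partner i) (fun i _ => c.partner i) ?_ ?_ ?_ ?_ ?_
  · intro i hi
    simp only [WalkChoice.starts, Finset.mem_filter, Finset.mem_univ, true_and] at hi ⊢
    rw [hc.invol]; exact hi.not_gt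
  · intro i hi
    simp only [WalkChoice.starts, Finset.mem_filter, Finset.mem_univ, true_and] at hi ⊢
    rw [hc.invol]; exact lt_of_le_of_ne (not_lt.1 hi) (hc.ne i).symm
  · intro i _; exact hc.invol i
  · intro i _; exact hc.invol i
  · intro i _; rfl

/-- The sign of a configuration: the product of its points and edges, relative to the sorted
product of its half-edges. -/
def configSign (L : List Half) (ω : Finset Edge) : ℤˣ :=
  ((L.map gen).prod * edgesMono ω).sign

/-- The list of the half-edges of a family of points. -/
def pointHalves (b : Fin N → OPoint) : List Half := List.ofFn fun i => (b i).half

lemma support_prod_gen {L : List Half} (hL : L.Nodup) :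
    ((L.map gen).prod).support = L.toFinset := by
  induction L with
  | nil => rfl
  | cons h L ih =>
    rw [List.nodup_cons] at hL
    rw [List.map_cons, List.prod_cons, support_mul, ih hL.2, List.toFinset_cons, support_gen]
    ext x
    simp only [Finset.mem_symmDiff, Finset.mem_singleton, Finset.mem_insert, List.mem_toFinset]
    constructor
    · tauto
    · rintro (rfl | h')
      · exact Or.inl ⟨rfl, hL.1⟩
      · exact Or.inr ⟨h', fun e => hL.1 (e ▸ h')⟩

/-- The phase of a configuration does not depend on the choice of the walks: it is given by the
sign of the configuration, the gauge signs of its points and the loops around `a`. -/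
theorem IsAdmissible.choiceSign_eq (a : Face) {b : Fin N → OPoint} {ω : Finset Edge}
    {c : WalkChoice N}
    (hb : Function.Injective fun j => (b j).edge) (hω : ∀ i, (b i).edge ∉ ω)
    (hev : ∀ v, par v (occupied b ω) = 1) (hc : IsAdmissible b ω c) :
    choiceSign a b ω c =
      (((∏ i, (b i).gauge a) * loops a ω * configSign (pointHalves b) ω : ℤˣ) : ℤ) := by
  have hused : c.used b = c.usedOn b Finset.univ := rfl
  have husub : c.used b ⊆ ω := by
    intro e he
    simp only [WalkChoice.used, WalkChoice.starts, Finset.mem_biUnion, Finset.mem_filter,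
      List.mem_toFinset] at he
    obtain ⟨i, hi, he⟩ := he
    exact hc.subset i hi.2 e he
  have hmem : ∀ {i}, i ∈ c.starts ↔ c.partner i < i := by
    intro i; simp [WalkChoice.starts]
  set X := edgesMono (ω \ c.used b) with hXdef
  have hXs : X.support = halves (ω \ c.used b) := support_edgesMono _
  have hinj := half_injective hb
  have hmap : (pointHalves b).map gen = (List.finRange N).map fun i => gen (b i).half := by
    rw [pointHalves, List.map_ofFn, List.ofFn_eq_map]; rfl
  have hfin : (List.finRange N).toFinset = Finset.univ := by ext; simp
  have hsplit : edgesMono ω = edgesMono (c.used b) * X := by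
    rw [hXdef, ← edgesMono_union Finset.disjoint_sdiff, Finset.union_sdiff_of_subset husub]
  have hsupp : ((pointHalves b).map gen).prod.support = Finset.univ.image fun i => (b i).half := by
    rw [support_prod_gen (L := pointHalves b) (List.nodup_ofFn.2 hinj)]
    ext h; simp [pointHalves, List.mem_ofFn]
  have hpar : ∀ w, par w X.support = 1 := by
    intro w
    have h1 : par w (((pointHalves b).map gen).prod * edgesMono ω).support = 1 := by
      rw [support_mul, hsupp, support_edgesMono, ← hev w]
      congr 1
      ext h
      simp only [Finset.mem_symmDiff, occupied, Finset.mem_union]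
      have : ¬(h ∈ halves ω ∧ h ∈ Finset.univ.image fun i => (b i).half) := by
        rintro ⟨h1, h2⟩
        obtain ⟨i, -, rfl⟩ := Finset.mem_image.1 h2
        rw [mem_halves, OPoint.edge_half] at h1
        exact hω i h1
      tauto
    have h2 : par w (((pointHalves b).map gen).prod * edgesMono (c.used b)).support = 1 := by
      have hE : ∀ S : Finset (Fin N), S ⊆ c.starts → par w (edgesMono (c.usedOn b S)).support =
          ∏ i ∈ S, (if (b i).half.1 = w then -1 else 1) *
            (if (b (c.partner i)).half.1 = w then -1 else 1) := by
        intro S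
        induction S using Finset.induction_on with
        | empty => intro _; simp [WalkChoice.usedOn]
        | insert k S hk ih =>
          intro hS
          have hkst := hmem.1 (hS (Finset.mem_insert_self _ _))
          have hu : c.usedOn b (insert k S) =
              (walkEdges (b k).head (c.path k)).toFinset ∪ c.usedOn b S := by
            rw [WalkChoice.usedOn, Finset.filter_insert, if_pos hkst, Finset.biUnion_insert]; rfl
          have hd : Disjoint (walkEdges (b k).head (c.path k)).toFinset (c.usedOn b S) := by
            rw [Finset.disjoint_left]
            intro e hek he
            simp only [WalkChoice.usedOn, Finset.mem_biUnion, Finset.mem_filter,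
              List.mem_toFinset] at he hek
            obtain ⟨i, hi, he⟩ := he
            exact hc.disjoint k i hkst hi.2 (fun e => hk (e ▸ hi.1)) hek he
          rw [hu, edgesMono_union hd, par_mul, ih ((Finset.subset_insert _ _).trans hS),
            Finset.prod_insert hk]
          congr 1
          have hw := par_walkMono w (c.path k) (b k).head (b k).dir ((b (c.partner k)).dir + 2)
          rw [walkMono, par_mul, par_mul, par_gen, par_gen, hc.ends k hkst,
            ← edgesMono_toFinset (hc.nodup k hkst)] at hw
          have aux : ∀ p x q : ℤˣ, p * x * q = 1 → x = p * q := by decide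
          exact aux _ _ _ hw
      have hs : c.usedOn b c.starts = c.used b := by
        rw [WalkChoice.usedOn, WalkChoice.used]
        congr 1
        rw [Finset.filter_eq_self]
        intro i hi; exact hmem.1 hi
      rw [par_mul, ← hs, hE _ (Finset.Subset.refl _),
        prod_starts hc (fun i => if (b i).half.1 = w then -1 else 1), hsupp, par,
        Finset.prod_image fun i _ j _ h => hinj h, Int.units_mul_self]
    rw [hsplit, ← mul_assoc, par_mul, h2, one_mul] at h1
    exact h1
  have hXsign : X.sign = 1 := by
    rw [hXdef, edgesMono_of_even]
    rw [← hXs]; exact hpar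
  have hw := prod_walks hb hω hc N (List.finRange N) X (by simp) (List.pairwise_lt_finRange N)
    (by simp) hpar ?_ ?_
  · rw [hfin, ← hused, ← hmap, mul_assoc, ← hsplit, hXsign, mul_one, c.crossSign_univ] at hw
    rw [configSign, hw]
    have hpsi : ∀ i ∈ c.starts, psi a (b i) (c.path i) (b (c.partner i)) =
        ((((b i).gauge a * (b (c.partner i)).gauge a) *
          ((((walkEdges (b i).head (c.path i)).map (cut a)).prod *
          -walkSign (b i).dir (c.path i) ((b (c.partner i)).dir + 2))) : ℤˣ) : ℤ) := by
      intro i hi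
      rw [psi_eq a _ _ _ (hc.isSimpleWalk hb hω (hmem.1 hi))]
      congr 2
      simp only [mul_neg, neg_mul]
    have hcut : ∏ i ∈ c.starts, ((walkEdges (b i).head (c.path i)).map (cut a)).prod =
        loops a (c.used b) := by
      rw [loops, WalkChoice.used, Finset.prod_biUnion]
      · refine Finset.prod_congr rfl fun i hi => ?_
        exact (List.prod_toFinset _ (hc.nodup i (hmem.1 hi))).symm
      · intro i hi j hj hij
        rw [Function.onFun, Finset.disjoint_left]
        intro e he he'
        rw [List.mem_toFinset] at he he'
        exact hc.disjoint i j (hmem.1 hi) (hmem.1 hj) hij he he'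
    have hloops : loops a ω = loops a (ω \ c.used b) * loops a (c.used b) :=
      (Finset.prod_sdiff husub).symm
    have hst : Finset.univ.filter (fun i => c.partner i < i) = c.starts := rfl
    obtain ⟨ws, hws⟩ : ∃ ws : Fin N → ℤˣ, ∀ i, ws i =
      -walkSign (b i).dir (c.path i) ((b (c.partner i)).dir + 2) := ⟨_, fun _ => rfl⟩
    simp only [← hws] at hpsi ⊢
    rw [choiceSign, Finset.prod_congr rfl hpsi, ← coe_loops, hloops, ← hcut,
      ← prod_starts hc fun i => (b i).gauge a, hst]
    push_cast
    simp only [Finset.prod_mul_distrib]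
    ring
  · rw [hXs]
    exact fun h hh => Finset.mem_union_left _ (mem_halves.2 (Finset.sdiff_subset (mem_halves.1 hh)))
  · intro h hh
    rw [hXs, mem_halves, Finset.mem_sdiff] at hh
    rw [hfin, ← hused]
    refine ⟨hh.2, fun i _ e => hω i ?_⟩
    rw [← OPoint.edge_half, ← e]; exact hh.1

/-! ### Existence of admissible walks -/

/-- A pairing without crossings of an even set `S` of directions. -/
def mate (S : Finset (Fin 4)) (d : Fin 4) : Fin 4 :=
  if S.card = 4 then ![1, 0, 3, 2] d
  else if d + 1 ∈ S then d + 1 else if d + 2 ∈ S then d + 2 else d + 3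

lemma mate_spec : ∀ S : Finset (Fin 4), Even S.card → ∀ d ∈ S,
    mate S d ∈ S ∧ mate S (mate S d) = d ∧ mate S d ≠ d ∧ (S.card = 4 → mate S d ≠ d + 2) := by
  decide

variable {N : ℕ}

/-- Given a pairing `m` of the half-edges at each vertex, one follows the walk that starts at the
largest index, edge by edge, and then removes it. -/
lemma exists_walks (deg : Vtx → ℕ) (A : Finset Half) (m : Half → Half)
    (hm : ∀ h ∈ A, (m h).1 = h.1 ∧ m (m h) = h ∧ m h ≠ h ∧ (deg h.1 = 4 → (m h).2 ≠ h.2 + 2))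
    (n : ℕ) : ∀ (T : Finset (Fin N)) (g : Fin N → Half) (ω : Finset Edge),
    ω.card + T.card ≤ n → (∀ i ∈ T, ∀ j ∈ T, g i = g j → i = j) → (∀ i ∈ T, g i ∉ halves ω) →
    (∀ h, (h ∈ halves ω ∨ ∃ i ∈ T, g i = h) → h ∈ A ∧ (m h ∈ halves ω ∨ ∃ i ∈ T, g i = m h)) →
    ∃ c : WalkChoice N,
      (∀ i ∈ T, c.partner i ∈ T ∧ c.partner (c.partner i) = i ∧ c.partner i ≠ i) ∧
      ∀ i ∈ T, c.partner i < i →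
        walkEnd (g i).1 (c.path i) = (g (c.partner i)).1 ∧
        (∀ e ∈ walkEdges (g i).1 (c.path i), e ∈ ω) ∧
        (walkEdges (g i).1 (c.path i)).Nodup ∧
        (∀ j ∈ T, c.partner j < j → i ≠ j →
          (walkEdges (g i).1 (c.path i)).Disjoint (walkEdges (g j).1 (c.path j))) ∧
        TurnsAtAmbiguity deg (g i).1 ((g i).2 + 2) (c.path i) (g (c.partner i)).2 := by
  induction n with
  | zero =>
    intro T g ω hn _ _ _
    obtain rfl : T = ∅ := Finset.card_eq_zero.1 (by omega)
    exact ⟨⟨id, fun _ => []⟩, by simp, by simp⟩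
  | succ n ih =>
    intro T g ω hn hg hgω hcl
    rcases T.eq_empty_or_nonempty with rfl | hT
    · exact ⟨⟨id, fun _ => []⟩, by simp, by simp⟩
    set k := T.max' hT with hk
    have hkT : k ∈ T := T.max'_mem hT
    have hmax : ∀ i ∈ T, i ≤ k := fun i hi => T.le_max' i hi
    obtain ⟨hA, ho⟩ := hcl (g k) (Or.inr ⟨k, hkT, rfl⟩)
    obtain ⟨m1, m2, m3, m4⟩ := hm _ hA
    have hsix : ∀ d : Fin 4, d + 2 + 2 = d := by decide
    by_cases hj : ∃ j ∈ T, g j = m (g k)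
    · -- the walk from the largest index ends at once
      obtain ⟨j, hjT, hj⟩ := hj
      have hjk : j ≠ k := by rintro rfl; exact m3 hj.symm
      set T' := (T.erase k).erase j with hT'
      have hmT' : ∀ i, i ∈ T' ↔ i ∈ T ∧ i ≠ k ∧ i ≠ j := by
        intro i; simp only [hT', Finset.mem_erase]; tauto
      have hcard : T'.card + 1 ≤ T.card := by
        have h1 := Finset.card_le_card (Finset.erase_subset j (T.erase k))
        have h2 := Finset.card_erase_add_one hkT
        rw [← hT'] at h1; omega
      have key := ih T' g ω (by omega)
        (fun i hi l hl => hg i ((hmT' i).1 hi).1 l ((hmT' l).1 hl).1)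
        (fun i hi => hgω i ((hmT' i).1 hi).1) ?_
      · obtain ⟨c, hc1, hc2⟩ := key
        have hp : ∀ i ∈ T', Function.update (Function.update c.partner k j) j k i = c.partner i := by
          intro i hi
          rw [Function.update_of_ne ((hmT' i).1 hi).2.2, Function.update_of_ne ((hmT' i).1 hi).2.1]
        have hpk : Function.update (Function.update c.partner k j) j k k = j := by
          rw [Function.update_of_ne hjk.symm, Function.update_self]
        have hpj : Function.update (Function.update c.partner k j) j k j = k :=
          Function.update_self _ _ _
        have hpa : ∀ i ∈ T', Function.update c.path k [] i = c.path i := fun i hi =>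
          Function.update_of_ne ((hmT' i).1 hi).2.1 _ _
        have hpak : Function.update c.path k [] k = [] := Function.update_self _ _ _
        have hcase : ∀ i ∈ T, i ∈ T' ∨ i = k ∨ i = j := by
          intro i hi; rw [hmT']; tauto
        refine ⟨⟨Function.update (Function.update c.partner k j) j k,
          Function.update c.path k []⟩, ?_, ?_⟩
        · intro i hi
          dsimp only
          rcases hcase i hi with h | rfl | rfl
          · have h1 := hc1 i h
            rw [hp i h, hp _ h1.1]
            exact ⟨((hmT' _).1 h1.1).1, h1.2⟩
          · rw [hpk, hpj]; exact ⟨hjT, rfl, hjk⟩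
          · rw [hpj, hpk]; exact ⟨hkT, rfl, hjk.symm⟩
        · intro i hi hlt
          dsimp only at hlt ⊢
          rcases hcase i hi with h | rfl | rfl
          · rw [hp i h] at hlt ⊢
            rw [hpa i h]
            obtain ⟨w1, w2, w3, w4, w5⟩ := hc2 i h hlt
            refine ⟨w1, w2, w3, fun l hl hll hil => ?_, w5⟩
            rcases hcase l hl with h' | rfl | rfl
            · rw [hp l h'] at hll
              rw [hpa l h']; exact w4 l h' hll hil
            · rw [hpak]; simp [walkEdges]
            · rw [hpj] at hll; exact absurd (hmax _ hl) hll.not_ge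
          · rw [hpk] at hlt ⊢
            rw [hpak]
            simp only [walkEnd, walkEdges, TurnsAtAmbiguity, hj]
            refine ⟨m1.symm, by simp, by simp, by simp, fun h => (m4 h).symm⟩
          · rw [hpj] at hlt; exact absurd (hmax _ hi) hlt.not_ge
      · intro h hh
        have hh' : h ∈ halves ω ∨ ∃ i ∈ T, g i = h := by
          rcases hh with hh | ⟨i, hi, rfl⟩
          · exact Or.inl hh
          · exact Or.inr ⟨i, ((hmT' i).1 hi).1, rfl⟩
        obtain ⟨h1, h2⟩ := hcl h hh'
        refine ⟨h1, ?_⟩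
        rcases h2 with h2 | ⟨i, hi, h2⟩
        · exact Or.inl h2
        · refine Or.inr ⟨i, (hmT' i).2 ⟨hi, ?_, ?_⟩, h2⟩
          · rintro rfl
            have h3 : h = g j := by rw [hj, h2, (hm h h1).2.1]
            rcases hh with hh | ⟨l, hl, rfl⟩
            · exact hgω j hjT (h3 ▸ hh)
            · exact ((hmT' l).1 hl).2.2 (hg l ((hmT' l).1 hl).1 j hjT h3)
          · rintro rfl
            have h3 : h = g k := by
              rw [← (hm h h1).2.1, ← h2, hj, m2]
            rcases hh with hh | ⟨l, hl, rfl⟩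
            · exact hgω k hkT (h3 ▸ hh)
            · exact ((hmT' l).1 hl).2.1 (hg l ((hmT' l).1 hl).1 k hkT h3)
    · -- the walk from the largest index runs along an edge
      have hoω : m (g k) ∈ halves ω := ho.resolve_right hj
      set o := m (g k) with hodef
      set e := o.edge with he
      have heω : e ∈ ω := mem_halves.1 hoω
      have hopp : (opp o).edge = e := edge_opp o
      set g' := Function.update g k (opp o) with hg'
      have hgk : g' k = opp o := Function.update_self _ _ _
      have hgi : ∀ i, i ≠ k → g' i = g i := fun i hi => Function.update_of_ne hi _ _
      have hcard := Finset.card_erase_add_one heω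
      have hmem : ∀ h : Half, h ∈ halves (ω.erase e) ↔ h ∈ halves ω ∧ h.edge ≠ e := by
        intro h; rw [mem_halves, mem_halves, Finset.mem_erase]; tauto
      have hoo : opp o ∈ halves ω := by rw [opp_mem_halves]; exact hoω
      have key := ih T g' (ω.erase e) (by omega) ?_ ?_ ?_
      · obtain ⟨c, hc1, hc2⟩ := key
        refine ⟨⟨c.partner, Function.update c.path k (o.2 :: c.path k)⟩, hc1, ?_⟩
        have hpk : Function.update c.path k (o.2 :: c.path k) k = o.2 :: c.path k :=
          Function.update_self _ _ _
        have hpi : ∀ i, i ≠ k → Function.update c.path k (o.2 :: c.path k) i = c.path i :=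
          fun i hi => Function.update_of_ne hi _ _
        have hnk : ∀ i ∈ T, c.partner i < i → c.partner i ≠ k := by
          intro i hi hlt h
          rw [h] at hlt; exact absurd (hmax i hi) hlt.not_ge
        have hedge : edgeOf (g k).1 o.2 = e := by rw [← m1]; rfl
        have hvert : (g k).1 + dirVec o.2 = (opp o).1 := by rw [← m1]; rfl
        intro i hi hlt
        dsimp only at hlt ⊢
        obtain ⟨w1, w2, w3, w4, w5⟩ := hc2 i hi hlt
        rw [hgi _ (hnk i hi hlt)] at w1 w5
        by_cases hik : i = k
        · subst hik
          rw [← hk] at *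
          rw [hgk] at w1 w2 w3 w4 w5
          rw [hpk]
          simp only [walkEnd, walkEdges, hvert, hedge, TurnsAtAmbiguity]
          refine ⟨w1, ?_, ?_, ?_, ?_, ?_⟩
          · intro e' he'
            rcases List.mem_cons.1 he' with rfl | he'
            · exact heω
            · exact Finset.mem_of_mem_erase (w2 e' he')
          · exact List.nodup_cons.2 ⟨fun h => Finset.notMem_erase _ _ (w2 e h), w3⟩
          · intro l hl hll hil
            have hl' := w4 l hl hll hil
            rw [hpi l hil.symm]
            rw [hgi l hil.symm] at hl'
            rw [List.disjoint_cons_left]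
            refine ⟨fun h => ?_, hl'⟩
            have := (hc2 l hl hll).2.1
            rw [hgi l hil.symm] at this
            exact Finset.notMem_erase _ _ (this e h)
          · intro h
            exact (m4 h).symm
          · have : (opp o).2 + 2 = o.2 := hsix o.2
            rw [this] at w5; exact w5
        · rw [hgi i hik] at w1 w2 w3 w4 w5
          rw [hpi i hik]
          refine ⟨w1, fun e' he' => Finset.mem_of_mem_erase (w2 e' he'), w3, ?_, w5⟩
          intro l hl hll hil
          have hl' := w4 l hl hll hil
          by_cases hlk : l = k
          · subst hlk
            rw [← hk] at *
            rw [hpk]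
            simp only [walkEdges, hvert, hedge]
            rw [hgk] at hl'
            rw [List.disjoint_cons_right]
            exact ⟨fun h => Finset.notMem_erase _ _ (w2 e h), hl'⟩
          · rw [hpi l hlk]
            rwa [hgi l hlk] at hl'
      · intro i hi l hl h
        by_cases hik : i = k <;> by_cases hlk : l = k
        · rw [hik, hlk]
        · rw [hik, hgk, hgi l hlk] at h
          exact absurd (h ▸ hoo) (hgω l hl)
        · rw [hlk, hgk, hgi i hik] at h
          exact absurd (h ▸ hoo) (hgω i hi)
        · rw [hgi i hik, hgi l hlk] at h; exact hg i hi l hl h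
      · intro i hi h
        rw [hmem] at h
        by_cases hik : i = k
        · rw [hik, hgk] at h; exact h.2 hopp
        · rw [hgi i hik] at h; exact hgω i hi h.1
      · intro h hh
        have hne : h ≠ g k ∧ h ≠ o ∧ (h ∈ halves ω ∨ ∃ i ∈ T, g i = h) := by
          rcases hh with hh | ⟨i, hi, rfl⟩
          · rw [hmem] at hh
            refine ⟨fun e' => hgω k hkT (e' ▸ hh.1), fun e' => hh.2 (by rw [e']), Or.inl hh.1⟩
          · by_cases hik : i = k
            · rw [hik, hgk]
              exact ⟨fun e' => hgω k hkT (e' ▸ hoo), opp_ne o, Or.inl hoo⟩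
            · rw [hgi i hik]
              exact ⟨fun e' => hik (hg i hi k hkT e'), fun e' => hgω i hi (e' ▸ hoω),
                Or.inr ⟨i, hi, rfl⟩⟩
        obtain ⟨h1, h2⟩ := hcl h hne.2.2
        refine ⟨h1, ?_⟩
        have hmo : m h ≠ o := fun e' => hne.1 (by rw [← (hm h h1).2.1, e', m2])
        rcases h2 with h2 | ⟨i, hi, h2⟩
        · by_cases hme : (m h).edge = e
          · rcases (edge_eq_iff _ _).1 hme with h3 | h3
            · exact absurd h3 hmo
            · exact Or.inr ⟨k, hkT, by rw [hgk, h3]⟩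
          · exact Or.inl ((hmem _).2 ⟨h2, hme⟩)
        · refine Or.inr ⟨i, hi, ?_⟩
          rw [hgi i, h2]
          rintro rfl
          exact hne.2.1 (by rw [hodef, h2, (hm h h1).2.1])

/-- Every configuration has an admissible choice of walks: one pairs the half-edges at each vertex
without crossings and follows the resulting curves. -/
lemma exists_isAdmissible {b : Fin N → OPoint} {ω : Finset Edge}
    (hb : Function.Injective fun j => (b j).edge) (hω : ∀ i, (b i).edge ∉ ω)
    (hev : ∀ v, par v (occupied b ω) = 1) : ∃ c, IsAdmissible b ω c := by
  set A := occupied b ω with hA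
  set S : Vtx → Finset (Fin 4) := fun v => Finset.univ.filter fun d => (v, d) ∈ A with hS
  have hSe : ∀ v, Even (S v).card := by
    intro v
    have := (par_eq_one_iff v A).1 (hev v)
    have h2 := hdeg_eq A v
    rw [hdeg] at h2
    rwa [h2] at this
  have hmS : ∀ (v : Vtx) (d : Fin 4), d ∈ S v ↔ (v, d) ∈ A := by intro v d; simp [hS]
  obtain ⟨c, hc1, hc2⟩ := exists_walks (N := N) (deg b ω) A (fun h => (h.1, mate (S h.1) h.2))
    (fun h hh => by
      have := mate_spec (S h.1) (hSe h.1) h.2 ((hmS _ _).2 hh)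
      refine ⟨rfl, by dsimp only; rw [this.2.1], fun e => this.2.2.1 (congrArg Prod.snd e), ?_⟩
      rw [deg_eq_hdeg hb hω, hdeg_eq]
      exact this.2.2.2)
    _ Finset.univ (fun i => (b i).half) ω le_rfl (fun i _ j _ h => half_injective hb h)
    (fun i _ h => hω i (by rwa [mem_halves, OPoint.edge_half] at h))
    (fun h hh => by
      have hmA : ∀ h : Half, h ∈ A ↔ h ∈ halves ω ∨ ∃ i ∈ Finset.univ, (b i).half = h := by
        intro h; simp [hA, occupied]
      rw [← hmA] at hh ⊢
      exact ⟨hh, (hmS _ _).1 (mate_spec (S h.1) (hSe h.1) h.2 ((hmS _ _).2 hh)).1⟩)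
  have hsix : ∀ d : Fin 4, d + 2 + 2 = d := by decide
  refine ⟨c, fun i => (hc1 i (Finset.mem_univ i)).2.1, fun i => (hc1 i (Finset.mem_univ i)).2.2,
    fun i hi => (hc2 i (Finset.mem_univ i) hi).1, fun i hi => (hc2 i (Finset.mem_univ i) hi).2.1,
    fun i hi => (hc2 i (Finset.mem_univ i) hi).2.2.1,
    fun i j hi hj hij => (hc2 i (Finset.mem_univ i) hi).2.2.2.1 j (Finset.mem_univ j) hj hij, ?_⟩
  intro i hi
  have := (hc2 i (Finset.mem_univ i) hi).2.2.2.2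
  simp only [OPoint.half, hsix] at this
  exact this

/-- The phase of a configuration is a product of signs of its points, its edges, and the order of
its half-edges; no walks are left in this description. -/
theorem phase_eq (a : Face) {b : Fin N → OPoint} {ω : Finset Edge}
    (hb : Function.Injective fun j => (b j).edge) (hω : ∀ i, (b i).edge ∉ ω)
    (hev : ∀ v, par v (occupied b ω) = 1) : phase a b ω =
      (((∏ i, (b i).gauge a) * loops a ω * configSign (pointHalves b) ω : ℤˣ) : ℤ) := by
  have h := exists_isAdmissible hb hω hev
  rw [phase, dif_pos h]
  exact h.choose_spec.choiceSign_eq a hb hω hev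

/-! ### Alternating sums over the elements of a list -/

/-- The alternating sum of `g x B C` over the decompositions `B ++ x :: C` of a list. -/
def altSum {ι R : Type*} [Ring R] : (ι → List ι → List ι → R) → List ι → R
  | _, [] => 0
  | g, x :: L => g x [] L - altSum (fun z B C => g z (x :: B) C) L

section altSum

variable {ι R : Type*} [Ring R]

lemma altSum_congr {g g' : ι → List ι → List ι → R} {L : List ι}
    (h : ∀ B x C, L = B ++ x :: C → g x B C = g' x B C) : altSum g L = altSum g' L := by
  induction L generalizing g g' with
  | nil => rfl
  | cons y L ih =>
    rw [altSum, altSum, h [] y L rfl, ih fun B x C e => h (y :: B) x C (by rw [e]; rfl)]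

lemma altSum_zero (L : List ι) : altSum (fun _ _ _ => (0 : R)) L = 0 := by
  induction L with
  | nil => rfl
  | cons y L ih => rw [altSum, ih, sub_zero]

lemma altSum_add (g g' : ι → List ι → List ι → R) (L : List ι) :
    altSum (fun x B C => g x B C + g' x B C) L = altSum g L + altSum g' L := by
  induction L generalizing g g' with
  | nil => simp [altSum]
  | cons y L ih => rw [altSum, altSum, altSum, ih]; abel

lemma altSum_mul_left (c : R) (g : ι → List ι → List ι → R) (L : List ι) :
    altSum (fun x B C => c * g x B C) L = c * altSum g L := by
  induction L generalizing g with
  | nil => simp [altSum]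
  | cons y L ih => rw [altSum, altSum, ih, mul_sub]

lemma altSum_append (g : ι → List ι → List ι → R) (L L' : List ι) :
    altSum g (L ++ L') = altSum (fun x B C => g x B (C ++ L')) L +
      (-1) ^ L.length * altSum (fun x B C => g x (L ++ B) C) L' := by
  induction L generalizing g with
  | nil => simp [altSum]
  | cons y L ih =>
    rw [List.cons_append, altSum, altSum, ih, List.length_cons, pow_succ]
    simp only [List.cons_append, mul_neg, mul_one, neg_mul]
    abel

lemma altSum_eq_zero {g : ι → List ι → List ι → R} {L : List ι}
    (h : ∀ B x C, L = B ++ x :: C → g x B C = 0) : altSum g L = 0 := by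
  rw [altSum_congr h, altSum_zero]

lemma altSum_ite_of_notMem [DecidableEq ι] {y : ι} {L : List ι} (h : y ∉ L)
    (f : List ι → List ι → R) : altSum (fun x B C => if x = y then f B C else 0) L = 0 := by
  refine altSum_eq_zero fun B x C e => if_neg ?_
  rintro rfl
  exact h (by rw [e]; simp)

lemma altSum_ite [DecidableEq ι] {y : ι} {B C : List ι} (h : (B ++ y :: C).Nodup)
    (f : List ι → List ι → R) :
    altSum (fun x B C => if x = y then f B C else 0) (B ++ y :: C) =
      (-1) ^ B.length * f B C := by
  have h' := (List.nodup_cons.1 (List.nodup_middle.1 h)).1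
  rw [altSum_append, altSum_ite_of_notMem (fun hy => h' (List.mem_append_left _ hy)), zero_add,
    altSum, altSum_ite_of_notMem (fun hy => h' (List.mem_append_right _ hy))]
  simp

end altSum

/-! ### Correlation functions of half-edges -/

/-- The monomial of a configuration: the product of its points, in the order of the list, and of its
edges. -/
def configMono (L : List Half) (ω : Finset Edge) : Mono := (L.map gen).prod * edgesMono ω

lemma configMono_cons (y : Half) (L : List Half) (ω : Finset Edge) :
    configMono (y :: L) ω = gen y * configMono L ω := by
  simp [configMono, mul_assoc]

lemma par_configMono_cons (w : Vtx) (y : Half) (L : List Half) (ω : Finset Edge) :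
    par w (configMono (y :: L) ω).support =
      (if y.1 = w then -1 else 1) * par w (configMono L ω).support := by
  rw [configMono_cons, par_mul, par_gen]

/-- The configurations with the half-edges in `L` whose parity at each vertex `w` is `p w`. -/
def cfg (V : Finset Vtx) (p : Vtx → ℤˣ) (L : List Half) : Finset (Finset Edge) := by
  classical exact (edges V).powerset.filter fun ω => L.Nodup ∧ (∀ h ∈ L, h.1 ∈ V) ∧
    (∀ h ∈ L, h.edge ∉ ω) ∧ ∀ w, par w (configMono L ω).support = p w

lemma mem_cfg {V : Finset Vtx} {p : Vtx → ℤˣ} {L : List Half} {ω : Finset Edge} :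
    ω ∈ cfg V p L ↔ ω ⊆ edges V ∧ L.Nodup ∧ (∀ h ∈ L, h.1 ∈ V) ∧
    (∀ h ∈ L, h.edge ∉ ω) ∧ ∀ w, par w (configMono L ω).support = p w := by
  simp [cfg]

lemma mem_support_configMono {L : List Half} {ω : Finset Edge} (hL : L.Nodup)
    (hω : ∀ h ∈ L, h.edge ∉ ω) (y : Half) :
    y ∈ (configMono L ω).support ↔ y ∈ L ∨ y.edge ∈ ω := by
  rw [configMono, support_mul, support_prod_gen hL, support_edgesMono, Finset.mem_symmDiff,
    List.mem_toFinset, mem_halves]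
  have := hω y
  tauto

/-- The weight of a set of edges, with the sign of the number of its loops around `a`. -/
def weight (a : Face) (ω : Finset Edge) : ℝ := alpha ^ ω.card * ((loops a ω : ℤ) : ℝ)

/-- The unnormalized correlation function of a list of half-edges: the signed sum over the
configurations with these points. It vanishes if a half-edge is repeated or does not lie in the
domain. Unlike for the spinors, the two halves of an edge may both occur. -/
def corr (V : Finset Vtx) (a : Face) (L : List Half) : ℝ :=
  ∑ ω ∈ cfg V 1 L, weight a ω * ((configMono L ω).sign : ℤ)

lemma corr_of_not_nodup {V : Finset Vtx} {a : Face} {L : List Half} (h : ¬L.Nodup) :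
    corr V a L = 0 := by
  rw [corr, Finset.sum_eq_zero]
  intro ω hω
  exact absurd (mem_cfg.1 hω).2.1 h

lemma corr_of_notMem {V : Finset Vtx} {a : Face} {L : List Half} {h : Half} (hL : h ∈ L)
    (hV : h.1 ∉ V) : corr V a L = 0 := by
  rw [corr, Finset.sum_eq_zero]
  intro ω hω
  exact absurd ((mem_cfg.1 hω).2.2.1 h hL) hV

/-- Correlation functions are alternating. -/
lemma corr_perm {V : Finset Vtx} {a : Face} {L L' : List Half} (h : L.Perm L') {s : ℤˣ}
    (hs : (L.map gen).prod = s • (L'.map gen).prod) :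
    corr V a L = ((s : ℤ) : ℝ) * corr V a L' := by
  have hm : ∀ ω, configMono L ω = s • configMono L' ω := fun ω => by
    rw [configMono, hs, smul_mul_assoc]; rfl
  have hc : cfg V 1 L = cfg V 1 L' := by
    ext ω
    simp only [mem_cfg, h.nodup_iff, h.mem_iff, hm, support_smul]
  rw [corr, corr, hc, Finset.mul_sum]
  refine Finset.sum_congr rfl fun ω _ => ?_
  rw [hm, sign_smul]
  push_cast; ring

lemma gen_mul_prod_gen {k : Half} {L : List Half} (h : k ∉ L) :
    gen k * (L.map gen).prod = (-1 : ℤˣ) ^ L.length • ((L.map gen).prod * gen k) :=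
  gen_mul_prod id k L fun _ hi e => h (e ▸ hi)

lemma edge_mem_edges {V : Finset Vtx} {y : Half} :
    y.edge ∈ edges V ↔ y.1 ∈ V ∧ (opp y).1 ∈ V := by
  have h1 : ∀ e : Edge, e ∈ edges V ↔ (half1 e).1 ∈ V ∧ (half2 e).1 ∈ V := by
    intro e; simp [edges, half1, half2]
  rw [h1]
  rcases half_cases y with ⟨h, -⟩ | ⟨h, -⟩
  · rw [← h, ← opp_half1, ← h]
  · rw [← h, ← opp_half2, ← h, and_comm]

lemma sum_insert_edge {V : Finset Vtx} {e : Edge} (he : e ∈ edges V) (Q : Finset Edge → Prop)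
    [DecidablePred Q] (F : Finset Edge → ℝ) :
    ∑ ω ∈ (edges V).powerset.filter (fun ω => e ∈ ω ∧ Q ω), F ω =
      ∑ ω ∈ (edges V).powerset.filter (fun ω => e ∉ ω ∧ Q (insert e ω)), F (insert e ω) := by
  symm
  refine Finset.sum_bij' (fun ω _ => insert e ω) (fun ω _ => ω.erase e) ?_ ?_ ?_ ?_ ?_
  · intro ω hω
    simp only [Finset.mem_filter, Finset.mem_powerset] at hω ⊢
    exact ⟨Finset.insert_subset he hω.1, Finset.mem_insert_self _ _, hω.2.2⟩
  · intro ω hω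
    simp only [Finset.mem_filter, Finset.mem_powerset] at hω ⊢
    refine ⟨(Finset.erase_subset _ _).trans hω.1, Finset.notMem_erase _ _, ?_⟩
    rw [Finset.insert_erase hω.2.1]; exact hω.2.2
  · intro ω hω
    simp only [Finset.mem_filter] at hω
    exact Finset.erase_insert hω.2.1
  · intro ω hω
    simp only [Finset.mem_filter] at hω
    exact Finset.insert_erase hω.2.1
  · intros; rfl

/-- The signed weight of an edge when its two halves, `y` first, are replaced by the edge. -/
def hop (a : Face) (y : Half) : ℝ := alpha * (((stepSign y.2 * cut a y.edge : ℤˣ) : ℤ) : ℝ)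

lemma weight_insert (a : Face) {ω : Finset Edge} {e : Edge} (he : e ∉ ω) :
    weight a (insert e ω) = alpha * ((cut a e : ℤ) : ℝ) * weight a ω := by
  rw [weight, weight, Finset.card_insert_of_notMem he, loops, Finset.prod_insert he]
  push_cast [loops]; ring

lemma commute_edgeMono_prod {L : List Half} {e : Edge} (h : ∀ k ∈ L, k.edge ≠ e) :
    Commute (edgeMono e) (L.map gen).prod := by
  induction L with
  | nil => exact Commute.one_right _
  | cons k L ih =>
    rw [List.map_cons, List.prod_cons]
    refine Commute.mul_right (commute_edgeMono_of_notMem ?_) (ih fun j hj => h j (by simp [hj]))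
    intro j hj
    rw [support_gen, Finset.mem_singleton] at hj
    rw [hj]; exact h k (by simp)

lemma configMono_insert {L : List Half} {ω : Finset Edge} {y : Half} (hy : y.edge ∉ ω)
    (hL : ∀ k ∈ L, k.edge ≠ y.edge) :
    configMono L (insert y.edge ω) = stepSign y.2 • configMono (y :: opp y :: L) ω := by
  rw [configMono, edgesMono_insert hy, ← mul_assoc, ← (commute_edgeMono_prod hL).eq, edgeMono_eq,
    configMono_cons, configMono_cons, configMono, smul_mul_assoc, smul_mul_assoc]
  simp only [mul_assoc]

/-- The configurations that contain a given edge are those in which the edge is replaced by its two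
halves. -/
lemma sum_mem_edge_mul {V : Finset Vtx} {a : Face} {L : List Half} {y : Half} (hy : y.1 ∈ V)
    (hyL : y ∉ L) (hyL' : opp y ∉ L) {f : Finset Edge → ℝ}
    (hf : ∀ ω, f (insert y.edge ω) = f ω) :
    ∑ ω ∈ (cfg V 1 L).filter (fun ω => y.edge ∈ ω),
        weight a ω * ((configMono L ω).sign : ℤ) * f ω =
      hop a y * ∑ ω ∈ cfg V 1 (y :: opp y :: L),
        weight a ω * ((configMono (y :: opp y :: L) ω).sign : ℤ) * f ω := by
  classical
  by_cases he : y.edge ∈ edges V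
  · have hne : ∀ k ∈ L, k.edge ≠ y.edge := by
      intro k hk e
      rcases (edge_eq_iff k y).1 e with rfl | rfl
      · exact hyL hk
      · exact hyL' hk
    have e1 : (cfg V 1 L).filter (fun ω => y.edge ∈ ω) = (edges V).powerset.filter
        (fun ω => y.edge ∈ ω ∧ ω ∈ cfg V 1 L) := by
      ext ω
      simp only [Finset.mem_filter, Finset.mem_powerset, mem_cfg]; tauto
    have e2 : (edges V).powerset.filter (fun ω => y.edge ∉ ω ∧ insert y.edge ω ∈ cfg V 1 L) =
        cfg V 1 (y :: opp y :: L) := by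
      ext ω
      simp only [Finset.mem_filter, Finset.mem_powerset, mem_cfg, List.nodup_cons, List.mem_cons,
        forall_eq_or_imp, edge_opp, not_or, Finset.insert_subset_iff, (opp_ne y).symm, hyL, hyL', hy,
        he, true_and, not_false_eq_true, (edge_mem_edges.1 he).2, Finset.mem_insert]
      constructor
      · rintro ⟨h1, h2, h3, h4, h5, h6, h7⟩
        refine ⟨h1, h4, h5, ⟨h2, h2, fun k hk => (h6 k hk).2⟩, fun w => ?_⟩
        rw [← h7 w, configMono_insert h2 hne, support_smul]
      · rintro ⟨h1, h4, h5, ⟨h2, -, h6⟩, h7⟩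
        refine ⟨h1, h2, h1, h4, h5, fun k hk => ⟨hne k hk, h6 k hk⟩, fun w => ?_⟩
        rw [← h7 w, configMono_insert h2 hne, support_smul]
    rw [e1, sum_insert_edge he, e2, Finset.mul_sum]
    refine Finset.sum_congr rfl fun ω hω => ?_
    have h2 : y.edge ∉ ω := (mem_cfg.1 hω).2.2.2.1 y (by simp)
    rw [weight_insert a h2, configMono_insert h2 hne, sign_smul, hop, hf]
    push_cast; ring
  · rw [Finset.sum_eq_zero, Finset.sum_eq_zero, mul_zero]
    · intro ω hω
      exact absurd (edge_mem_edges.2 ⟨hy, (mem_cfg.1 hω).2.2.1 (opp y) (by simp)⟩) he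
    · intro ω hω
      simp only [Finset.mem_filter, mem_cfg] at hω
      exact absurd (hω.1.1 hω.2) he

lemma sum_mem_edge {V : Finset Vtx} {a : Face} {L : List Half} {y : Half} (hy : y.1 ∈ V)
    (hyL : y ∉ L) (hyL' : opp y ∉ L) :
    ∑ ω ∈ (cfg V 1 L).filter (fun ω => y.edge ∈ ω), weight a ω * ((configMono L ω).sign : ℤ) =
      hop a y * corr V a (y :: opp y :: L) := by
  simpa [corr] using sum_mem_edge_mul (a := a) hy hyL hyL' (f := fun _ => 1) fun _ => rfl

/-! ### The linear relations around a vertex -/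

/-- The correlation function of the list with `y` removed, with the sign of the position of `y`; it
is `0` if `y` is not in the list. This is the source term of the relations around a vertex. -/
def contract (V : Finset Vtx) (a : Face) (L : List Half) (y : Half) : ℝ :=
  altSum (fun x B C => if x = y then corr V a (B ++ C) else 0) L

/-- The parity that is odd at `v` only. -/
def oddAt (v : Vtx) : Vtx → ℤˣ := fun w => if v = w then -1 else 1

/-- The correlation function with the point `y` in front: the sum over the configurations of the
other points that are odd at the vertex of `y` and do not contain `y`. -/
lemma corr_cons {V : Finset Vtx} {a : Face} {L : List Half} {y : Half} (hy : y.1 ∈ V) :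
    corr V a (y :: L) =
      ∑ ω ∈ (cfg V (oddAt y.1) L).filter (fun ω => y ∉ (configMono L ω).support),
        weight a ω * ((gen y * configMono L ω).sign : ℤ) := by
  rw [corr]
  refine Finset.sum_congr ?_ fun ω _ => by rw [configMono_cons]
  ext ω
  simp only [Finset.mem_filter, mem_cfg, List.nodup_cons, List.mem_cons, forall_eq_or_imp, hy,
    true_and, par_configMono_cons]
  have hp : ∀ w, ((if y.1 = w then -1 else 1) * par w (configMono L ω).support = (1 : Vtx → ℤˣ) w ↔
      par w (configMono L ω).support = oddAt y.1 w) := by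
    intro w
    rw [oddAt, Pi.one_apply]
    generalize par w (configMono L ω).support = x
    have aux : ∀ p x : ℤˣ, (p * x = 1 ↔ x = p) := by decide
    exact aux _ _
  simp only [hp]
  constructor
  · rintro ⟨h1, ⟨h2, h3⟩, h4, ⟨h5, h6⟩, h7⟩
    refine ⟨⟨h1, h3, h4, h6, h7⟩, ?_⟩
    rw [mem_support_configMono h3 h6]; tauto
  · rintro ⟨⟨h1, h3, h4, h6, h7⟩, h8⟩
    rw [mem_support_configMono h3 h6] at h8; tauto

/-- The configurations that do contain `y` are counted as well: either `y` is one of the points, or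
the edge of `y` is in the configuration and shortening it to a half-edge moves `y` to its other
half. -/
lemma hop_mul_corr {V : Finset Vtx} {a : Face} {L : List Half} {y : Half} (hy : y.1 ∈ V)
    (hL : L.Nodup) (hLV : ∀ h ∈ L, h.1 ∈ V) :
    hop a y * corr V a (opp y :: L) + contract V a L y =
      ∑ ω ∈ (cfg V (oddAt y.1) L).filter (fun ω => y ∈ (configMono L ω).support),
        weight a ω * ((gen y * configMono L ω).sign : ℤ) := by
  classical
  by_cases hyL : y ∈ L
  · obtain ⟨B, C, rfl⟩ := List.append_of_mem hyL
    have hn := List.nodup_cons.1 (List.nodup_middle.1 hL)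
    have hB : y ∉ B := fun h => hn.1 (List.mem_append_left _ h)
    have hPy : ((B ++ y :: C).map gen).prod =
        (-1 : ℤˣ) ^ B.length • (gen y * ((B ++ C).map gen).prod) := by
      simp only [List.map_append, List.map_cons, List.prod_append, List.prod_cons]
      rw [← mul_assoc, ← mul_assoc, gen_mul_prod_gen hB, smul_mul_assoc, smul_smul, ← mul_pow]
      simp
    have hgy : ∀ ω, gen y * configMono (B ++ y :: C) ω =
        (-1 : ℤˣ) ^ B.length • configMono (B ++ C) ω := by
      intro ω
      rw [configMono, hPy, smul_mul_assoc, mul_smul_comm, ← mul_assoc, ← mul_assoc, gen_mul_self,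
        one_mul]; rfl
    have hcm : ∀ ω, configMono (B ++ y :: C) ω =
        (-1 : ℤˣ) ^ B.length • (gen y * configMono (B ++ C) ω) := by
      intro ω
      rw [configMono, hPy, smul_mul_assoc, mul_assoc]; rfl
    -- the configurations that avoid the edge of `y`
    have h1 : (cfg V (oddAt y.1) (B ++ y :: C)).filter
        (fun ω => y ∈ (configMono (B ++ y :: C) ω).support) =
        (cfg V 1 (B ++ C)).filter (fun ω => y.edge ∉ ω) := by
      ext ω
      simp only [Finset.mem_filter, mem_cfg]
      have hp : ∀ w, (par w (configMono (B ++ y :: C) ω).support = oddAt y.1 w ↔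
          par w (configMono (B ++ C) ω).support = (1 : Vtx → ℤˣ) w) := by
        intro w
        rw [oddAt, Pi.one_apply, hcm, support_smul, par_mul, par_gen]
        generalize par w (configMono (B ++ C) ω).support = x
        have aux : ∀ p x : ℤˣ, (p * x = p ↔ x = 1) := by decide
        exact aux _ _
      simp only [hp, hL, hn.2, true_and]
      have hmem : ∀ k, k ∈ B ++ y :: C ↔ k = y ∨ k ∈ B ++ C := by
        intro k; simp; tauto
      constructor
      · rintro ⟨⟨a1, a2, a3, a4⟩, -⟩
        exact ⟨⟨a1, fun h hh => a2 h ((hmem h).2 (Or.inr hh)),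
          fun h hh => a3 h ((hmem h).2 (Or.inr hh)), a4⟩, a3 y hyL⟩
      · rintro ⟨⟨a1, a2, a3, a4⟩, a5⟩
        have a6 : ∀ h ∈ B ++ y :: C, h.edge ∉ ω := by
          intro h hh
          rcases (hmem h).1 hh with rfl | hh
          · exact a5
          · exact a3 h hh
        exact ⟨⟨a1, hLV, a6, a4⟩, (mem_support_configMono hL a6 y).2 (Or.inl hyL)⟩
    have h2 : ∑ ω ∈ (cfg V 1 (B ++ C)).filter (fun ω => y.edge ∈ ω),
        weight a ω * ((configMono (B ++ C) ω).sign : ℤ) =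
        -((-1) ^ B.length * (hop a y * corr V a (opp y :: (B ++ y :: C)))) := by
      by_cases ho : opp y ∈ B ++ C
      · rw [corr_of_not_nodup, Finset.sum_eq_zero]
        · simp
        · intro ω hω
          simp only [Finset.mem_filter, mem_cfg] at hω
          exact absurd hω.2 (edge_opp y ▸ hω.1.2.2.2.1 _ ho)
        · rw [List.nodup_cons]
          rintro ⟨h, -⟩
          apply h
          simp only [List.mem_append, List.mem_cons] at ho ⊢; tauto
      · rw [sum_mem_edge hy hn.1 ho]
        have hperm : (y :: opp y :: (B ++ C)).Perm (opp y :: (B ++ y :: C)) := by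
          refine (List.Perm.swap _ _ _).trans ?_
          refine List.Perm.cons _ ?_
          exact List.perm_middle.symm
        rw [corr_perm (s := -(-1) ^ B.length) hperm]
        · push_cast; ring
        · rw [List.map_cons, List.prod_cons, List.map_cons, List.prod_cons, List.map_cons (l := B ++ y :: C),
            List.prod_cons, hPy, mul_smul_comm, smul_smul, ← mul_assoc, ← mul_assoc,
            gen_mul_gen (opp_ne y).symm, smul_mul_assoc, neg_mul, ← mul_pow]
          simp
    have h3 := Finset.sum_filter_add_sum_filter_not (cfg V 1 (B ++ C)) (fun ω => y.edge ∈ ω)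
      (fun ω => weight a ω * (((configMono (B ++ C) ω).sign : ℤ) : ℝ))
    rw [h2] at h3
    rw [contract, altSum_ite hL, h1]
    have h4 : ∑ ω ∈ (cfg V 1 (B ++ C)).filter (fun ω => y.edge ∉ ω),
        weight a ω * (((gen y * configMono (B ++ y :: C) ω).sign : ℤ) : ℝ) = (-1) ^ B.length *
        ∑ ω ∈ (cfg V 1 (B ++ C)).filter (fun ω => y.edge ∉ ω),
        weight a ω * (((configMono (B ++ C) ω).sign : ℤ) : ℝ) := by
      rw [Finset.mul_sum]
      refine Finset.sum_congr rfl fun ω _ => ?_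
      rw [hgy, sign_smul]; push_cast; ring
    have hcorr : ∑ ω ∈ cfg V 1 (B ++ C), weight a ω * (((configMono (B ++ C) ω).sign : ℤ) : ℝ) =
      corr V a (B ++ C) := rfl
    rw [h4, eq_sub_of_add_eq' h3, hcorr]
    have hsq : ((-1 : ℝ) ^ B.length) * (-1) ^ B.length = 1 := by rw [← mul_pow]; simp
    linear_combination (-(hop a y * corr V a (opp y :: (B ++ y :: C)))) * hsq
  · rw [contract, altSum_ite_of_notMem hyL, add_zero]
    have h1 : (cfg V (oddAt y.1) L).filter (fun ω => y ∈ (configMono L ω).support) =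
        (edges V).powerset.filter (fun ω => y.edge ∈ ω ∧ ω ∈ cfg V (oddAt y.1) L) := by
      ext ω
      simp only [Finset.mem_filter, Finset.mem_powerset, mem_cfg]
      constructor
      · rintro ⟨⟨a1, a2, a3, a4, a5⟩, a6⟩
        rw [mem_support_configMono a2 a4] at a6
        exact ⟨a1, a6.resolve_left hyL, a1, a2, a3, a4, a5⟩
      · rintro ⟨-, a6, a1, a2, a3, a4, a5⟩
        exact ⟨⟨a1, a2, a3, a4, a5⟩, (mem_support_configMono a2 a4 y).2 (Or.inr a6)⟩
    by_cases ho : opp y ∈ L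
    · rw [corr_of_not_nodup (by rw [List.nodup_cons]; tauto), mul_zero, Finset.sum_eq_zero]
      intro ω hω
      rw [h1] at hω
      simp only [Finset.mem_filter, mem_cfg] at hω
      exact absurd hω.2.1 (edge_opp y ▸ hω.2.2.2.2.2.1 _ ho)
    · by_cases he : y.edge ∈ edges V
      · have hne : ∀ k ∈ L, k.edge ≠ y.edge := by
          intro k hk e
          rcases (edge_eq_iff k y).1 e with rfl | rfl
          · exact hyL hk
          · exact ho hk
        have hgm : ∀ ω : Finset Edge, y.edge ∉ ω → gen y * configMono L (insert y.edge ω) =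
            stepSign y.2 • configMono (opp y :: L) ω := by
          intro ω hω
          rw [configMono_insert hω hne, mul_smul_comm, configMono_cons, ← mul_assoc, gen_mul_self,
            one_mul]
        have hgm' : ∀ ω : Finset Edge, y.edge ∉ ω → configMono L (insert y.edge ω) =
            stepSign y.2 • (gen y * configMono (opp y :: L) ω) := by
          intro ω hω
          rw [configMono_insert hω hne, configMono_cons]
        have e2 : (edges V).powerset.filter
            (fun ω => y.edge ∉ ω ∧ insert y.edge ω ∈ cfg V (oddAt y.1) L) =
            cfg V 1 (opp y :: L) := by
          ext ω
          simp only [Finset.mem_filter, Finset.mem_powerset, mem_cfg, List.nodup_cons, List.mem_cons,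
            forall_eq_or_imp, edge_opp, Finset.insert_subset_iff, ho, he, true_and,
            not_false_eq_true, (edge_mem_edges.1 he).2, Finset.mem_insert, not_or]
          have hp : y.edge ∉ ω → ∀ w,
              (par w (configMono L (insert y.edge ω)).support = oddAt y.1 w ↔
              par w (configMono (opp y :: L) ω).support = (1 : Vtx → ℤˣ) w) := by
            intro hω w
            rw [oddAt, Pi.one_apply, hgm' ω hω, support_smul, par_mul, par_gen]
            generalize par w (configMono (opp y :: L) ω).support = x
            have aux : ∀ p x : ℤˣ, (p * x = p ↔ x = 1) := by decide
            exact aux _ _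
          constructor
          · rintro ⟨a1, a2, -, a3, a4, a5, a6⟩
            exact ⟨a1, a3, a4, ⟨a2, fun k hk => (a5 k hk).2⟩, fun w => (hp a2 w).1 (a6 w)⟩
          · rintro ⟨a1, a3, a4, ⟨a2, a5⟩, a6⟩
            exact ⟨a1, a2, a1, a3, a4, fun k hk => ⟨hne k hk, a5 k hk⟩, fun w => (hp a2 w).2 (a6 w)⟩
        rw [h1, sum_insert_edge he, e2, corr, Finset.mul_sum]
        refine Finset.sum_congr rfl fun ω hω => ?_
        have h2 : y.edge ∉ ω := edge_opp y ▸ (mem_cfg.1 hω).2.2.2.1 (opp y) (by simp)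
        rw [weight_insert a h2, hgm ω h2, sign_smul, hop]
        push_cast; ring
      · rw [corr_of_notMem (h := opp y) (by simp) fun h => he (edge_mem_edges.2 ⟨hy, h⟩), mul_zero,
          Finset.sum_eq_zero]
        intro ω hω
        rw [h1] at hω
        simp only [Finset.mem_filter, mem_cfg] at hω
        exact absurd (hω.2.2.1 hω.2.1) he

/-- The sign of the passage from the direction `d` to the next one: the spinors change sign around
a vertex. -/
def wrap (d : Fin 4) : ℤˣ := if d = 3 then -1 else 1

/-- Moving a generator past the next half-edge around a vertex, in front of a monomial that is odd
at this vertex. -/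
lemma inv_succ (v : Vtx) (d : Fin 4) (A : Finset Half) (hA : par v A = -1) :
    inv {(v, d + 1)} A = wrap d * sgn ((v, d) ∈ A) * inv {(v, d)} A := by
  have hd : d ≠ d + 1 := by revert d; decide
  have hne : ((v, d) : Half) ≠ (v, d + 1) := fun h => hd (Prod.mk.inj h).2
  have h1 := inv_pair_left v hd A
  have h2 : inv {(v, d), (v, d + 1)} A = inv {(v, d)} A * inv {(v, d + 1)} A := by
    unfold inv; rw [Finset.prod_pair hne, Finset.prod_singleton, Finset.prod_singleton]
  have h3 : inv {(v, d), (v, d + 1)} A = wrap d * sgn ((v, d) ∈ A) := by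
    rw [h1]
    rw [par_eq_prod] at hA
    simp only [Fin.prod_univ_four, eps_same, sgn] at hA ⊢
    clear h1 h2 hne hd
    by_cases h0 : (v, 0) ∈ A <;> by_cases h1 : (v, 1) ∈ A <;> by_cases h2 : (v, 2) ∈ A <;>
      by_cases h3 : (v, 3) ∈ A <;> simp only [h0, h1, h2, h3, if_true, if_false] at hA ⊢ <;>
      first
      | exact absurd hA (by decide)
      | (fin_cases d <;> simp [h0, h1, h2, h3, wrap])
  rw [← h3, h2, mul_comm, ← mul_assoc, Int.units_mul_self, one_mul]

/-- The linear relation between the correlation functions at two consecutive half-edges of a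
vertex; it is equivalent to s-holomorphicity at the corner between them. -/
theorem corner_relation {V : Finset Vtx} {a : Face} {L : List Half} {v : Vtx} (hv : v ∈ V)
    (d : Fin 4) (hL : L.Nodup) (hLV : ∀ h ∈ L, h.1 ∈ V) :
    corr V a ((v, d) :: L) -
        (hop a (v, d) * corr V a (opp (v, d) :: L) + contract V a L (v, d)) =
      ((wrap d : ℤ) : ℝ) * (corr V a ((v, d + 1) :: L) +
        (hop a (v, d + 1) * corr V a (opp (v, d + 1) :: L) + contract V a L (v, d + 1))) := by
  rw [hop_mul_corr (y := (v, d)) hv hL hLV, hop_mul_corr (y := (v, d + 1)) hv hL hLV,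
    corr_cons (y := (v, d)) hv, corr_cons (y := (v, d + 1)) hv]
  simp only [Finset.sum_filter]
  rw [← Finset.sum_sub_distrib, ← Finset.sum_add_distrib, Finset.mul_sum]
  refine Finset.sum_congr rfl fun ω hω => ?_
  have hp := (mem_cfg.1 hω).2.2.2.2 v
  rw [oddAt, if_pos rfl] at hp
  have hs := inv_succ v d _ hp
  have e1 : ∀ y : Half, (gen y * configMono L ω).sign =
      (configMono L ω).sign * inv {y} (configMono L ω).support := by
    intro y; rw [sign_mul]; simp
  rw [e1, e1, hs]
  have hw : (((wrap d : ℤˣ) : ℤ) : ℝ) * ((wrap d : ℤˣ) : ℤ) = 1 := by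
    rw [← Int.cast_mul, ← Units.val_mul, Int.units_mul_self]; simp
  unfold sgn
  split_ifs <;> push_cast <;> first
    | linear_combination (weight a ω * ((configMono L ω).sign : ℤ) *
        ((inv {(v, d)} (configMono L ω).support : ℤˣ) : ℤ)) * hw
    | linear_combination -(weight a ω * ((configMono L ω).sign : ℤ) *
        ((inv {(v, d)} (configMono L ω).support : ℤˣ) : ℤ)) * hw

/-! ### Positivity of the partition function -/

lemma alpha_eq : alpha = Real.sqrt 2 - 1 := by
  have h : (0 : ℝ) < Real.sqrt 2 + 1 := by positivity
  rw [alpha, betaC, show -2 * (Real.log (Real.sqrt 2 + 1) / 2) = -Real.log (Real.sqrt 2 + 1) by ring,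
    Real.exp_neg, Real.exp_log h]
  refine inv_eq_of_mul_eq_one_left ?_
  have := Real.mul_self_sqrt (show (0 : ℝ) ≤ 2 by norm_num)
  linear_combination this

lemma alpha_pos : 0 < alpha := Real.exp_pos _

lemma alpha_lt_one : alpha < 1 := by
  rw [alpha_eq, sub_lt_iff_lt_add, Real.sqrt_lt' (by norm_num)]; norm_num

lemma prod_halves (ω : Finset Edge) (f : Half → ℤˣ) :
    ∏ h ∈ halves ω, f h = ∏ e ∈ ω, f (half1 e) * f (half2 e) := by
  rw [halves, Finset.prod_biUnion]
  · exact Finset.prod_congr rfl fun e _ => Finset.prod_pair (half1_ne_half2 e)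
  · intro e _ e' _ hee
    rw [Function.onFun, Finset.disjoint_left]
    intro h hh hh'
    have aux : ∀ e : Edge, h ∈ ({half1 e, half2 e} : Finset Half) → h.edge = e := by
      intro e he
      rcases Finset.mem_insert.1 he with rfl | he
      · exact edge_half1 e
      · rw [Finset.mem_singleton.1 he]; exact edge_half2 e
    exact hee ((aux e hh).symm.trans (aux e' hh'))

lemma cfg_nil_iff {V : Finset Vtx} {ω : Finset Edge} :
    ω ∈ cfg V 1 [] ↔ ω ⊆ edges V ∧ ∀ v, par v (halves ω) = 1 := by
  simp [mem_cfg, configMono, support_edgesMono]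

lemma configMono_nil_sign {V : Finset Vtx} {ω : Finset Edge} (h : ω ∈ cfg V 1 []) :
    (configMono [] ω).sign = 1 := by
  have : configMono [] ω = edgesMono ω := by simp [configMono]
  rw [this, edgesMono_of_even (cfg_nil_iff.1 h).2]

lemma par_halves_of_notMem {V : Finset Vtx} {ω : Finset Edge} (h : ω ⊆ edges V) {v : Vtx}
    (hv : v ∉ V) : par v (halves ω) = 1 := by
  refine Finset.prod_eq_one fun k hk => if_neg ?_
  rintro rfl
  exact hv (edge_mem_edges.1 (h (mem_halves.1 hk))).1

/-- High-temperature expansion: the partition function is, up to a factor, the sum over all spin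
configurations on the vertices of a product of positive numbers. -/
theorem corr_nil_pos (V : Finset Vtx) (a : Face) : 0 < corr V a [] := by
  classical
  set x : Edge → ℝ := fun e => alpha * ((cut a e : ℤ) : ℝ) with hx
  have h1 : corr V a [] = ∑ ω ∈ (edges V).powerset,
      if (∀ v, par v (halves ω) = 1) then ∏ e ∈ ω, x e else 0 := by
    rw [← Finset.sum_filter]
    refine Finset.sum_congr ?_ ?_
    · ext ω; rw [cfg_nil_iff, Finset.mem_filter, Finset.mem_powerset]
    · intro ω hω
      have hω' : ω ∈ cfg V 1 [] := by
        rw [Finset.mem_filter, Finset.mem_powerset] at hω; exact cfg_nil_iff.2 hω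
      rw [configMono_nil_sign hω', weight, hx, Finset.prod_mul_distrib, Finset.prod_const, loops]
      push_cast; ring
  have h2 : ∀ ω ∈ (edges V).powerset, (2 : ℝ) ^ V.card *
      (if (∀ v, par v (halves ω) = 1) then ∏ e ∈ ω, x e else 0) =
      ∑ S ∈ V.powerset, ∏ e ∈ ω, x e * ((∏ v ∈ S,
        (if (half1 e).1 = v then -1 else 1) * (if (half2 e).1 = v then -1 else 1) : ℤˣ) : ℤ) := by
    intro ω hω
    have h3 : ∀ S : Finset Vtx, ∏ e ∈ ω, x e * (((∏ v ∈ S,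
        (if (half1 e).1 = v then -1 else 1) * (if (half2 e).1 = v then -1 else 1) : ℤˣ) : ℤ) : ℝ) =
        (∏ e ∈ ω, x e) * ∏ v ∈ S, ((par v (halves ω) : ℤ) : ℝ) := by
      intro S
      rw [Finset.prod_mul_distrib]
      congr 1
      have : ∏ e ∈ ω, ∏ v ∈ S, ((if (half1 e).1 = v then -1 else 1) *
          (if (half2 e).1 = v then -1 else 1) : ℤˣ) = ∏ v ∈ S, par v (halves ω) := by
        rw [Finset.prod_comm]
        exact Finset.prod_congr rfl fun v _ =>
          (prod_halves ω fun h => if h.1 = v then -1 else 1).symm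
      have := congrArg (fun u : ℤˣ => ((u : ℤ) : ℝ)) this
      push_cast at this
      push_cast
      exact this
    rw [Finset.sum_congr rfl fun S _ => h3 S, ← Finset.mul_sum, mul_comm]
    have h4 : ∑ S ∈ V.powerset, ∏ v ∈ S, ((par v (halves ω) : ℤ) : ℝ) =
        ∏ v ∈ V, (1 + ((par v (halves ω) : ℤ) : ℝ)) := by
      rw [Finset.prod_one_add]
    rw [h4]
    split_ifs with hp
    · congr 1
      rw [Finset.prod_congr rfl fun v _ => by rw [hp v], Finset.prod_const]; norm_num
    · push Not at hp
      obtain ⟨v, hv⟩ := hp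
      have hvV : v ∈ V := by
        by_contra h; exact hv (par_halves_of_notMem (Finset.mem_powerset.1 hω) h)
      rw [Finset.prod_eq_zero hvV, mul_zero, zero_mul]
      rcases Int.units_eq_one_or (par v (halves ω)) with h | h
      · exact absurd h hv
      · rw [h]; simp
  have h5 : (2 : ℝ) ^ V.card * corr V a [] = ∑ S ∈ V.powerset, ∏ e ∈ edges V, (1 + x e *
      ((∏ v ∈ S, (if (half1 e).1 = v then -1 else 1) *
        (if (half2 e).1 = v then -1 else 1) : ℤˣ) : ℤ)) := by
    rw [h1, Finset.mul_sum, Finset.sum_congr rfl h2, Finset.sum_comm]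
    refine Finset.sum_congr rfl fun S _ => ?_
    rw [Finset.prod_one_add]
  have hu : ∀ u : ℤˣ, |((u : ℤ) : ℝ)| = 1 := by
    intro u; rcases Int.units_eq_one_or u with h | h <;> simp [h]
  have h6 : 0 < (2 : ℝ) ^ V.card * corr V a [] := by
    rw [h5]
    refine Finset.sum_pos (fun S _ => Finset.prod_pos fun e _ => ?_) ⟨∅, by simp⟩
    generalize (∏ v ∈ S, ((if (half1 e).1 = v then -1 else 1) *
        (if (half2 e).1 = v then -1 else 1) : ℤˣ)) = u
    have : |x e * ((u : ℤ) : ℝ)| < 1 := by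
      rw [abs_mul, hu, mul_one, hx]
      simp only [abs_mul, hu, mul_one, abs_of_pos alpha_pos]
      exact alpha_lt_one
    linarith [(abs_lt.1 this).1]
  exact pos_of_mul_pos_right h6 (by positivity)

/-! ### Wick's formula -/

/-- The linear operator of the relations around the vertices, a discrete Dirac operator: `u`
satisfies the homogeneous form of `corner_relation` at `y` and the next half-edge if `dirac a u y =
0`. -/
def dirac (a : Face) (u : Half → ℝ) (y : Half) : ℝ :=
  u y - hop a y * u (opp y) - ((wrap y.2 : ℤ) : ℝ) *
    (u (y.1, y.2 + 1) + hop a (y.1, y.2 + 1) * u (opp (y.1, y.2 + 1)))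

lemma dirac_corr {V : Finset Vtx} {a : Face} {L : List Half} {y : Half} (hy : y.1 ∈ V)
    (hL : L.Nodup) (hLV : ∀ h ∈ L, h.1 ∈ V) :
    dirac a (fun z => corr V a (z :: L)) y =
      contract V a L y + ((wrap y.2 : ℤ) : ℝ) * contract V a L (y.1, y.2 + 1) := by
  have := corner_relation (a := a) (L := L) hy y.2 hL hLV
  rw [dirac]
  linear_combination this

lemma dirac_altSum (a : Face) (u : Half → List Half → List Half → Half → ℝ) (L : List Half)
    (y : Half) :
    dirac a (fun z => altSum (fun x B C => u x B C z) L) y =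
      altSum (fun x B C => dirac a (u x B C) y) L := by
  simp only [dirac]
  rw [← altSum_mul_left (hop a y), ← altSum_mul_left (hop a (y.1, y.2 + 1)), ← altSum_add,
    ← altSum_mul_left, sub_eq_add_neg, sub_eq_add_neg, ← neg_one_mul, ← altSum_mul_left,
    ← altSum_add, ← neg_one_mul (altSum _ _), ← altSum_mul_left, ← altSum_add]
  refine altSum_congr fun B x C _ => ?_
  ring

/-- The relations around the vertices determine a function: by the two-point correlations they can
be solved for every right-hand side, and there are as many relations as unknowns. -/
lemma eq_zero_of_dirac {V : Finset Vtx} {a : Face} {u : Half → ℝ} (hu : ∀ h, h.1 ∉ V → u h = 0)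
    (h0 : ∀ y, y.1 ∈ V → dirac a u y = 0) : u = 0 := by
  classical
  set ι := {h : Half // h ∈ V ×ˢ (Finset.univ : Finset (Fin 4))} with hι
  have hmem : ∀ h : Half, h ∈ V ×ˢ (Finset.univ : Finset (Fin 4)) ↔ h.1 ∈ V := by
    intro h; simp
  set ext : (ι → ℝ) → Half → ℝ := fun f h =>
    if hh : h ∈ V ×ˢ (Finset.univ : Finset (Fin 4)) then f ⟨h, hh⟩ else 0 with hext
  have ext_add : ∀ f g h, ext (f + g) h = ext f h + ext g h := by
    intro f g h; simp only [hext]; split_ifs <;> simp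
  have ext_smul : ∀ (c : ℝ) f h, ext (c • f) h = c * ext f h := by
    intro c f h; simp only [hext]; split_ifs <;> simp
  let D : (ι → ℝ) →ₗ[ℝ] (ι → ℝ) :=
    { toFun := fun f y => dirac a (ext f) y.1
      map_add' := fun f g => by
        funext y; simp only [dirac, ext_add, Pi.add_apply]; ring
      map_smul' := fun c f => by
        funext y; simp only [dirac, ext_smul, Pi.smul_apply, smul_eq_mul, RingHom.id_apply]; ring }
  have hZ := corr_nil_pos V a
  -- applied to a two-point correlation, the operator gives a combination of two unit vectors
  have hsol : ∀ x : ι, D (fun y => corr V a [y.1, x.1]) = fun y : ι =>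
      corr V a [] * ((if x.1 = y.1 then 1 else 0) +
        ((wrap y.1.2 : ℤ) : ℝ) * (if x.1 = (y.1.1, y.1.2 + 1) then 1 else 0)) := by
    intro x
    funext y
    have hx := (hmem x.1).1 x.2
    have hy := (hmem y.1).1 y.2
    have he : ext (fun y => corr V a [y.1, x.1]) = fun z => corr V a (z :: [x.1]) := by
      funext z
      simp only [hext]
      split_ifs with hz
      · rfl
      · exact (corr_of_notMem (h := z) (by simp) (fun h => hz ((hmem z).2 h))).symm
    change dirac a (ext (fun y => corr V a [y.1, x.1])) y.1 = _
    rw [he, dirac_corr hy (by simp) (by simpa using hx)]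
    simp only [contract, altSum, List.append_nil, sub_zero]
    split_ifs <;> ring
  have hsurj : Function.Surjective D := by
    intro φ
    set f := ext φ with hf
    -- `ψ` solves `ψ y + wrap y * ψ (next y) = f y`; going once around the vertex multiplies by
    -- the product `-1` of the four signs `wrap`, which makes this possible
    set ψ : Half → ℝ := fun y => (1 / 2) * (f y - ((wrap y.2 : ℤ) : ℝ) * (f (y.1, y.2 + 1) -
      ((wrap (y.2 + 1) : ℤ) : ℝ) * (f (y.1, y.2 + 2) -
      ((wrap (y.2 + 2) : ℤ) : ℝ) * f (y.1, y.2 + 3)))) with hψ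
    refine ⟨(corr V a [])⁻¹ • ∑ x : ι, ψ x.1 • (fun y : ι => corr V a [y.1, x.1]), ?_⟩
    rw [map_smul, map_sum]
    funext y
    have hy := (hmem y.1).1 y.2
    simp only [map_smul, hsol, Pi.smul_apply, Finset.sum_apply, smul_eq_mul]
    have hs1 : ∑ x : ι, ψ x.1 * (if x.1 = y.1 then (1 : ℝ) else 0) = ψ y.1 := by
      rw [Finset.sum_eq_single y]
      · simp
      · intro x _ hx; rw [if_neg (fun e => hx (Subtype.ext e)), mul_zero]
      · simp
    have hs2 : ∑ x : ι, ψ x.1 * (if x.1 = (y.1.1, y.1.2 + 1) then (1 : ℝ) else 0) =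
        ψ (y.1.1, y.1.2 + 1) := by
      rw [Finset.sum_eq_single ⟨(y.1.1, y.1.2 + 1), (hmem _).2 hy⟩]
      · simp
      · intro x _ hx; rw [if_neg (fun e => hx (Subtype.ext e)), mul_zero]
      · simp
    have hsum : ∑ x : ι, ψ x.1 * (corr V a [] * ((if x.1 = y.1 then 1 else 0) +
        ((wrap y.1.2 : ℤ) : ℝ) * (if x.1 = (y.1.1, y.1.2 + 1) then 1 else 0))) =
        corr V a [] * (ψ y.1 + ((wrap y.1.2 : ℤ) : ℝ) * ψ (y.1.1, y.1.2 + 1)) := by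
      rw [← hs1, ← hs2, Finset.mul_sum, ← Finset.sum_add_distrib, Finset.mul_sum]
      refine Finset.sum_congr rfl fun x _ => ?_
      ring
    rw [hsum, inv_mul_cancel_left₀ hZ.ne']
    have hfy : φ y = f y.1 := by
      rw [hf]; simp only [hext]; rw [dif_pos y.2]
    rw [hfy]
    obtain ⟨⟨v, d⟩, hvd⟩ := y
    simp only [hψ]
    fin_cases d <;> simp [wrap] <;> ring
  have hinj : Function.Injective D := LinearMap.injective_iff_surjective.2 hsurj
  have hext_u : ext (fun y : ι => u y.1) = u := by
    funext h
    simp only [hext]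
    split_ifs with hh
    · rfl
    · exact (hu h fun h' => hh ((hmem h).2 h')).symm
  have hz : (fun y : ι => u y.1) = 0 := by
    apply hinj
    rw [map_zero]
    funext y
    change dirac a (ext (fun y : ι => u y.1)) y.1 = 0
    rw [hext_u]
    exact h0 y.1 ((hmem _).1 y.2)
  rw [← hext_u, hz]
  funext h
  simp [hext]

/-- Wick's formula: expansion of a correlation function with respect to its first point. -/
theorem corr_wick {V : Finset Vtx} {a : Face} {L : List Half} (hL : L.Nodup)
    (hLV : ∀ h ∈ L, h.1 ∈ V) (y : Half) :
    corr V a [] * corr V a (y :: L) =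
      altSum (fun x B C => corr V a [y, x] * corr V a (B ++ C)) L := by
  -- the two sides of the formula satisfy the same relations around the vertices
  have key := eq_zero_of_dirac (V := V) (a := a) (u := fun y => corr V a [] * corr V a (y :: L) -
    altSum (fun x B C => corr V a [y, x] * corr V a (B ++ C)) L) ?_ ?_
  · exact sub_eq_zero.1 (congrFun key y)
  · intro h hh
    rw [corr_of_notMem (L := h :: L) (h := h) (by simp) hh, altSum_eq_zero, mul_zero, sub_zero]
    intro B x C _
    rw [corr_of_notMem (h := h) (by simp) hh, zero_mul]
  · intro y hy
    have h1 : dirac a (fun y => corr V a [] * corr V a (y :: L) -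
        altSum (fun x B C => corr V a [y, x] * corr V a (B ++ C)) L) y =
        corr V a [] * dirac a (fun y => corr V a (y :: L)) y -
        dirac a (fun y => altSum (fun x B C => corr V a [y, x] * corr V a (B ++ C)) L) y := by
      simp only [dirac]; ring
    rw [h1, dirac_corr hy hL hLV,
      dirac_altSum a (fun x B C y => corr V a [y, x] * corr V a (B ++ C)), contract, contract,
      ← altSum_mul_left, ← altSum_add, ← altSum_mul_left, sub_eq_zero]
    refine altSum_congr fun B x C hC => ?_
    have hx : x.1 ∈ V := hLV x (by rw [hC]; simp)
    have h2 : dirac a (fun y => corr V a [y, x] * corr V a (B ++ C)) y =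
        dirac a (fun y => corr V a (y :: [x])) y * corr V a (B ++ C) := by
      simp only [dirac]; ring
    rw [h2, dirac_corr hy (by simp) (by simpa using hx)]
    simp only [contract, altSum, List.append_nil, sub_zero]
    split_ifs <;> ring

/-! ### Pfaffians by expansion along the first row -/

section PfL

variable {ι : Type*}

/-- Auxiliary function for `pfL`; its first argument bounds the length of the list. -/
def pfAux (A : ι → ι → ℂ) : ℕ → List ι → ℂ
  | 0, _ => 1
  | _ + 1, [] => 1
  | n + 1, x :: L => altSum (fun y B C => A x y * pfAux A n (B ++ C)) L

/-- The Pfaffian of the antisymmetric matrix with the entries `A x y` for `x` before `y` in the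
list, defined by expansion along the first row. -/
def pfL (A : ι → ι → ℂ) (L : List ι) : ℂ := pfAux A L.length L

lemma pfAux_congr (A : ι → ι → ℂ) (n : ℕ) : ∀ (m : ℕ) (L : List ι), L.length ≤ n →
    L.length ≤ m → pfAux A n L = pfAux A m L := by
  have h0 : ∀ m, pfAux A m [] = 1 := fun m => by cases m <;> rfl
  induction n with
  | zero => intro m L hL _; rw [List.length_eq_zero_iff.1 (Nat.le_zero.1 hL), h0, h0]
  | succ n ih =>
    intro m L hn hm
    cases L with
    | nil => rw [h0, h0]
    | cons x L =>
      obtain ⟨m, rfl⟩ : ∃ k, m = k + 1 := ⟨m - 1, by simp at hm; omega⟩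
      rw [pfAux, pfAux]
      refine altSum_congr fun B y C e => ?_
      have : (B ++ C).length ≤ L.length := by rw [e]; simp
      simp only [List.length_cons] at hn hm
      rw [ih m _ (by omega) (by omega)]

@[simp] lemma pfL_nil (A : ι → ι → ℂ) : pfL A [] = 1 := rfl

lemma pfL_cons (A : ι → ι → ℂ) (x : ι) (L : List ι) :
    pfL A (x :: L) = altSum (fun y B C => A x y * pfL A (B ++ C)) L := by
  rw [pfL, List.length_cons, pfAux]
  refine altSum_congr fun B y C e => ?_
  rw [pfL, pfAux_congr A _ _ _ _ le_rfl]
  rw [e]; simp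

/-- Induction on lists in which some element of the tail may be dropped along with the head. -/
lemma list_induction_drop {P : List ι → Prop} (nil : P [])
    (cons : ∀ x L, (∀ B y C, L = B ++ y :: C → P (B ++ C)) → P (x :: L)) (L : List ι) : P L := by
  induction h : L.length using Nat.strong_induction_on generalizing L with
  | _ n ih =>
    cases L with
    | nil => exact nil
    | cons x L =>
      refine cons x L fun B y C e => ih _ ?_ _ rfl
      rw [← h, e]; simp

lemma pfL_congr {A A' : ι → ι → ℂ} (L : List ι) :
    L.Pairwise (fun x y => A x y = A' x y) → pfL A L = pfL A' L := by
  induction L using list_induction_drop with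
  | nil => intro _; rfl
  | cons x L ih =>
    intro h
    rw [List.pairwise_cons] at h
    rw [pfL_cons, pfL_cons]
    refine altSum_congr fun B y C e => ?_
    have hs : (B ++ C).Sublist L := by rw [e]; simp
    rw [ih B y C e (h.2.sublist hs), h.1 y (by rw [e]; simp)]

lemma pfL_map {κ : Type*} (A : ι → ι → ℂ) (f : κ → ι) (L : List κ) :
    pfL A (L.map f) = pfL (fun x y => A (f x) (f y)) L := by
  have hmap : ∀ (g : ι → List ι → List ι → ℂ) (L : List κ),
      altSum g (L.map f) = altSum (fun x B C => g (f x) (B.map f) (C.map f)) L := by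
    intro g L
    induction L generalizing g with
    | nil => rfl
    | cons x L ih => rw [List.map_cons, altSum, altSum, ih]; rfl
  induction L using list_induction_drop with
  | nil => rfl
  | cons x L ih =>
    rw [List.map_cons, pfL_cons, pfL_cons, hmap]
    refine altSum_congr fun B y C e => ?_
    rw [← ih B y C e, List.map_append]

/-- Rows and columns of a Pfaffian may be scaled. -/
lemma pfL_scale (A : ι → ι → ℂ) (c : ι → ℂ) (L : List ι) :
    pfL (fun x y => c x * c y * A x y) L = (L.map c).prod * pfL A L := by
  induction L using list_induction_drop with
  | nil => simp
  | cons x L ih =>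
    rw [pfL_cons, pfL_cons, ← altSum_mul_left]
    refine altSum_congr fun B y C e => ?_
    rw [ih B y C e, e]
    simp only [List.map_cons, List.map_append, List.prod_cons, List.prod_append]
    ring

/-- A Pfaffian is an affine function of each entry of the matrix. -/
lemma pfL_add_entry [DecidableEq ι] (A : ι → ι → ℂ) (t : ℂ) {a b : ι} (L₁ L₂ L₃ : List ι)
    (h : (L₁ ++ a :: (L₂ ++ b :: L₃)).Nodup) :
    pfL (fun x y => A x y + if x = a ∧ y = b then t else 0) (L₁ ++ a :: (L₂ ++ b :: L₃)) =
      pfL A (L₁ ++ a :: (L₂ ++ b :: L₃)) + (-1) ^ L₂.length * t * pfL A (L₁ ++ (L₂ ++ L₃)) := by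
  set A' : ι → ι → ℂ := fun x y => A x y + if x = a ∧ y = b then t else 0 with hA'
  -- the perturbation is not seen by lists that lack one of the two indices
  have hfar : ∀ L : List ι, a ∉ L ∨ b ∉ L → pfL A' L = pfL A L := by
    intro L hL
    refine pfL_congr L (List.pairwise_of_forall_mem_list fun x hx y hy => ?_)
    rw [hA']
    simp only
    rw [if_neg, add_zero]
    rintro ⟨rfl, rfl⟩
    exact hL.elim (fun h => h hx) fun h => h hy
  induction hn : (L₁ ++ (L₂ ++ L₃)).length using Nat.strong_induction_on
    generalizing L₁ L₂ L₃ with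
  | _ n ih =>
    cases L₁ with
    | nil =>
      rw [List.nil_append, List.nil_append] at *
      have ha := (List.nodup_cons.1 h).1
      rw [pfL_cons, pfL_cons]
      have h1 : ∀ B y C, L₂ ++ b :: L₃ = B ++ y :: C → A' a y * pfL A' (B ++ C) =
          A a y * pfL A (B ++ C) + if y = b then t * pfL A (B ++ C) else 0 := by
        intro B y C e
        rw [hfar _ (Or.inl fun hh => ha (by rw [e]; simp at hh ⊢; tauto)), hA']
        simp only [true_and]
        split_ifs <;> ring
      rw [altSum_congr h1, altSum_add, altSum_ite (List.nodup_cons.1 h).2]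
      ring
    | cons x L₁ =>
      simp only [List.cons_append] at h hn ⊢
      have hx := (List.nodup_cons.1 h).1
      have hnd := (List.nodup_cons.1 h).2
      have hxa : ∀ y, A' x y = A x y := by
        intro y
        rw [hA']; simp only; rw [if_neg, add_zero]
        rintro ⟨rfl, -⟩
        exact hx (by simp)
      have hsub : ∀ L : List ι, L.Sublist (L₁ ++ a :: (L₂ ++ b :: L₃)) → L.Nodup :=
        fun L hL => hL.nodup hnd
      simp only [List.length_cons, List.length_append] at hn
      have key1 : ∀ B y C, L₁ = B ++ y :: C →
          A' x y * pfL A' (B ++ (C ++ a :: (L₂ ++ b :: L₃))) =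
          A x y * pfL A (B ++ (C ++ a :: (L₂ ++ b :: L₃))) +
          (-1) ^ L₂.length * t * (A x y * pfL A (B ++ (C ++ (L₂ ++ L₃)))) := by
        intro B y C e
        have := ih ((B ++ C ++ (L₂ ++ L₃)).length) (by rw [← hn, e]; simp; omega)
          (B ++ C) L₂ L₃ (hsub _ (by rw [e]; simp)) rfl
        simp only [List.append_assoc] at this
        rw [hxa, this]; ring
      have key2 : ∀ B y C, L₂ = B ++ y :: C →
          A' x y * pfL A' (L₁ ++ a :: (B ++ (C ++ b :: L₃))) =
          A x y * pfL A (L₁ ++ a :: (B ++ (C ++ b :: L₃))) +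
          -((-1) ^ L₂.length * t) * (A x y * pfL A (L₁ ++ (B ++ (C ++ L₃)))) := by
        intro B y C e
        have := ih ((L₁ ++ (B ++ C ++ L₃)).length) (by rw [← hn, e]; simp; omega)
          L₁ (B ++ C) L₃ (hsub _ (by rw [e]; simp)) rfl
        simp only [List.append_assoc] at this
        have hl : L₂.length = (B ++ C).length + 1 := by rw [e]; simp; omega
        rw [hxa, this, hl, pow_succ]; ring
      have key3 : ∀ B y C, L₃ = B ++ y :: C →
          A' x y * pfL A' (L₁ ++ a :: (L₂ ++ b :: (B ++ C))) =
          A x y * pfL A (L₁ ++ a :: (L₂ ++ b :: (B ++ C))) +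
          (-1) ^ L₂.length * t * (A x y * pfL A (L₁ ++ (L₂ ++ (B ++ C)))) := by
        intro B y C e
        have := ih ((L₁ ++ (L₂ ++ (B ++ C))).length) (by rw [← hn, e]; simp)
          L₁ L₂ (B ++ C) (hsub _ (by rw [e]; simp)) rfl
        rw [hxa, this]; ring
      have hb : pfL A' (L₁ ++ a :: (L₂ ++ L₃)) = pfL A (L₁ ++ a :: (L₂ ++ L₃)) := by
        refine hfar _ (Or.inr fun hh => ?_)
        have : (b :: (L₁ ++ a :: (L₂ ++ L₃))).Nodup := by
          refine (List.Perm.nodup_iff ?_).1 hnd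
          refine (List.Perm.trans ?_ List.perm_middle)
          refine List.Perm.append_left _ ?_
          refine (List.Perm.trans (List.Perm.cons _ List.perm_middle) (List.Perm.swap _ _ _))
        exact (List.nodup_cons.1 this).1 hh
      have ha : pfL A' (L₁ ++ (L₂ ++ b :: L₃)) = pfL A (L₁ ++ (L₂ ++ b :: L₃)) :=
        hfar _ (Or.inl fun hh => (List.nodup_cons.1 (List.nodup_middle.1 hnd)).1 hh)
      rw [pfL_cons, pfL_cons, pfL_cons]
      simp only [altSum_append, altSum, List.append_assoc, List.cons_append, List.append_nil]
      rw [altSum_congr key1, altSum_congr key2, altSum_congr key3, altSum_add, altSum_add,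
        altSum_add, altSum_mul_left, altSum_mul_left, altSum_mul_left, hb, ha, hxa, hxa]
      have hs : ((-1 : ℂ) ^ L₂.length) * (-1) ^ L₂.length = 1 := by
        rw [← mul_pow]; simp
      ring

end PfL

/-! ### The recursion for Pfaffians -/

section Recursion

variable {p : ℕ}

/-- The permutation `0, j + 1, …` that continues by the permutation `ρ` of the other indices. -/
def extendPairing (j : Fin (2 * p + 1)) (ρ : Equiv.Perm (Fin (2 * p))) :
    Equiv.Perm (Fin (2 * (p + 1))) :=
  Equiv.Perm.decomposeFin.symm (0, j.cycleRange.symm * Equiv.Perm.decomposeFin.symm (0, ρ))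

lemma extendPairing_zero (j : Fin (2 * p + 1)) (ρ : Equiv.Perm (Fin (2 * p))) :
    extendPairing j ρ (0 : Fin (2 * p + 1 + 1)) = (0 : Fin (2 * p + 1 + 1)) :=
  Equiv.Perm.decomposeFin_symm_apply_zero _ _

lemma extendPairing_one (j : Fin (2 * p + 1)) (ρ : Equiv.Perm (Fin (2 * p))) :
    extendPairing j ρ (Fin.succ (0 : Fin (2 * p + 1))) = j.succ := by
  refine (Equiv.Perm.decomposeFin_symm_apply_succ _ _ _).trans ?_
  rw [Equiv.swap_self, Equiv.refl_apply, Equiv.Perm.mul_apply,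
    Equiv.Perm.decomposeFin_symm_apply_zero, Fin.cycleRange_symm_zero]

lemma extendPairing_succ (j : Fin (2 * p + 1)) (ρ : Equiv.Perm (Fin (2 * p))) (k : Fin (2 * p)) :
    extendPairing j ρ k.succ.succ = (j.succAbove (ρ k)).succ := by
  refine (Equiv.Perm.decomposeFin_symm_apply_succ _ _ _).trans ?_
  rw [Equiv.swap_self, Equiv.refl_apply, Equiv.Perm.mul_apply,
    Equiv.Perm.decomposeFin_symm_apply_succ, Equiv.swap_self, Equiv.refl_apply,
    Fin.cycleRange_symm_succ]

lemma sign_extendPairing (j : Fin (2 * p + 1)) (ρ : Equiv.Perm (Fin (2 * p))) :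
    Equiv.Perm.sign (extendPairing j ρ) = (-1) ^ (j : ℕ) * Equiv.Perm.sign ρ := by
  refine (Equiv.Perm.decomposeFin.symm_sign _ _).trans ?_
  rw [if_pos rfl, one_mul, Equiv.Perm.sign_mul, Equiv.Perm.sign_symm, Fin.sign_cycleRange,
    Equiv.Perm.decomposeFin.symm_sign, if_pos rfl, one_mul]

lemma extendPairing_even (j : Fin (2 * p + 1)) (ρ : Equiv.Perm (Fin (2 * p))) (k : Fin p) (h) :
    extendPairing j ρ ⟨2 * (k.succ : Fin (p + 1)), h⟩ =
      (j.succAbove (ρ ⟨2 * k, by omega⟩)).succ :=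
  extendPairing_succ j ρ ⟨2 * k, by omega⟩

lemma extendPairing_odd (j : Fin (2 * p + 1)) (ρ : Equiv.Perm (Fin (2 * p))) (k : Fin p) (h) :
    extendPairing j ρ ⟨2 * (k.succ : Fin (p + 1)) + 1, h⟩ =
      (j.succAbove (ρ ⟨2 * k + 1, by omega⟩)).succ :=
  extendPairing_succ j ρ ⟨2 * k + 1, by omega⟩

lemma extendPairing_injective :
    Function.Injective fun x : Fin (2 * p + 1) × Equiv.Perm (Fin (2 * p)) =>
      extendPairing x.1 x.2 := by
  rintro ⟨j, ρ⟩ ⟨j', ρ'⟩ h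
  simp only at h
  have hj : j = j' := by
    have := congrArg (fun π => π (Fin.succ (0 : Fin (2 * p + 1)))) h
    simp only [extendPairing_one] at this
    exact Fin.succ_injective _ this
  subst hj
  have hρ : ρ = ρ' := by
    ext k
    have := congrArg (fun π => π k.succ.succ) h
    simp only [extendPairing_succ] at this
    rw [Fin.succAbove_right_injective (Fin.succ_injective _ this)]
  rw [hρ]

lemma exists_extendPairing {π : Equiv.Perm (Fin (2 * (p + 1)))}
    (h : π (0 : Fin (2 * p + 1 + 1)) = (0 : Fin (2 * p + 1 + 1))) :
    ∃ j ρ, extendPairing j ρ = π := by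
  obtain ⟨⟨i, τ⟩, hτ⟩ := Equiv.Perm.decomposeFin.symm.surjective (π : Equiv.Perm (Fin (2 * p + 1).succ))
  have hi : i = 0 := by
    rw [← Equiv.Perm.decomposeFin_symm_apply_zero i τ, hτ]; exact h
  subst hi
  obtain ⟨⟨i, ρ⟩, hρ⟩ := Equiv.Perm.decomposeFin.symm.surjective
    ((τ 0).cycleRange * τ : Equiv.Perm (Fin (2 * p).succ))
  have hi : i = 0 := by
    rw [← Equiv.Perm.decomposeFin_symm_apply_zero i ρ, hρ, Equiv.Perm.mul_apply,
      Fin.cycleRange_self]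
  subst hi
  refine ⟨τ 0, ρ, ?_⟩
  rw [← hτ, extendPairing, hρ]
  congr 2
  ext k
  simp

lemma extendPairing_mem {j : Fin (2 * p + 1)} {ρ : Equiv.Perm (Fin (2 * p))} :
    extendPairing j ρ ∈ pairings (p + 1) ↔ ρ ∈ pairings p := by
  simp only [pairings, Finset.mem_filter, Finset.mem_univ, true_and]
  constructor
  · rintro ⟨h1, h2⟩
    refine ⟨fun k => ?_, fun k l hkl => ?_⟩
    · have := h1 k.succ
      rw [extendPairing_even, extendPairing_odd, Fin.succ_lt_succ_iff,
        Fin.succAbove_lt_succAbove_iff] at this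
      exact this
    · have := h2 k.succ l.succ (Fin.succ_lt_succ_iff.2 hkl)
      rw [extendPairing_even, extendPairing_even, Fin.succ_lt_succ_iff,
        Fin.succAbove_lt_succAbove_iff] at this
      exact this
  · rintro ⟨h1, h2⟩
    have h0 : ∀ h, extendPairing j ρ ⟨2 * ((0 : Fin (p + 1)) : ℕ), h⟩ = (0 : Fin (2 * p + 1 + 1)) :=
      fun _ => extendPairing_zero j ρ
    refine ⟨fun k => ?_, fun k l hkl => ?_⟩
    · refine Fin.cases ?_ (fun k => ?_) k
      · rw [h0]
        have : extendPairing j ρ ⟨2 * ((0 : Fin (p + 1)) : ℕ) + 1, by simp; omega⟩ = j.succ :=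
          extendPairing_one j ρ
        rw [this]
        exact Fin.succ_pos j
      · rw [extendPairing_even, extendPairing_odd, Fin.succ_lt_succ_iff,
          Fin.succAbove_lt_succAbove_iff]
        exact h1 k
    · induction k using Fin.cases with
      | zero =>
        induction l using Fin.cases with
        | zero => exact absurd hkl (lt_irrefl _)
        | succ l => rw [h0, extendPairing_even]; exact Fin.succ_pos _
      | succ k =>
        induction l using Fin.cases with
        | zero => exact absurd hkl (Fin.not_lt_zero _)
        | succ l =>
          rw [extendPairing_even, extendPairing_even, Fin.succ_lt_succ_iff,
            Fin.succAbove_lt_succAbove_iff]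
          exact h2 k l (Fin.succ_lt_succ_iff.1 hkl)

lemma pairings_zero_eq {π : Equiv.Perm (Fin (2 * (p + 1)))} (h : π ∈ pairings (p + 1)) :
    π (0 : Fin (2 * p + 1 + 1)) = (0 : Fin (2 * p + 1 + 1)) := by
  simp only [pairings, Finset.mem_filter, Finset.mem_univ, true_and] at h
  obtain ⟨h1, h2⟩ := h
  obtain ⟨i, hi⟩ := π.surjective (0 : Fin (2 * p + 1 + 1))
  have hmin : ∀ k, ¬ π k < (0 : Fin (2 * p + 1 + 1)) := fun k => Fin.not_lt_zero _
  have hk : i = ⟨2 * ((⟨i / 2, by omega⟩ : Fin (p + 1)) : ℕ), by simp; omega⟩ := by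
    rcases Nat.even_or_odd' (i : ℕ) with ⟨k, hk | hk⟩
    · ext; simp; omega
    · exfalso
      have := h1 ⟨k, by omega⟩
      have e : (⟨2 * k + 1, by omega⟩ : Fin (2 * (p + 1))) = i := by ext; simp; omega
      rw [e, hi] at this
      exact hmin _ this
  by_cases h0 : (i : ℕ) / 2 = 0
  · have : i = (0 : Fin (2 * p + 1 + 1)) := by rw [hk]; ext; simp [h0]
    rw [← this]; rw [hi, this]
  · have := h2 0 ⟨i / 2, by omega⟩ (by rw [Fin.lt_def]; simp; omega)
    rw [← hk, hi] at this
    exact absurd this (hmin _)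

/-- Expansion of a Pfaffian along the first row. -/
theorem pfaffian_succ (A : Matrix (Fin (2 * (p + 1))) (Fin (2 * (p + 1))) ℂ) :
    pfaffian A = ∑ j : Fin (2 * p + 1), (-1) ^ (j : ℕ) * (A (0 : Fin (2 * p + 1 + 1)) j.succ *
      pfaffian (Matrix.of fun k l => A (j.succAbove k).succ (j.succAbove l).succ)) := by
  have hsum : pfaffian A = ∑ x ∈ (Finset.univ : Finset (Fin (2 * p + 1))) ×ˢ pairings p,
      ((Equiv.Perm.sign (extendPairing x.1 x.2) : ℤ) : ℂ) *
        ∏ k : Fin (p + 1), A (extendPairing x.1 x.2 ⟨2 * k, by omega⟩)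
          (extendPairing x.1 x.2 ⟨2 * k + 1, by omega⟩) := by
    rw [pfaffian]
    symm
    refine Finset.sum_bij (fun x _ => extendPairing x.1 x.2) ?_ ?_ ?_ ?_
    · rintro ⟨j, ρ⟩ h
      exact extendPairing_mem.2 (Finset.mem_product.1 h).2
    · intro x _ y _ h
      exact extendPairing_injective h
    · intro π hπ
      obtain ⟨j, ρ, rfl⟩ := exists_extendPairing (pairings_zero_eq hπ)
      exact ⟨(j, ρ), Finset.mem_product.2 ⟨Finset.mem_univ _, extendPairing_mem.1 hπ⟩, rfl⟩
    · intros; rfl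
  rw [hsum, Finset.sum_product]
  refine Finset.sum_congr rfl fun j _ => ?_
  rw [pfaffian, Finset.mul_sum, Finset.mul_sum]
  refine Finset.sum_congr rfl fun ρ _ => ?_
  rw [Fin.prod_univ_succ, sign_extendPairing]
  simp only [extendPairing_even, extendPairing_odd, Matrix.of_apply]
  have e0 : extendPairing j ρ ⟨2 * ((0 : Fin (p + 1)) : ℕ), by simp⟩ = (0 : Fin (2 * p + 1 + 1)) :=
    extendPairing_zero j ρ
  have e1 : extendPairing j ρ ⟨2 * ((0 : Fin (p + 1)) : ℕ) + 1, by simp; omega⟩ = j.succ :=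
    extendPairing_one j ρ
  rw [e0, e1]
  push_cast
  ring

lemma altSum_ofFn {ι : Type*} {n : ℕ} (f : Fin (n + 1) → ι) (g : ι → List ι → ℂ) :
    altSum (fun x B C => g x (B ++ C)) (List.ofFn f) =
      ∑ j : Fin (n + 1), (-1) ^ (j : ℕ) * g (f j) (List.ofFn fun k => f (j.succAbove k)) := by
  induction n generalizing g with
  | zero => simp [altSum]
  | succ n ih =>
    rw [List.ofFn_succ, altSum, Fin.sum_univ_succ]
    have := ih (fun k => f k.succ) (fun x B => g x (f 0 :: B))
    simp only [List.cons_append]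
    rw [this, sub_eq_add_neg, ← Finset.sum_neg_distrib]
    congr 1
    · simp
    · refine Finset.sum_congr rfl fun j _ => ?_
      rw [List.ofFn_succ (f := fun k => f (j.succ.succAbove k))]
      simp [pow_succ]

/-- The sum over pairings agrees with the expansion along the first row. -/
theorem pfaffian_eq_pfL {ι : Type*} (A : ι → ι → ℂ) (f : Fin (2 * p) → ι) :
    pfaffian (Matrix.of fun j k => A (f j) (f k)) = pfL A (List.ofFn f) := by
  induction p with
  | zero =>
    have h : pairings 0 = {1} := by
      ext π
      have : π = 1 := Equiv.ext fun i => absurd i.2 (by simp)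
      simp [pairings, this]
    simp [pfaffian, h]
  | succ p ih =>
    have e : List.ofFn f = f (0 : Fin (2 * p + 1 + 1)) ::
        List.ofFn (fun k : Fin (2 * p + 1) => f k.succ) := List.ofFn_succ
    rw [pfaffian_succ, e, pfL_cons,
      altSum_ofFn (fun k : Fin (2 * p + 1) => f k.succ) (fun y L => A (f _) y * pfL A L)]
    refine Finset.sum_congr rfl fun j _ => ?_
    rw [← ih]
    rfl

end Recursion

/-! ### The spinors as correlation functions -/

/-- The correlation function of a list of half-edges with a function of the configuration. -/
def corrWith (V : Finset Vtx) (a : Face) (f : Finset Edge → ℝ) (L : List Half) : ℝ :=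
  ∑ ω ∈ cfg V 1 L, weight a ω * ((configMono L ω).sign : ℤ) * f ω

lemma corrWith_one (V : Finset Vtx) (a : Face) (L : List Half) :
    corrWith V a (fun _ => 1) L = corr V a L := by simp [corrWith, corr]

lemma corrWith_perm {V : Finset Vtx} {a : Face} {L L' : List Half} (f : Finset Edge → ℝ)
    (h : L.Perm L') {s : ℤˣ} (hs : (L.map gen).prod = s • (L'.map gen).prod) :
    corrWith V a f L = ((s : ℤ) : ℝ) * corrWith V a f L' := by
  have hm : ∀ ω, configMono L ω = s • configMono L' ω := fun ω => by
    rw [configMono, hs, smul_mul_assoc]; rfl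
  have hc : cfg V 1 L = cfg V 1 L' := by
    ext ω
    simp only [mem_cfg, h.nodup_iff, h.mem_iff, hm, support_smul]
  rw [corrWith, corrWith, hc, Finset.mul_sum]
  refine Finset.sum_congr rfl fun ω _ => ?_
  rw [hm, sign_smul]
  push_cast; ring

/-- The factor that relates the spinor at a doubly oriented point to the correlation function of
the corresponding half-edge. -/
def OPoint.theta (a : Face) (x : OPoint) : ℝ := Real.sqrt alpha * ((x.gauge a : ℤ) : ℝ)

/-- The normalized correlation function of two doubly oriented points, which may lie over the same
medial vertex. -/
def pairFun (V : Finset Vtx) (a : Face) (x y : OPoint) : ℝ :=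
  x.theta a * y.theta a * corr V a [x.half, y.half] / corr V a []

lemma mem_cfg_pointHalves {V : Finset Vtx} {N : ℕ} {b : Fin N → OPoint}
    (hb : Function.Injective fun j => (b j).edge) {ω : Finset Edge} :
    ω ∈ cfg V 1 (pointHalves b) ↔ ω ∈ configs V [] b := by
  have hnd : (pointHalves b).Nodup := List.nodup_ofFn.2 (half_injective hb)
  simp only [mem_cfg, configs, Finset.mem_filter, Finset.mem_powerset, hnd, true_and,
    List.not_mem_nil, false_imp_iff, implies_true, and_true]
  have hfor : ∀ P : Half → Prop, (∀ h ∈ pointHalves b, P h) ↔ ∀ i, P (b i).half := by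
    intro P; simp [pointHalves]
  rw [hfor, hfor]
  refine and_congr_right fun hω => and_congr_right fun hV => ?_
  simp only [OPoint.edge_half]
  refine and_congr_right fun he => ?_
  have hsupp : (configMono (pointHalves b) ω).support = occupied b ω := by
    ext h
    rw [mem_support_configMono hnd ((hfor _).2 (by simpa only [OPoint.edge_half] using he))]
    simp [occupied, pointHalves, mem_halves, or_comm]
  rw [hsupp, deg_eq_hdeg hb he]
  have hpar : ∀ w, par w (occupied b ω) = (1 : Vtx → ℤˣ) w ↔ Even (hdeg (occupied b ω) w) :=
    fun w => par_eq_one_iff w _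
  simp only [hpar]
  refine ⟨fun h v _ => h v, fun h w => ?_⟩
  by_cases hw : w ∈ V
  · exact h w hw
  · have : hdeg (occupied b ω) w = 0 := by
      rw [hdeg, Finset.card_eq_zero, Finset.filter_eq_empty_iff]
      rintro k hk rfl
      simp only [occupied, Finset.mem_union, mem_halves, Finset.mem_image, Finset.mem_univ,
        true_and] at hk
      rcases hk with hk | ⟨i, rfl⟩
      · exact hw (edge_mem_edges.1 (hω hk)).1
      · exact hw (hV i)
    rw [this]; exact Even.zero

lemma mem_cfg_nil {V : Finset Vtx} {ω : Finset Edge} :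
    ω ∈ cfg V 1 [] ↔ ω ∈ configs V [] (Fin.elim0 : Fin 0 → OPoint) :=
  mem_cfg_pointHalves (b := (Fin.elim0 : Fin 0 → OPoint)) fun i => i.elim0

lemma partitionSpin_eq (V : Finset Vtx) (a : Face) : partitionSpin V a = corr V a [] := by
  have hc : configs V [] (Fin.elim0 : Fin 0 → OPoint) = cfg V 1 [] :=
    Finset.ext fun ω => mem_cfg_nil.symm
  rw [partitionSpin, corr, hc]
  refine Finset.sum_congr rfl fun ω hω => ?_
  rw [configMono_nil_sign hω, weight, coe_loops, Units.val_one, Int.cast_one, mul_one]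

lemma alpha_rpow (k N : ℕ) :
    alpha ^ ((k : ℝ) + (N : ℝ) / 2) = alpha ^ k * Real.sqrt alpha ^ N := by
  rw [Real.rpow_add alpha_pos, Real.rpow_natCast, Real.sqrt_eq_rpow,
    ← Real.rpow_natCast (alpha ^ (1 / 2 : ℝ)), ← Real.rpow_mul alpha_pos.le]
  congr 2; ring

/-- The indicator function of the configurations allowed by the signed edges in `s`. -/
def restriction (s : List (Edge × Bool)) (ω : Finset Edge) : ℝ :=
  if ∀ e ∈ s, (e.1 ∈ ω ↔ e.2 = false) then 1 else 0

@[simp] lemma restriction_nil (ω : Finset Edge) : restriction [] ω = 1 := by simp [restriction]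

lemma restriction_cons_true (e : Edge) (s : List (Edge × Bool)) (ω : Finset Edge) :
    restriction ((e, true) :: s) ω = (1 - if e ∈ ω then 1 else 0) * restriction s ω := by
  have hiff : (∀ e' ∈ (e, true) :: s, (e'.1 ∈ ω ↔ e'.2 = false)) ↔
      e ∉ ω ∧ ∀ e' ∈ s, (e'.1 ∈ ω ↔ e'.2 = false) := by simp
  unfold restriction
  by_cases h1 : e ∈ ω
  · rw [if_neg fun h => (hiff.1 h).1 h1, if_pos h1]; ring
  · by_cases h2 : ∀ e' ∈ s, (e'.1 ∈ ω ↔ e'.2 = false)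
    · rw [if_pos (hiff.2 ⟨h1, h2⟩), if_neg h1, if_pos h2]; ring
    · rw [if_neg fun h => h2 (hiff.1 h).2, if_neg h2]; ring

/-- The restricted spinors are correlation functions of half-edges, up to a factor for each point.
-/
lemma spinor_eq (V : Finset Vtx) (a : Face) (s : List (Edge × Bool)) {N : ℕ} {b : Fin N → OPoint}
    (hb : Function.Injective fun j => (b j).edge) :
    spinor V a s b = (((∏ i, (b i).theta a) * corrWith V a
      (restriction s) (pointHalves b) / corr V a [] : ℝ) : ℂ) := by
  rw [spinor, partitionSpin_eq, Complex.ofReal_div]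
  congr 1
  have hc : configs V s b = (cfg V 1 (pointHalves b)).filter
      fun ω => ∀ e ∈ s, (e.1 ∈ ω ↔ e.2 = false) := by
    ext ω
    rw [Finset.mem_filter, mem_cfg_pointHalves hb]
    simp only [configs, Finset.mem_filter, List.not_mem_nil, false_imp_iff, implies_true, and_true]
    tauto
  simp only [corrWith, restriction]
  rw [Finset.mul_sum, hc, Finset.sum_filter, Complex.ofReal_sum]
  refine Finset.sum_congr rfl fun ω hω => ?_
  split_ifs with h
  · have hω' := mem_cfg.1 hω
    have hω2 := (Finset.mem_filter.1 (mem_cfg_pointHalves hb |>.1 hω)).2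
    have hev : ∀ v, par v (occupied b ω) = 1 := by
      intro v
      have h1 := hω'.2.2.2.2 v
      have hsupp : (configMono (pointHalves b) ω).support = occupied b ω := by
        ext h
        rw [mem_support_configMono hω'.2.1 hω'.2.2.2.1]
        simp [occupied, pointHalves, mem_halves, or_comm]
      rwa [hsupp] at h1
    have hphase := phase_eq a hb hω2.2.1 hev
    have hsign : configSign (pointHalves b) ω = (configMono (pointHalves b) ω).sign := rfl
    rw [hphase, hsign, alpha_rpow, weight]
    have htheta : ∏ i, (b i).theta a =
        Real.sqrt alpha ^ N * (((∏ i, (b i).gauge a : ℤˣ) : ℤ) : ℝ) := by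
      simp only [OPoint.theta, Finset.prod_mul_distrib, Finset.prod_const, Finset.card_univ,
        Fintype.card_fin]
      push_cast; rfl
    rw [htheta]
    push_cast; ring
  · simp

lemma twoPoint_eq (V : Finset Vtx) (a : Face) {x y : OPoint} (h : x.edge ≠ y.edge) :
    twoPoint V a x y = (pairFun V a x y : ℂ) := by
  classical
  have hb : Function.Injective fun j => (![x, y] j).edge := by
    intro i j hij
    fin_cases i <;> fin_cases j <;> first | rfl | exact absurd hij h | exact absurd hij.symm h
  rw [twoPoint, spinor_eq V a [] hb, pairFun]
  have h1 : corrWith V a (restriction []) = corr V a := by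
    funext L; simp [corrWith, corr]
  simp [h1, pointHalves, Fin.prod_univ_two]

/-- The factor by which the fused edge `e` enters the sum over the configurations: the indicator
function of `e ∉ ω` minus `(1 + μ̃) / 2`. -/
def fuseFactor (a : Face) (e : Edge) (ω : Finset Edge) : ℝ :=
  (1 - muTilde a e) / 2 - if e ∈ ω then 1 else 0

lemma fused_eq_aux (V : Finset Vtx) (a : Face) {N : ℕ} {b : Fin N → OPoint}
    (hb : Function.Injective fun j => (b j).edge) (m : ℕ) :
    ∀ (e : Fin m → Edge) (s : List (Edge × Bool)), fused V a b m e s =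
      (((∏ i, (b i).theta a) * corrWith V a
      (fun ω => (∏ i, fuseFactor a (e i) ω) * restriction s ω) (pointHalves b) /
        corr V a [] : ℝ) : ℂ) := by
  induction m with
  | zero => intro e s; rw [fused, spinor_eq V a s hb]; simp
  | succ m ih =>
    intro e s
    rw [fused, ih, ih, ← Complex.ofReal_ofNat, ← Complex.ofReal_div, ← Complex.ofReal_mul,
      ← Complex.ofReal_sub]
    congr 1
    have hlin : corrWith V a (fun ω => (∏ i, fuseFactor a (e i) ω) * restriction s ω)
          (pointHalves b) =
        corrWith V a (fun ω => (∏ i, fuseFactor a (Fin.init e i) ω) *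
          restriction ((e (Fin.last m), true) :: s) ω) (pointHalves b) -
        (1 + muTilde a (e (Fin.last m))) / 2 *
        corrWith V a (fun ω => (∏ i, fuseFactor a (Fin.init e i) ω) * restriction s ω)
          (pointHalves b) := by
      rw [corrWith, corrWith, corrWith, Finset.mul_sum, ← Finset.sum_sub_distrib]
      refine Finset.sum_congr rfl fun ω _ => ?_
      rw [Fin.prod_univ_castSucc, restriction_cons_true]
      have hlast : fuseFactor a (e (Fin.last m)) ω = (1 - muTilde a (e (Fin.last m))) / 2 -
        if e (Fin.last m) ∈ ω then 1 else 0 := rfl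
      rw [hlast]
      simp only [Fin.init]
      ring
    rw [hlin]; ring

/-- The fused spinors are correlation functions with the factors `fuseFactor` inserted. -/
lemma fused_eq (V : Finset Vtx) (a : Face) {N : ℕ} {b : Fin N → OPoint}
    (hb : Function.Injective fun j => (b j).edge) (m : ℕ) (e : Fin m → Edge) :
    fused V a b m e [] = (((∏ i, (b i).theta a) * corrWith V a
      (fun ω => ∏ i, fuseFactor a (e i) ω) (pointHalves b) / corr V a [] : ℝ) : ℂ) := by
  rw [fused_eq_aux V a hb]; simp

/-! ### Correlation functions as Pfaffians -/

/-- Wick's theorem for half-edges. -/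
lemma pfL_corr (V : Finset Vtx) (a : Face) (L : List Half) : L.Nodup →
    pfL (fun h k => ((corr V a [h, k] / corr V a [] : ℝ) : ℂ)) L =
      ((corr V a L / corr V a [] : ℝ) : ℂ) := by
  have hZ := (corr_nil_pos V a).ne'
  induction L using list_induction_drop with
  | nil => intro _; simp [hZ]
  | cons x L ih =>
    intro hn
    have hL := (List.nodup_cons.1 hn).2
    have hsub : ∀ B y C, L = B ++ y :: C → (B ++ C).Nodup := by
      intro B y C e
      refine List.Sublist.nodup ?_ hL
      rw [e]; simp
    rw [pfL_cons, altSum_congr fun B y C e => by rw [ih B y C e (hsub B y C e)]]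
    by_cases hV : ∀ h ∈ L, h.1 ∈ V
    · have hw := corr_wick (a := a) hL hV x
      have hcast : ∀ (g : Half → List Half → List Half → ℝ) (L : List Half),
          altSum (fun y B C => ((g y B C : ℝ) : ℂ)) L = ((altSum g L : ℝ) : ℂ) := by
        intro g L
        induction L generalizing g with
        | nil => simp [altSum]
        | cons x L ih => simp only [altSum]; rw [ih]; push_cast; rfl
      simp only [← Complex.ofReal_mul]
      rw [hcast fun y B C => corr V a [x, y] / corr V a [] * (corr V a (B ++ C) / corr V a [])]
      congr 1
      have : altSum (fun y B C => corr V a [x, y] / corr V a [] *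
          (corr V a (B ++ C) / corr V a [])) L = (corr V a [] * corr V a [])⁻¹ *
          altSum (fun y B C => corr V a [x, y] * corr V a (B ++ C)) L := by
        rw [← altSum_mul_left]
        refine altSum_congr fun B y C _ => ?_
        field_simp
      rw [this, ← hw]
      field_simp
    · push Not at hV
      obtain ⟨h, hh, hhV⟩ := hV
      rw [corr_of_notMem (List.mem_cons_of_mem _ hh) hhV, altSum_eq_zero]
      · simp
      · intro B y C e
        rw [e] at hh
        by_cases hy : y = h
        · subst hy
          rw [corr_of_notMem (L := [x, y]) (h := y) (by simp) hhV]; simp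
        · rw [corr_of_notMem (L := B ++ C) (h := h) _ hhV]
          · simp
          · simp only [List.mem_append, List.mem_cons] at hh ⊢
            rcases hh with hh | hh | hh
            · exact Or.inl hh
            · exact absurd hh.symm hy
            · exact Or.inr hh

lemma pfL_pairFun (V : Finset Vtx) (a : Face) {X : List OPoint} (hX : (X.map OPoint.half).Nodup) :
    pfL (fun x y => (pairFun V a x y : ℂ)) X =
      (((X.map (OPoint.theta a)).prod * corr V a (X.map OPoint.half) / corr V a [] : ℝ) : ℂ) := by
  have h1 : (fun x y => (pairFun V a x y : ℂ)) = fun x y => ((x.theta a : ℝ) : ℂ) *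
      ((y.theta a : ℝ) : ℂ) * ((corr V a [x.half, y.half] / corr V a [] : ℝ) : ℂ) := by
    funext x y; rw [pairFun, mul_div_assoc]; push_cast; rfl
  have h2 := pfL_map (fun h k => ((corr V a [h, k] / corr V a [] : ℝ) : ℂ)) OPoint.half X
  rw [pfL_corr V a _ hX] at h2
  have h3 := pfL_scale (fun x y : OPoint => ((corr V a [x.half, y.half] / corr V a [] : ℝ) : ℂ))
    (fun x => ((x.theta a : ℝ) : ℂ)) X
  rw [h1, h3, ← h2, mul_div_assoc, Complex.ofReal_mul]
  congr 1
  have := map_list_prod Complex.ofRealHom (X.map (OPoint.theta a))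
  rw [List.map_map] at this
  exact this.symm

/-! ### Fusion -/

lemma stepSign_add_two (d : Fin 4) : stepSign (d + 2) = -stepSign d := by revert d; decide

lemma OPoint.rootSign_flip (x : OPoint) : x.flip.rootSign = -(x.rootSign * stepSign x.dir) := by
  have h1 := x.flip.root_eq
  have h2 : x.flip.root = Complex.I * x.root := rfl
  have h3 : x.flip.dir = x.dir + 2 := rfl
  rw [h2, h3, stdRoot_add_two, x.root_eq] at h1
  have hz : Complex.I * stdRoot x.dir ≠ 0 := mul_ne_zero Complex.I_ne_zero (stdRoot_ne_zero _)
  have h4 : ((x.rootSign : ℤ) : ℂ) = -((x.flip.rootSign : ℤ) : ℂ) * ((stepSign x.dir : ℤ) : ℂ) := by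
    refine mul_right_cancel₀ hz ?_
    linear_combination h1
  have h5 : (x.rootSign : ℤ) = -(x.flip.rootSign : ℤ) * (stepSign x.dir : ℤ) := by
    exact_mod_cast h4
  have h6 : x.rootSign = -x.flip.rootSign * stepSign x.dir := Units.ext (by push_cast; exact h5)
  rw [h6]
  rcases Int.units_eq_one_or (stepSign x.dir) with h | h <;> simp [h]

lemma hcut_mul_hcut (a : Face) (v : Vtx) (d : Fin 4) :
    hcut a (v + dirVec d) (d + 2) * hcut a v d = cut a (edgeOf v d) := by
  obtain ⟨i, j⟩ := v
  have h : j + -1 = a.2 ↔ j = a.2 + 1 := by omega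
  fin_cases d <;> simp [hcut, cut, sgn, edgeOf, dirVec, h]

/-- The factors of the two orientations of a point combine to the weight of its edge. -/
lemma OPoint.theta_mul_theta_flip (a : Face) (x : OPoint) :
    x.theta a * x.flip.theta a = -hop a x.half := by
  have h1 : x.gauge a * x.flip.gauge a = stepSign x.dir * cut a x.edge := by
    have e1 : x.flip.head = x.tail := congrArg Prod.fst x.opp_half
    have e2 : x.flip.dir + 2 = x.dir := congrArg Prod.snd x.opp_half
    have e3 : x.flip.sheet = x.sheet := rfl
    have e4 : x.flip.dir = x.dir + 2 := rfl
    rw [OPoint.gauge, OPoint.gauge, e2, e1, e3, x.rootSign_flip, e4, stepSign_add_two,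
      OPoint.edge, ← hcut_mul_hcut, ← OPoint.head]
    generalize hcut a x.head (x.dir + 2) = u
    generalize hcut a x.tail x.dir = v
    generalize x.rootSign = r
    generalize x.sheet = s
    generalize stepSign x.dir = t
    revert u v r s t
    decide
  have h2 : hop a x.half = -(alpha * (((stepSign x.dir * cut a x.edge : ℤˣ) : ℤ) : ℝ)) := by
    have : x.half.2 = x.dir + 2 := rfl
    rw [hop, this, stepSign_add_two, OPoint.edge_half]
    push_cast; ring
  rw [h2, ← h1, neg_neg, OPoint.theta, OPoint.theta, mul_mul_mul_comm,
    Real.mul_self_sqrt alpha_pos.le]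
  push_cast; ring

open scoped Classical in
/-- The normalized two-point function, with `t x` added to the entry of each point `x` in `Q` and
the opposite orientation of `x`. -/
def fusionEntry (V : Finset Vtx) (a : Face) (t : OPoint → ℝ) (Q : List OPoint) (x y : OPoint) : ℂ :=
  (pairFun V a x y : ℂ) + if x ∈ Q ∧ y = x.flip then (t x : ℂ) else 0

/-- Fusion: perturbing the entries of the pairs of opposite orientations of the points in `Q`
inserts into the correlation function a factor for each of the edges. The two halves of an edge
glue to the edge, which gives the summand `-1[e ∈ ω]`; the perturbation gives the summand `t`. -/
theorem pfL_fusionEntry {V : Finset Vtx} {a : Face} (t : OPoint → ℝ) (Q : List OPoint) :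
    ∀ Y X : List OPoint, Even Y.length → (∀ x ∈ Q, x.head ∈ V) →
      ((Q ++ (Y ++ ((Q.map OPoint.flip).reverse ++ X))).map OPoint.half).Nodup →
      pfL (fusionEntry V a t Q) (Q ++ (Y ++ ((Q.map OPoint.flip).reverse ++ X))) =
        ((((Y ++ X).map (OPoint.theta a)).prod * corrWith V a
          (fun ω => (Q.map fun x => t x - if x.edge ∈ ω then 1 else 0).prod)
          ((Y ++ X).map OPoint.half) / corr V a [] : ℝ) : ℂ) := by
  classical
  induction Q using List.reverseRecOn with
  | nil =>
    intro Y X _ _ hn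
    have : fusionEntry V a t [] = fun x y => (pairFun V a x y : ℂ) := by
      funext x y; simp [fusionEntry]
    rw [this]
    simp only [List.nil_append, List.map_nil, List.reverse_nil, List.prod_nil] at hn ⊢
    rw [pfL_pairFun V a hn, corrWith_one]
  | append_singleton Q q ih =>
    intro Y X hY hQ hn
    simp only [List.map_append, List.map_cons, List.map_nil, List.reverse_append,
      List.reverse_cons, List.reverse_nil, List.nil_append, List.cons_append, List.append_assoc]
      at hn ⊢
    set R := (Q.map OPoint.flip).reverse ++ X with hR
    have hmap : (Q.map OPoint.half ++ q.half ::
        (Y.map OPoint.half ++ q.flip.half :: R.map OPoint.half)).Nodup := by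
      simpa [hR] using hn
    have hn' : (Q ++ q :: (Y ++ q.flip :: R)).Nodup := by
      refine List.Nodup.of_map OPoint.half ?_
      simpa using hmap
    have hmid := List.nodup_cons.1 (List.nodup_middle.1 hmap)
    have hqQ : q.half ∉ Q.map OPoint.half := fun h => hmid.1 (List.mem_append_left _ h)
    have hqY : q.half ∉ Y.map OPoint.half := fun h =>
      hmid.1 (List.mem_append_right _ (List.mem_append_left _ h))
    have hXR : ∀ h, h ∈ X.map OPoint.half → h ∈ R.map OPoint.half := by
      intro h hh
      rw [hR, List.map_append]
      exact List.mem_append_right _ hh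
    have hqX : q.half ∉ X.map OPoint.half := fun h =>
      hmid.1 (List.mem_append_right _ (List.mem_append_right _ (List.mem_cons_of_mem _ (hXR _ h))))
    have hmid2 : q.flip.half ∉ (Q.map OPoint.half ++ Y.map OPoint.half) ++ R.map OPoint.half ∧
        ((Q.map OPoint.half ++ Y.map OPoint.half) ++ R.map OPoint.half).Nodup := by
      have := hmid.2
      rw [← List.append_assoc] at this
      exact List.nodup_cons.1 (List.nodup_middle.1 this)
    have hfQ : q.flip.half ∉ Q.map OPoint.half := fun h =>
      hmid2.1 (List.mem_append_left _ (List.mem_append_left _ h))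
    have hfY : q.flip.half ∉ Y.map OPoint.half := fun h =>
      hmid2.1 (List.mem_append_left _ (List.mem_append_right _ h))
    have hfX : q.flip.half ∉ X.map OPoint.half := fun h =>
      hmid2.1 (List.mem_append_right _ (hXR _ h))
    have hne : ∀ x ∈ Q, x.edge ≠ q.edge := by
      intro x hx e
      rw [← OPoint.edge_half, ← OPoint.edge_half, edge_eq_iff] at e
      rcases e with e | e
      · exact hqQ (List.mem_map.2 ⟨x, hx, e⟩)
      · exact hfQ (List.mem_map.2 ⟨x, hx, e⟩)
    have hentry : fusionEntry V a t (Q ++ [q]) = fun x y => fusionEntry V a t Q x y +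
        if x = q ∧ y = q.flip then (t q : ℂ) else 0 := by
      funext x y
      unfold fusionEntry
      by_cases hxq : x = q
      · subst hxq
        have : x ∉ Q := fun h => hne x h rfl
        simp [this]
      · simp [hxq]
    have hQ' : ∀ x ∈ Q, x.head ∈ V := fun x hx => hQ x (by simp [hx])
    have ih1 := ih (q :: (Y ++ [q.flip])) X (by simpa using hY.add_one.add_one) hQ' (by simpa [hR] using hn)
    have ih2 := ih Y X hY hQ' (by simpa [hR] using hmid2.2)
    simp only [List.cons_append, List.append_assoc, List.nil_append] at ih1
    rw [← hR] at ih1 ih2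
    rw [hentry, pfL_add_entry _ _ _ _ _ hn', ih1, ih2, hY.neg_one_pow, one_mul,
      ← Complex.ofReal_mul, ← Complex.ofReal_add]
    congr 1
    set f : Finset Edge → ℝ := fun ω => (Q.map fun x => t x - if x.edge ∈ ω then 1 else 0).prod
      with hf
    have hfins : ∀ ω, f (insert q.half.edge ω) = f ω := by
      intro ω
      simp only [hf]
      congr 1
      refine List.map_congr_left fun x hx => ?_
      simp only [Finset.mem_insert, OPoint.edge_half, hne x hx, false_or]
    have hmove : corrWith V a f ((q :: (Y ++ q.flip :: X)).map OPoint.half) =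
        corrWith V a f (q.half :: opp q.half :: (Y ++ X).map OPoint.half) := by
      refine (corrWith_perm (s := 1)
        (L' := q.half :: opp q.half :: (Y ++ X).map OPoint.half) f ?_ ?_).trans (by simp)
      · simp only [List.map_cons, List.map_append]
        exact List.Perm.cons _ List.perm_middle
      · have hc := gen_mul_prod_gen hfY
        rw [List.length_map, hY.neg_one_pow, one_smul] at hc
        simp only [List.map_cons, List.map_append, List.prod_cons, List.prod_append, one_smul]
        rw [← OPoint.half_flip, ← mul_assoc (gen q.flip.half), hc, mul_assoc]
    have hedge := sum_mem_edge_mul (V := V) (a := a) (L := (Y ++ X).map OPoint.half) (y := q.half)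
      (hQ q (by simp)) (by rw [List.map_append]; exact fun h => (List.mem_append.1 h).elim hqY hqX)
      (by
        rw [← OPoint.half_flip, List.map_append]
        exact fun h => (List.mem_append.1 h).elim hfY hfX) hfins
    have hsplit : corrWith V a (fun ω => ((Q.map fun x => t x - if x.edge ∈ ω then 1 else 0) ++
        [t q - if q.edge ∈ ω then 1 else 0]).prod) ((Y ++ X).map OPoint.half) =
        t q * corrWith V a f ((Y ++ X).map OPoint.half) -
          hop a q.half * corrWith V a f (q.half :: opp q.half :: (Y ++ X).map OPoint.half) := by
      change _ = _ - hop a q.half * (∑ ω ∈ _, _)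
      rw [← hedge, corrWith, corrWith, Finset.sum_filter, Finset.mul_sum,
        ← Finset.sum_sub_distrib]
      refine Finset.sum_congr rfl fun ω _ => ?_
      simp only [List.prod_append, List.prod_singleton, OPoint.edge_half]
      split_ifs <;> simp only [hf] <;> ring
    rw [← List.map_append, ← List.map_append, hsplit, hmove]
    simp only [List.map_cons, List.map_append, List.prod_cons, List.prod_append]
    have hth := q.theta_mul_theta_flip a
    rw [← neg_eq_iff_eq_neg] at hth
    rw [← hth]
    ring

/-! ### s-holomorphicity -/

/-- The unit vector with argument `π / 8`. -/
def zeta : ℂ := Complex.exp (Complex.I * (Real.pi / 8))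

lemma zeta_sq : zeta ^ 2 = Complex.exp (Complex.I * (Real.pi / 4)) := by
  rw [zeta, ← Complex.exp_nat_mul]; congr 1; push_cast; ring

lemma zeta_eq : zeta = Real.cos (Real.pi / 8) + Real.sin (Real.pi / 8) * Complex.I := by
  rw [zeta, mul_comm, Complex.exp_mul_I]; push_cast; rfl

lemma sin_pi_div_eight_eq : Real.sin (Real.pi / 8) = alpha * Real.cos (Real.pi / 8) := by
  have h2 : Real.sqrt 2 ^ 2 = 2 := Real.sq_sqrt (by norm_num)
  have hs : 2 * Real.sin (Real.pi / 8) * Real.cos (Real.pi / 8) = Real.sqrt 2 / 2 := by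
    rw [← Real.sin_two_mul, ← Real.sin_pi_div_four]; congr 1; ring
  have hc : 2 * Real.cos (Real.pi / 8) ^ 2 - 1 = Real.sqrt 2 / 2 := by
    rw [← Real.cos_two_mul, ← Real.cos_pi_div_four]; congr 1; ring
  rw [alpha_eq]
  have h3 : 0 < Real.sqrt 2 := by positivity
  have key : (Real.sqrt 2 + 2) * (Real.sin (Real.pi / 8) -
      (Real.sqrt 2 - 1) * Real.cos (Real.pi / 8)) = 0 := by
    linear_combination 2 * Real.cos (Real.pi / 8) * hs - 2 * Real.sin (Real.pi / 8) * hc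
      - Real.cos (Real.pi / 8) * h2
  have := (mul_eq_zero.1 key).resolve_left (by positivity)
  linarith

lemma zeta_normSq : zeta * (starRingEnd ℂ) zeta = 1 := by
  rw [Complex.mul_conj, zeta, Complex.normSq_eq_norm_sq]
  have : Complex.I * (Real.pi / 8) = ((Real.pi / 8 : ℝ) : ℂ) * Complex.I := by push_cast; ring
  rw [this, Complex.norm_exp_ofReal_mul_I]; simp

lemma stdRoot_eq (d : Fin 4) : stdRoot d = zeta * (zeta ^ 2) ^ (d : ℕ) := by
  rw [stdRoot, zeta_sq, zeta]

lemma zeta_pow_four : zeta ^ 4 = Complex.I := by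
  rw [show zeta ^ 4 = (zeta ^ 2) ^ 2 by ring, zeta_sq, exp_pi_four_sq]

lemma stdRoot_add_one (d : Fin 4) :
    stdRoot (d + 1) = ((wrap d : ℤ) : ℂ) * zeta ^ 2 * stdRoot d := by
  have h : zeta ^ 8 = -1 := by
    rw [show zeta ^ 8 = (zeta ^ 4) ^ 2 by ring, zeta_pow_four, Complex.I_sq]
  simp only [stdRoot_eq]
  fin_cases d <;> simp [wrap] <;> first | ring1 | linear_combination zeta * h

lemma stdRoot_normSq (d : Fin 4) : stdRoot d * (starRingEnd ℂ) (stdRoot d) = 1 := by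
  rw [stdRoot_eq]
  simp only [map_mul, map_pow]
  calc _ = (zeta * (starRingEnd ℂ) zeta) * (zeta * (starRingEnd ℂ) zeta) ^ (2 * (d : ℕ)) := by ring
    _ = 1 := by rw [zeta_normSq]; simp

lemma orient_add_one (d : Fin 4) : orient (d + 1) = Complex.I * orient d := by
  have h3 : Complex.I ^ 3 = -Complex.I := Complex.I_pow_three
  fin_cases d <;> simp [orient, h3] <;> ring_nf <;> simp

/-- The corner between two consecutive edges. -/
lemma corner_eq (d : Fin 4) :
    (orient d + orient (d + 1)) / (Real.sqrt 2 : ℂ) = (zeta * stdRoot d) ^ 2 := by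
  rw [orient_add_one, mul_pow, stdRoot_sq]
  have h2 : ((Real.sqrt 2 : ℝ) : ℂ) ≠ 0 := by
    rw [Ne, Complex.ofReal_eq_zero]; positivity
  have hsq : ((Real.sqrt 2 : ℝ) : ℂ) ^ 2 = 2 := by
    rw [← Complex.ofReal_pow, Real.sq_sqrt (by norm_num)]; simp
  have hz : zeta ^ 2 = (1 + Complex.I) * ((Real.sqrt 2 : ℝ) : ℂ) / 2 := by
    rw [zeta_sq, mul_comm Complex.I, show ((Real.pi : ℂ) / 4) = ((Real.pi / 4 : ℝ) : ℂ) by push_cast; rfl,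
      Complex.exp_mul_I, ← Complex.ofReal_cos, ← Complex.ofReal_sin, Real.cos_pi_div_four,
      Real.sin_pi_div_four]
    push_cast; ring
  rw [hz]
  field_simp
  linear_combination -(orient d * (1 + Complex.I)) * hsq

lemma proj_sq {τ : ℂ} (hτ : τ * (starRingEnd ℂ) τ = 1) (w : ℂ) :
    proj (τ ^ 2) w = (starRingEnd ℂ) τ * ((τ * w).re : ℂ) := by
  have h := Complex.add_conj (τ * w)
  rw [map_mul] at h
  rw [proj, map_pow]
  have h2 : (((τ * w).re : ℝ) : ℂ) = (τ * w + (starRingEnd ℂ) τ * (starRingEnd ℂ) w) / 2 := by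
    rw [h]; push_cast; ring
  rw [h2]
  linear_combination (-w / 2) * hτ

/-- The relation between two real numbers at each of two consecutive edges that is equivalent to
the agreement of the projections at the corner between them. -/
lemma proj_corner (d : Fin 4) {c ξ c' ξ' : ℝ}
    (h : c - ξ = ((wrap d : ℤ) : ℝ) * (c' + ξ')) :
    proj ((zeta * stdRoot d) ^ 2) ((c + ((ξ / alpha : ℝ) : ℂ) * Complex.I) / stdRoot d) =
      proj ((zeta * stdRoot d) ^ 2)
        ((c' + ((ξ' / alpha : ℝ) : ℂ) * Complex.I) / stdRoot (d + 1)) := by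
  have hτ : zeta * stdRoot d * (starRingEnd ℂ) (zeta * stdRoot d) = 1 := by
    rw [map_mul, mul_mul_mul_comm, zeta_normSq, stdRoot_normSq, mul_one]
  have hz : zeta ≠ 0 := Complex.exp_ne_zero _
  have hα := alpha_pos.ne'
  rw [proj_sq hτ, proj_sq hτ]
  congr 2
  have e1 : zeta * stdRoot d * ((c + ((ξ / alpha : ℝ) : ℂ) * Complex.I) / stdRoot d) =
      zeta * (c + ((ξ / alpha : ℝ) : ℂ) * Complex.I) := by
    field_simp [stdRoot_ne_zero d]
  have hw : (((wrap d : ℤˣ) : ℤ) : ℂ) * ((wrap d : ℤˣ) : ℤ) = 1 := by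
    rw [← Int.cast_mul, ← Units.val_mul, Int.units_mul_self]; simp
  have e2 : zeta * stdRoot d * ((c' + ((ξ' / alpha : ℝ) : ℂ) * Complex.I) / stdRoot (d + 1)) =
      ((((wrap d : ℤˣ) : ℤ) : ℝ) : ℂ) *
        ((starRingEnd ℂ) zeta * (c' + ((ξ' / alpha : ℝ) : ℂ) * Complex.I)) := by
    have h1 : zeta * stdRoot d = ((((wrap d : ℤˣ) : ℤ) : ℝ) : ℂ) * (starRingEnd ℂ) zeta *
        stdRoot (d + 1) := by
      rw [stdRoot_add_one, Complex.ofReal_intCast]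
      linear_combination (-(zeta * stdRoot d)) * hw -
        (((wrap d : ℤˣ) : ℤ) : ℂ) * ((wrap d : ℤˣ) : ℤ) * (zeta * stdRoot d) * zeta_normSq
    rw [h1]
    field_simp [stdRoot_ne_zero (d + 1)]
  rw [e1, e2, Complex.re_ofReal_mul]
  have hre : ∀ C S u v : ℝ, (((C : ℂ) + S * Complex.I) * (u + v * Complex.I)).re =
      C * u - S * v := by
    intro C S u v; simp
  have hre' : ∀ C S u v : ℝ,
      ((starRingEnd ℂ) ((C : ℂ) + S * Complex.I) * (u + v * Complex.I)).re = C * u + S * v := by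
    intro C S u v; simp
  rw [zeta_eq, hre, hre', sin_pi_div_eight_eq]
  field_simp
  linear_combination Real.cos (Real.pi / 8) * h

lemma cornerDir_three (p : OPoint) : cornerDir p 3 = (zeta * stdRoot (p.dir + 2)) ^ 2 := by
  rw [cornerDir, ← corner_eq]
  congr 3
  rw [add_assoc]; rfl

lemma cornerDir_one (p : OPoint) : cornerDir p 1 = (zeta * stdRoot (p.dir + 1)) ^ 2 := by
  rw [cornerDir, ← corner_eq, add_comm (orient _)]
  congr 3
  rw [add_assoc]; rfl

lemma cornerDir_three_eq (p : OPoint) : cornerDir p 3 = Complex.I * cornerDir p 1 := by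
  rw [cornerDir_three, cornerDir_one, mul_pow, mul_pow, stdRoot_sq, stdRoot_sq,
    show p.dir + 2 = p.dir + 1 + 1 by rw [add_assoc]; rfl, orient_add_one]
  ring

lemma cornerDir_one_normSq (p : OPoint) :
    cornerDir p 1 * (starRingEnd ℂ) (cornerDir p 1) = 1 := by
  rw [cornerDir_one, map_pow, map_mul, ← mul_pow, mul_mul_mul_comm, zeta_normSq, stdRoot_normSq]
  norm_num

/-- The value at `p` determined by the values at its two neighbours in front. -/
def frontFormula (a : Face) (G : OPoint → ℂ) (p : OPoint) : ℂ :=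
  (cornerDir p 1 * G (nextTo a p 1) + (starRingEnd ℂ) (G (nextTo a p 1)) -
    cornerDir p 3 * G (nextTo a p 3) - (starRingEnd ℂ) (G (nextTo a p 3))) /
      (cornerDir p 1 - cornerDir p 3)

/-- The lines of the two corners in front of `p` are different, so the front value is unique. -/
lemma IsFrontValue.eq_frontFormula {a : Face} {G : OPoint → ℂ} {p : OPoint} {h : ℂ}
    (hh : IsFrontValue a G p h) : h = frontFormula a G p := by
  have h1 := hh 1 (Or.inl rfl)
  have h3 := hh 3 (Or.inr rfl)
  have hn := cornerDir_one_normSq p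
  rw [frontFormula]
  rw [cornerDir_three_eq] at h3 ⊢
  rw [proj, proj] at h1 h3
  rw [map_mul, Complex.conj_I] at h3
  generalize cornerDir p 1 = κ at *
  generalize G (nextTo a p 1) = w at *
  generalize G (nextTo a p 3) = w' at *
  have hκ : κ ≠ 0 := left_ne_zero_of_mul_eq_one hn
  have hd : κ - Complex.I * κ ≠ 0 := by
    have : (1 : ℂ) - Complex.I ≠ 0 := by
      intro h; have := congrArg Complex.re h; simp at this
    have h' := mul_ne_zero this hκ
    rwa [sub_mul, one_mul] at h'
  rw [eq_div_iff hd]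
  have hI := Complex.I_sq
  linear_combination 2 * κ * h1 - 2 * Complex.I * κ * h3 -
    ((starRingEnd ℂ) h - (starRingEnd ℂ) w) * hn +
    (-(Complex.I ^ 2)) * ((starRingEnd ℂ) h - (starRingEnd ℂ) w') * hn -
    ((starRingEnd ℂ) h - (starRingEnd ℂ) w') * hI

lemma IsFrontValue.frontValue_eq {a : Face} {G : OPoint → ℂ} {p : OPoint} {h : ℂ}
    (hh : IsFrontValue a G p h) : frontValue a G p = h := by
  have : IsFrontValue a G p (frontValue a G p) := Classical.epsilon_spec ⟨h, hh⟩
  rw [this.eq_frontFormula, ← hh.eq_frontFormula]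

lemma proj_sub (κ w w' : ℂ) : proj κ (w - w') = proj κ w - proj κ w' := by
  simp only [proj, map_sub]; ring

lemma IsFrontValue.sub {a : Face} {G G' : OPoint → ℂ} {p : OPoint} {h h' : ℂ}
    (hh : IsFrontValue a G p h) (hh' : IsFrontValue a G' p h') :
    IsFrontValue a (fun z => G z - G' z) p (h - h') := by
  intro t ht
  simp only [proj_sub, hh t ht, hh' t ht]

/-- A limit of functions that are s-holomorphic at the two corners in front of `p`. -/
lemma IsFrontValue.tendsto {ι : Type*} {l : Filter ι} [l.NeBot] {a : Face} {G : ι → OPoint → ℂ}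
    {G' : OPoint → ℂ} {p : OPoint} {h : ι → ℂ} (hh : ∀ᶠ n in l, IsFrontValue a (G n) p (h n))
    (hG : ∀ t : Fin 4, t = 1 ∨ t = 3 →
      Filter.Tendsto (fun n => G n (nextTo a p t)) l (nhds (G' (nextTo a p t)))) :
    Filter.Tendsto h l (nhds (frontValue a G' p)) ∧ IsFrontValue a G' p (frontValue a G' p) := by
  have h1 := hG 1 (Or.inl rfl)
  have h3 := hG 3 (Or.inr rfl)
  have hconj : Continuous (starRingEnd ℂ) := Complex.continuous_conj
  have hlim : Filter.Tendsto h l (nhds (frontFormula a G' p)) := by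
    have : Filter.Tendsto (fun n => frontFormula a (G n) p) l (nhds (frontFormula a G' p)) := by
      unfold frontFormula
      refine Filter.Tendsto.div_const ?_ _
      exact (((h1.const_mul _).add ((hconj.tendsto _).comp h1)).sub (h3.const_mul _)).sub
        ((hconj.tendsto _).comp h3)
    refine this.congr' ?_
    filter_upwards [hh] with n hn
    exact hn.eq_frontFormula.symm
  have hproj : ∀ κ, Continuous (proj κ) := by
    intro κ; unfold proj
    exact (continuous_id.add (continuous_const.mul hconj)).div_const _
  have hfront : IsFrontValue a G' p (frontFormula a G' p) := by
    intro t ht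
    refine tendsto_nhds_unique_of_eventuallyEq
      (((hproj (cornerDir p t)).tendsto _).comp hlim)
      (((hproj (cornerDir p t)).tendsto _).comp (hG t ht)) ?_
    filter_upwards [hh] with n hn
    exact hn t ht
  rw [hfront.frontValue_eq]
  exact ⟨hlim, hfront⟩

/-! ### The two-point spinors on the diagonal -/

lemma corr_swap (V : Finset Vtx) (a : Face) (h k : Half) :
    corr V a [h, k] = -corr V a [k, h] := by
  by_cases e : h = k
  · subst e; rw [corr_of_not_nodup (by simp)]; simp
  · rw [corr_perm (s := -1) (List.Perm.swap k h [])]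
    · simp
    · simp [gen_mul_gen e]

/-- The normalized correlation function of the two halves of an edge, with the sign and the weight
that make it minus the frequency of the edge in the signed sum over the configurations. -/
def energy (V : Finset Vtx) (a : Face) (y : Half) : ℝ :=
  -hop a y * corr V a [y, opp y] / corr V a []

lemma hop_opp (a : Face) (y : Half) : hop a (opp y) = -hop a y := by
  have : (opp y).2 = y.2 + 2 := rfl
  rw [hop, hop, edge_opp, this, stepSign_add_two]
  push_cast; ring

lemma energy_opp (V : Finset Vtx) (a : Face) (y : Half) : energy V a (opp y) = energy V a y := by
  rw [energy, energy, opp_opp, hop_opp, corr_swap]; ring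

lemma energy_congr (V : Finset Vtx) (a : Face) {x y : OPoint} (h : x.edge = y.edge) :
    energy V a x.half = energy V a y.half := by
  rw [← OPoint.edge_half, ← OPoint.edge_half, edge_eq_iff] at h
  rcases h with h | h
  · rw [h]
  · rw [h, energy_opp]

lemma pairFun_flip (V : Finset Vtx) (a : Face) (x : OPoint) :
    pairFun V a x x.flip = energy V a x.half := by
  rw [pairFun, OPoint.theta_mul_theta_flip, OPoint.half_flip]; rfl

lemma units_cast_mul_self (u : ℤˣ) : ((u : ℤ) : ℝ) * ((u : ℤ) : ℝ) = 1 := by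
  rw [← Int.cast_mul, ← Units.val_mul, Int.units_mul_self]; simp

lemma OPoint.gauge_flip (a : Face) {z : OPoint} (hz : z.root = stdRoot z.dir) :
    z.flip.gauge a = z.sheet * hcut a z.tail z.dir := by
  have h0 : z.rootSign = 1 := if_pos hz
  have e1 : z.flip.head = z.tail := congrArg Prod.fst z.opp_half
  have e2 : z.flip.dir + 2 = z.dir := congrArg Prod.snd z.opp_half
  have e3 : z.flip.sheet = z.sheet := rfl
  have e4 : z.flip.dir = z.dir + 2 := rfl
  rw [OPoint.gauge, e2, e1, e3, z.rootSign_flip, e4, stepSign_add_two, h0]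
  generalize hcut a z.tail z.dir = v
  generalize z.sheet = s
  generalize stepSign z.dir = t
  revert v s t
  decide

/-- The factor common to the values of the two-point observable around a vertex. -/
def obsFactor (V : Finset Vtx) (a : Face) (x : OPoint) (σ : ℤˣ) : ℝ :=
  -(x.theta a * Real.sqrt alpha * ((σ : ℤ) : ℝ)) / corr V a []

lemma complexObs_eq (V : Finset Vtx) (a : Face) {x z : OPoint} (hz : z.root = stdRoot z.dir)
    (h : x.edge ≠ z.edge) :
    complexObs (twoPoint V a) x z =
      (obsFactor V a x (z.sheet * hcut a z.tail z.dir) : ℂ) *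
        ((corr V a [(z.tail, z.dir), x.half] +
          ((hop a (z.tail, z.dir) * corr V a [opp (z.tail, z.dir), x.half] / alpha : ℝ) : ℂ) *
            Complex.I) / stdRoot z.dir) := by
  have h' : x.edge ≠ z.flip.edge := by rwa [OPoint.edge_flip]
  set σ := z.sheet * hcut a z.tail z.dir with hσ
  have hs : 0 < Real.sqrt alpha := Real.sqrt_pos.2 alpha_pos
  have hss : Real.sqrt alpha * Real.sqrt alpha = alpha := Real.mul_self_sqrt alpha_pos.le
  have hu := units_cast_mul_self σ
  have hfl : z.flip.theta a = Real.sqrt alpha * ((σ : ℤ) : ℝ) := by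
    rw [OPoint.theta, OPoint.gauge_flip a hz]
  have hop1 : opp z.half = (z.tail, z.dir) := z.opp_half
  have hop2 : z.half = opp (z.tail, z.dir) := by rw [← hop1, opp_opp]
  have hth : z.theta a * (Real.sqrt alpha * ((σ : ℤ) : ℝ)) = hop a (z.tail, z.dir) := by
    rw [← hfl, OPoint.theta_mul_theta_flip, ← hop1, hop_opp]
  have hz1 : z.theta a = hop a (z.tail, z.dir) * ((σ : ℤ) : ℝ) * Real.sqrt alpha / alpha := by
    rw [← hth, eq_div_iff alpha_pos.ne']
    linear_combination (-(z.theta a * ((σ : ℤ) : ℝ) * ((σ : ℤ) : ℝ))) * hss - z.theta a * alpha * hu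
  have hr : z.flip.root = Complex.I * stdRoot z.dir := by rw [← hz]; rfl
  rw [complexObs, twoPoint_eq V a h, twoPoint_eq V a h', hr, hz, pairFun, pairFun, hfl,
    OPoint.half_flip, hop1, hop2, corr_swap V a x.half, corr_swap V a x.half, hz1, obsFactor]
  have hI := Complex.I_ne_zero
  have hsr := stdRoot_ne_zero z.dir
  have hα : ((alpha : ℝ) : ℂ) ≠ 0 := Complex.ofReal_ne_zero.2 alpha_pos.ne'
  have hZ : ((corr V a [] : ℝ) : ℂ) ≠ 0 := Complex.ofReal_ne_zero.2 (corr_nil_pos V a).ne'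
  push_cast
  field_simp
  ring

lemma proj_ofReal_mul (κ : ℂ) (r : ℝ) (w : ℂ) : proj κ (r * w) = r * proj κ w := by
  simp only [proj, map_mul, Complex.conj_ofReal]; ring

lemma sheet_nextTo (a : Face) (p : OPoint) (t : Fin 4) :
    (nextTo a p t).sheet * hcut a (nextTo a p t).tail (nextTo a p t).dir =
      p.sheet * hcut a p.head (p.dir + 2) := by
  change p.sheet * (if halfCut a p.head (p.dir + 2) = halfCut a p.head (p.dir + t) then 1 else -1) *
    hcut a p.head (p.dir + t) = _
  rw [← coe_hcut, ← coe_hcut]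
  generalize hcut a p.head (p.dir + 2) = u
  generalize hcut a p.head (p.dir + t) = v
  generalize p.sheet = s
  revert u v s
  decide

lemma edge_nextTo_ne (a : Face) (p : OPoint) {t : Fin 4} (ht : t = 1 ∨ t = 3) :
    p.edge ≠ (nextTo a p t).edge := by
  have h1 : (nextTo a p t).edge = Half.edge (p.head, p.dir + t) := rfl
  rw [h1, ← OPoint.edge_half, Ne, edge_eq_iff]
  rintro (h | h)
  · have h2 : p.dir + 2 = p.dir + t := congrArg Prod.snd h
    have h3 := add_left_cancel h2
    rcases ht with rfl | rfl <;> exact absurd h3 (by decide)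
  · exact vertex_opp_ne _ (congrArg Prod.fst h).symm

/-- The two-point observable is s-holomorphic at the corners in front of a point on the diagonal,
when its value there is as follows. -/
lemma isFrontValue_twoPoint {V : Finset Vtx} {a : Face} {x p : OPoint} (hp : p.head ∈ V)
    (hx : x.head ∈ V) (h : x.edge = p.edge) :
    IsFrontValue a (complexObs (twoPoint V a) x) p
      ((obsFactor V a x (p.sheet * hcut a p.head (p.dir + 2)) : ℂ) *
        ((corr V a [p.half, x.half] +
          (((hop a p.half * corr V a [opp p.half, x.half] +
            if x.half = p.half then corr V a [] else 0) / alpha : ℝ) : ℂ) *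
            Complex.I) / stdRoot (p.dir + 2))) := by
  intro t ht
  have hne : x.edge ≠ (nextTo a p t).edge := h ▸ edge_nextTo_ne a p ht
  have hroot : (nextTo a p t).root = stdRoot (nextTo a p t).dir := rfl
  rw [complexObs_eq V a hroot hne, sheet_nextTo, proj_ofReal_mul, proj_ofReal_mul]
  congr 1
  have hcon : ∀ y : Half, contract V a [x.half] y = if x.half = y then corr V a [] else 0 := by
    intro y; simp [contract, altSum]
  have htail : ((nextTo a p t).tail, (nextTo a p t).dir) = ((p.head, p.dir + t) : Half) := rfl
  have hdir : (nextTo a p t).dir = p.dir + t := rfl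
  rw [htail, hdir]
  have hnot : x.half ≠ (p.head, p.dir + t) := by
    intro e
    apply hne
    rw [← OPoint.edge_half, e]; rfl
  rcases ht with rfl | rfl
  · rw [cornerDir_one]
    have hd : p.dir + 2 = p.dir + 1 + 1 := by rw [add_assoc]; rfl
    have hrel := corner_relation (V := V) (a := a) (L := [x.half]) hp (p.dir + 1) (by simp)
      (by rintro h hh; rw [List.mem_singleton.1 hh]; exact hx)
    rw [← hd, hcon, hcon, if_neg hnot, add_zero] at hrel
    have := proj_corner (p.dir + 1) hrel
    rw [← hd] at this
    exact this.symm
  · rw [cornerDir_three]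
    have hd : p.dir + 3 = p.dir + 2 + 1 := by rw [add_assoc]; rfl
    rw [hd] at hnot ⊢
    have hrel := corner_relation (V := V) (a := a) (L := [x.half]) hp (p.dir + 2) (by simp)
      (by rintro h hh; rw [List.mem_singleton.1 hh]; exact hx)
    rw [hcon, hcon, if_neg hnot, add_zero] at hrel
    exact proj_corner (p.dir + 2) hrel

lemma energy_mul (V : Finset Vtx) (a : Face) (y : Half) :
    hop a y * corr V a [opp y, y] = corr V a [] * energy V a y := by
  have hZ := (corr_nil_pos V a).ne'
  rw [energy, corr_swap V a y]
  field_simp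

/-- The front value of the two-point observable at its pole; the summand `1` is the residue. -/
lemma isFrontValue_self {V : Finset Vtx} {a : Face} {x : OPoint} (hx : x.head ∈ V) :
    IsFrontValue a (complexObs (twoPoint V a) x) x ((1 + (energy V a x.half : ℂ)) / x.root) := by
  have h := isFrontValue_twoPoint (a := a) hx hx rfl
  convert h using 1
  set σ := x.sheet * hcut a x.head (x.dir + 2) with hσ
  have hg : x.gauge a = stepSign x.dir * x.rootSign * σ := by
    rw [hσ, OPoint.gauge, mul_assoc _ x.sheet]
  have hZ : ((corr V a [] : ℝ) : ℂ) ≠ 0 := Complex.ofReal_ne_zero.2 (corr_nil_pos V a).ne'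
  have hα : ((alpha : ℝ) : ℂ) ≠ 0 := Complex.ofReal_ne_zero.2 alpha_pos.ne'
  have hF : obsFactor V a x σ = -(alpha * ((stepSign x.dir : ℤ) : ℝ) * ((x.rootSign : ℤ) : ℝ)) /
      corr V a [] := by
    have hss : Real.sqrt alpha * Real.sqrt alpha = alpha := Real.mul_self_sqrt alpha_pos.le
    have hu := units_cast_mul_self σ
    rw [obsFactor, OPoint.theta, hg]
    congr 1
    push_cast
    linear_combination (-((stepSign x.dir : ℤ) : ℝ) * ((x.rootSign : ℤ) : ℝ) *
      ((σ : ℤ) : ℝ) * ((σ : ℤ) : ℝ)) * hss -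
      (alpha * ((stepSign x.dir : ℤ) : ℝ) * ((x.rootSign : ℤ) : ℝ)) * hu
  rw [corr_of_not_nodup (L := [x.half, x.half]) (by simp), energy_mul, if_pos rfl, hF,
    stdRoot_add_two, x.root_eq]
  have hsr := stdRoot_ne_zero x.dir
  have hI := Complex.I_ne_zero
  rcases Int.units_eq_one_or (stepSign x.dir) with h1 | h1 <;>
    rcases Int.units_eq_one_or x.rootSign with h2 | h2 <;> rw [h1, h2] <;> push_cast <;>
    field_simp <;> ring

/-- The rear value of the two-point observable at its pole. -/
lemma isFrontValue_flip {V : Finset Vtx} {a : Face} {x : OPoint} (hx : x.head ∈ V)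
    (hx' : x.tail ∈ V) :
    IsFrontValue a (complexObs (twoPoint V a) x) x.flip ((energy V a x.half : ℂ) / x.root) := by
  have e1 : x.flip.head = x.tail := congrArg Prod.fst x.opp_half
  have e2 : x.flip.dir + 2 = x.dir := congrArg Prod.snd x.opp_half
  have h := isFrontValue_twoPoint (a := a) (p := x.flip) (e1 ▸ hx') hx (OPoint.edge_flip x).symm
  convert h using 1
  rw [e1, e2]
  set σ := x.flip.sheet * hcut a x.tail x.dir with hσ
  have hg : x.flip.gauge a = x.rootSign * σ := by
    have e4 : x.flip.dir = x.dir + 2 := rfl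
    rw [hσ, OPoint.gauge, e1, e2, x.rootSign_flip, e4, stepSign_add_two]
    generalize hcut a x.tail x.dir = v
    generalize x.flip.sheet = s
    generalize stepSign x.dir = t
    generalize x.rootSign = r
    revert v s t r
    decide
  have hZ0 := (corr_nil_pos V a).ne'
  have hZ : ((corr V a [] : ℝ) : ℂ) ≠ 0 := Complex.ofReal_ne_zero.2 hZ0
  have hc : obsFactor V a x σ * corr V a [opp x.half, x.half] =
      ((x.rootSign : ℤ) : ℝ) * energy V a x.half := by
    have hss : Real.sqrt alpha * Real.sqrt alpha = alpha := Real.mul_self_sqrt alpha_pos.le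
    have hth := x.theta_mul_theta_flip a
    rw [OPoint.theta, OPoint.theta, hg] at hth
    have hr := units_cast_mul_self x.rootSign
    rw [energy, corr_swap V a x.half, obsFactor, OPoint.theta, ← hth]
    push_cast at hth ⊢
    field_simp
    linear_combination (Real.sqrt alpha ^ 2 * corr V a [opp x.half, x.half]) * hr
  have hc' := congrArg (fun r : ℝ => (r : ℂ)) hc
  simp only [Complex.ofReal_mul] at hc'
  rw [OPoint.half_flip, opp_opp, corr_of_not_nodup (L := [x.half, x.half]) (by simp),
    if_neg (opp_ne x.half).symm, mul_zero, add_zero, zero_div, Complex.ofReal_zero, zero_mul,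
    add_zero, mul_div_assoc', hc', x.root_eq]
  have hsr := stdRoot_ne_zero x.dir
  rcases Int.units_eq_one_or x.rootSign with h2 | h2 <;> rw [h2] <;> push_cast <;> field_simp

/-! ### The full-plane spinor and the renormalized two-point functions -/

lemma mem_box {a : Face} {n : ℕ} {v : Vtx} :
    v ∈ box a n ↔ (a.1 - n ≤ v.1 ∧ v.1 ≤ a.1 + 1 + n) ∧ a.2 - n ≤ v.2 ∧ v.2 ≤ a.2 + 1 + n := by
  simp [box]

lemma edge_mem_box {a : Face} {n : ℕ} {e : Edge}
    (h : (e.1.1 - a.1).natAbs + (e.1.2 - a.2).natAbs + 1 ≤ n) : e ∈ edges (box a n) := by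
  simp only [edges, Finset.mem_filter, Finset.mem_product, Finset.mem_univ, and_true, mem_box]
  have : (Edge.snd' e).1 = e.1.1 + (if e.2 then 0 else 1) ∧
      (Edge.snd' e).2 = e.1.2 + (if e.2 then 1 else 0) := by
    unfold Edge.snd'; split_ifs <;> simp
  rw [this.1, this.2]
  split_ifs <;> omega

/-- Near each edge the function `fullPlane` is a limit, along a filter, of the two-point spinors of
squares that contain the edge. This covers the infinite-volume limit itself and also the default
value in its definition, so that the existence of that limit is not needed. -/
lemma exists_filter (a : Face) (e : Edge) : ∃ l : Filter ℕ, l.NeBot ∧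
    (∀ᶠ n in l, e ∈ edges (box a n)) ∧ ∀ x y : OPoint, x.edge = e → x.edge ≠ y.edge →
      Filter.Tendsto (fun n => twoPoint (box a n) a x y) l (nhds (fullPlane a x y)) := by
  classical
  by_cases h : ∃ L, IsFullPlaneLimit a L
  · refine ⟨Filter.atTop, inferInstance, ?_, ?_⟩
    · filter_upwards [Filter.eventually_ge_atTop ((e.1.1 - a.1).natAbs + (e.1.2 - a.2).natAbs + 1)]
        with n hn using edge_mem_box hn
    · intro x y _ hxy
      have : fullPlane a = h.choose := by rw [fullPlane, dif_pos h]
      rw [this]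
      exact h.choose_spec x y hxy
  · refine ⟨pure ((e.1.1 - a.1).natAbs + (e.1.2 - a.2).natAbs + 1), inferInstance, ?_, ?_⟩
    · exact Filter.eventually_pure.2 (edge_mem_box le_rfl)
    · intro x y hx _
      rw [fullPlane, dif_neg h]
      subst hx
      exact tendsto_pure_nhds (fun n => twoPoint (box a n) a x y) _

lemma OPoint.edge_mem_edges {V : Finset Vtx} {x : OPoint} :
    x.edge ∈ edges V ↔ x.head ∈ V ∧ x.tail ∈ V := by
  rw [← OPoint.edge_half, IsingSpinor.edge_mem_edges, OPoint.opp_half]; rfl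

lemma OPoint.root_ne_zero (x : OPoint) : x.root ≠ 0 := by
  rw [x.root_eq]
  rcases Int.units_eq_one_or x.rootSign with h | h <;> simp [h, stdRoot_ne_zero]

/-- The full-plane observable has the front and rear values `(1 + L) / √o` and `L / √o`, where `L`
is the same for all doubly oriented points over the edge. -/
lemma exists_fullPlane_values (a : Face) (e : Edge) : ∃ L : ℝ, ∀ x : OPoint, x.edge = e →
    IsFrontValue a (complexObs (fullPlane a) x) x ((1 + (L : ℂ)) / x.root) ∧
    IsFrontValue a (complexObs (fullPlane a) x) x.flip ((L : ℂ) / x.root) := by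
  obtain ⟨l, hl, hmem, hlim⟩ := exists_filter a e
  have hobs : ∀ x : OPoint, x.edge = e → ∀ z : OPoint, x.edge ≠ z.edge →
      Filter.Tendsto (fun n => complexObs (twoPoint (box a n) a) x z) l
        (nhds (complexObs (fullPlane a) x z)) := by
    intro x hx z hz
    unfold complexObs
    exact ((hlim x z hx hz).const_mul _).add
      ((hlim x z.flip hx (by rwa [OPoint.edge_flip])).const_mul _)
  have hself : ∀ x : OPoint, x.edge = e → Filter.Tendsto
      (fun n => (1 + (energy (box a n) a x.half : ℂ)) / x.root) l
        (nhds (frontValue a (complexObs (fullPlane a) x) x)) ∧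
      IsFrontValue a (complexObs (fullPlane a) x) x
        (frontValue a (complexObs (fullPlane a) x) x) := by
    intro x hx
    refine IsFrontValue.tendsto (G := fun n => complexObs (twoPoint (box a n) a) x) ?_
      fun t ht => hobs x hx _ (edge_nextTo_ne a x ht)
    filter_upwards [hmem] with n hn
    rw [← hx, OPoint.edge_mem_edges] at hn
    exact isFrontValue_self hn.1
  have hflip : ∀ x : OPoint, x.edge = e → Filter.Tendsto
      (fun n => (energy (box a n) a x.half : ℂ) / x.root) l
        (nhds (frontValue a (complexObs (fullPlane a) x) x.flip)) ∧
      IsFrontValue a (complexObs (fullPlane a) x) x.flip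
        (frontValue a (complexObs (fullPlane a) x) x.flip) := by
    intro x hx
    refine IsFrontValue.tendsto (G := fun n => complexObs (twoPoint (box a n) a) x) ?_
      fun t ht => hobs x hx _ (by
        have := edge_nextTo_ne a x.flip ht; rwa [OPoint.edge_flip] at this)
    filter_upwards [hmem] with n hn
    rw [← hx, OPoint.edge_mem_edges] at hn
    exact isFrontValue_flip hn.1 hn.2
  set x₀ := OPoint.std e.1 (if e.2 then 1 else 0) 1 with hx₀
  have hx₀e : x₀.edge = e := by
    obtain ⟨v, b⟩ := e
    cases b <;> rfl
  set c := frontValue a (complexObs (fullPlane a) x₀) x₀.flip * x₀.root with hc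
  have hlimc : Filter.Tendsto (fun n => (energy (box a n) a x₀.half : ℂ)) l (nhds c) := by
    have := ((hflip x₀ hx₀e).1).mul_const x₀.root
    simpa only [div_mul_cancel₀ _ x₀.root_ne_zero] using this
  have hcre : c = ((c.re : ℝ) : ℂ) := by
    refine tendsto_nhds_unique hlimc ?_
    have := (Complex.continuous_ofReal.tendsto _).comp ((Complex.continuous_re.tendsto _).comp hlimc)
    simpa [Function.comp_def] using this
  rw [hcre] at hlimc
  refine ⟨c.re, fun x hx => ?_⟩
  have hen : ∀ n, energy (box a n) a x.half = energy (box a n) a x₀.half := fun n =>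
    energy_congr _ _ (hx.trans hx₀e.symm)
  have h1 := hself x hx
  have h2 := hflip x hx
  simp only [hen] at h1 h2
  have l1 := tendsto_nhds_unique h1.1 ((hlimc.const_add 1).div_const x.root)
  have l2 := tendsto_nhds_unique h2.1 (hlimc.div_const x.root)
  rw [← l1, ← l2]
  exact ⟨h1.2, h2.2⟩

/-- The relation between the renormalized two-point function at opposite orientations and the
normalized correlation function of the two halves of the edge. -/
theorem renormalized_flip {V : Finset Vtx} {a : Face} {x : OPoint} (hx : x.edge ∈ edges V) :
    renormalized V a x x.flip =
      ((pairFun V a x x.flip + (1 - muTilde a x.edge) / 2 : ℝ) : ℂ) := by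
  obtain ⟨L, hL⟩ := exists_fullPlane_values a x.edge
  have hroot := x.root_ne_zero
  rw [OPoint.edge_mem_edges] at hx
  have hmu : muTilde a x.edge = 1 + 2 * L := by
    set e := x.edge
    set x₀ := OPoint.std e.1 (if e.2 then 1 else 0) 1 with hx₀
    have hx₀e : x₀.edge = e := by
      rcases e with ⟨v, b⟩
      cases b <;> rfl
    have h0 := hL x₀ hx₀e
    have hr := x₀.root_ne_zero
    have hfl : x₀.flip.root = Complex.I * x₀.root := rfl
    rw [muTilde]
    rw [← hx₀, rearValue, h0.1.frontValue_eq, h0.2.frontValue_eq, hfl]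
    have : -Complex.I * (Complex.I * x₀.root) * ((1 + (L : ℂ)) / x₀.root + (L : ℂ) / x₀.root) =
        ((1 + 2 * L : ℝ) : ℂ) := by
      push_cast
      field_simp
      linear_combination (-(1 + 2 * (L : ℂ))) * Complex.I_sq
    rw [this, Complex.ofReal_re]
  have h1 := (isFrontValue_self (a := a) hx.1).sub (hL x rfl).1
  have h2 := (isFrontValue_flip (a := a) hx.1 hx.2).sub (hL x rfl).2
  set w : ℂ := ((energy V a x.half - L : ℝ) : ℂ) / x.root with hw
  have e1 : (1 + (energy V a x.half : ℂ)) / x.root - (1 + (L : ℂ)) / x.root = w := by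
    rw [hw]; push_cast; field_simp; ring
  have e2 : (energy V a x.half : ℂ) / x.root - (L : ℂ) / x.root = w := by
    rw [hw]; push_cast; field_simp
  rw [e1] at h1
  rw [e2] at h2
  have hext : extension a
      (fun z => complexObs (twoPoint V a) x z - complexObs (fullPlane a) x z) x = w := by
    have := Classical.epsilon_spec (p := fun h => IsFrontValue a
      (fun z => complexObs (twoPoint V a) x z - complexObs (fullPlane a) x z) x h ∧ IsFrontValue a
      (fun z => complexObs (twoPoint V a) x z - complexObs (fullPlane a) x z) x.flip h) ⟨w, h1, h2⟩
    exact this.1.eq_frontFormula.trans h1.eq_frontFormula.symm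
  have hs : ((x.sheet : ℤ) * (x.flip.sheet : ℤ) : ℤ) = 1 := by
    change ((x.sheet : ℤ) * (x.sheet : ℤ) : ℤ) = 1
    rw [← Units.val_mul, Int.units_mul_self]; rfl
  have hfl : x.flip.root = Complex.I * x.root := rfl
  rw [renormalized, hext, hs, hfl, pairFun_flip, hmu, hw]
  have : Complex.I * x.root / Complex.I * (((energy V a x.half - L : ℝ) : ℂ) / x.root) =
      ((energy V a x.half - L : ℝ) : ℂ) := by
    field_simp
  rw [this, Complex.ofReal_re]
  push_cast; ring

/-! ### The Pfaffian formula for the fused spinors -/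

lemma ofFn_fusedPoints {m n : ℕ} (q : Fin m → OPoint) (b : Fin (2 * n) → OPoint) :
    List.ofFn (fusedPoints q b) =
      List.ofFn q ++ ([] ++ (((List.ofFn q).map OPoint.flip).reverse ++ List.ofFn b)) := by
  have h1 : List.ofFn (fusedPoints q b) =
      List.ofFn (Fin.append (Fin.append q fun i => (q i.rev).flip) b) := by
    rw [List.ofFn_congr (show 2 * (m + n) = m + m + 2 * n by omega)]
    rfl
  have h2 : List.ofFn (fun i => (q (Fin.rev i)).flip) = ((List.ofFn q).map OPoint.flip).reverse := by
    refine List.ext_getElem (by simp) fun i h1 h2 => ?_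
    simp only [List.getElem_ofFn, List.getElem_reverse, List.getElem_map, List.length_map,
      List.length_ofFn]
    congr 2
    ext
    simp only [Fin.val_rev]
    omega
  rw [h1, List.ofFn_fin_append, List.ofFn_fin_append, h2, List.nil_append, List.append_assoc]

/-- The half-edges of the points of the theorem are distinct. -/
lemma nodup_fusedPoints {m n : ℕ} {q : Fin m → OPoint} {b : Fin (2 * n) → OPoint}
    (hq : Function.Injective fun i => (q i).edge) (hb : Function.Injective fun j => (b j).edge)
    (hqb : ∀ i j, (q i).edge ≠ (b j).edge) :
    ((List.ofFn q ++ ([] ++ (((List.ofFn q).map OPoint.flip).reverse ++ List.ofFn b))).map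
      OPoint.half).Nodup := by
  have hedge : ∀ x y : OPoint, x.half = y.half → x.edge = y.edge := by
    intro x y h; rw [← OPoint.edge_half, h, OPoint.edge_half]
  have hqh := half_injective hq
  have hbh := half_injective hb
  simp only [List.nil_append, List.map_append, List.map_reverse, List.map_ofFn]
  rw [List.nodup_append', List.nodup_append']
  refine ⟨List.nodup_ofFn.2 hqh, ⟨List.nodup_reverse.2 (List.nodup_ofFn.2 ?_),
    List.nodup_ofFn.2 hbh, ?_⟩, ?_⟩
  · intro i j h
    simp only [Function.comp, OPoint.half_flip] at h
    have := congrArg opp h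
    rw [opp_opp, opp_opp] at this
    exact hqh this
  · intro h h1 h2
    simp only [List.mem_reverse, List.mem_ofFn, Function.comp] at h1 h2
    obtain ⟨i, rfl⟩ := h1
    obtain ⟨j, hj⟩ := h2
    exact hqb i j (by rw [← OPoint.edge_flip]; exact (hedge _ _ hj).symm)
  · intro h h1 h2
    simp only [List.mem_append, List.mem_reverse, List.mem_ofFn, Function.comp] at h1 h2
    obtain ⟨i, rfl⟩ := h1
    rcases h2 with ⟨j, hj⟩ | ⟨j, hj⟩
    · have he := hedge _ _ hj
      rw [OPoint.edge_flip] at he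
      have hij : j = i := hq he
      subst hij
      rw [OPoint.half_flip] at hj
      exact opp_ne _ hj
    · exact hqb i j (hedge _ _ hj).symm

/-- The fused spinor is the Pfaffian of the matrix of two-point spinors and renormalized two-point
functions: by `renormalized_flip` the latter perturb the normalized two-point functions as in
`pfL_fusionEntry`, with `t = (1 - μ̃) / 2`. -/
theorem fused_eq_pfaffian {V : Finset Vtx} {a : Face} {m n : ℕ} {e : Fin m → Edge}
    (he : ∀ i, e i ∈ edges V) (he_inj : Function.Injective e) {b : Fin (2 * n) → OPoint}
    (hb_inj : Function.Injective fun j => (b j).edge) (heb : ∀ i j, e i ≠ (b j).edge)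
    {q : Fin m → OPoint} (hq : ∀ i, (q i).edge = e i) :
    fused V a b m e [] = pfaffian (spinorMatrix V a (fusedPoints q b)) := by
  classical
  have hqe : (fun i => (q i).edge) = e := funext hq
  have hnd := nodup_fusedPoints (q := q) (b := b) (hqe ▸ he_inj) hb_inj
    (fun i j => (hq i).symm ▸ heb i j)
  set t : OPoint → ℝ := fun x => (1 - muTilde a x.edge) / 2 with ht
  set A : OPoint → OPoint → ℂ := fun x y => if x.edge = y.edge then
    if x.root = y.root then 0 else renormalized V a x y else twoPoint V a x y with hA
  have hmat : spinorMatrix V a (fusedPoints q b) =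
      Matrix.of fun j k => A (fusedPoints q b j) (fusedPoints q b k) := by
    funext j k
    simp only [spinorMatrix, hA, Matrix.of_apply]
  have hfar : ∀ x y : OPoint, x.edge ≠ y.edge →
      A x y = fusionEntry V a t (List.ofFn q) x y := by
    intro x y h
    have h' : y ≠ x.flip := fun e => h (by rw [e, OPoint.edge_flip])
    simp only [hA, fusionEntry, if_neg h, h', and_false, if_false, add_zero]
    exact twoPoint_eq V a h
  have hentries : (List.ofFn q ++ ([] ++ (((List.ofFn q).map OPoint.flip).reverse ++
      List.ofFn b))).Pairwise fun x y => A x y = fusionEntry V a t (List.ofFn q) x y := by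
    rw [List.nil_append, List.pairwise_append, List.pairwise_append]
    refine ⟨?_, ⟨?_, ?_, ?_⟩, ?_⟩
    · rw [List.pairwise_ofFn]
      intro i j hij
      refine hfar _ _ ?_
      rw [hq, hq]
      exact he_inj.ne hij.ne
    · rw [List.pairwise_reverse, List.map_ofFn, List.pairwise_ofFn]
      intro i j hij
      refine hfar _ _ ?_
      simp only [Function.comp, OPoint.edge_flip, hq]
      exact he_inj.ne hij.ne'
    · rw [List.pairwise_ofFn]
      intro i j hij
      exact hfar _ _ (hb_inj.ne hij.ne)
    · intro x hx y hy
      simp only [List.mem_reverse, List.map_ofFn, List.mem_ofFn, Function.comp] at hx hy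
      obtain ⟨i, rfl⟩ := hx
      obtain ⟨j, rfl⟩ := hy
      refine hfar _ _ ?_
      rw [OPoint.edge_flip, hq]
      exact heb i j
    · intro x hx y hy
      simp only [List.mem_append, List.mem_reverse, List.map_ofFn, List.mem_ofFn,
        Function.comp] at hx hy
      obtain ⟨i, rfl⟩ := hx
      rcases hy with ⟨j, rfl⟩ | ⟨j, rfl⟩
      · by_cases hij : i = j
        · subst hij
          have hr : (q i).root ≠ (q i).flip.root := by
            change (q i).root ≠ Complex.I * (q i).root
            intro h
            have h1 : (1 : ℂ) = Complex.I :=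
              mul_right_cancel₀ (q i).root_ne_zero (by rw [one_mul]; exact h)
            simpa using congrArg Complex.re h1
          simp only [hA]
          rw [if_pos (OPoint.edge_flip _).symm, if_neg hr,
            renormalized_flip ((hq i).symm ▸ he i), fusionEntry,
            if_pos ⟨List.mem_ofFn.2 ⟨i, rfl⟩, rfl⟩, ← Complex.ofReal_add]
        · refine hfar _ _ ?_
          rw [OPoint.edge_flip, hq, hq]
          exact he_inj.ne hij
      · refine hfar _ _ ?_
        rw [hq]
        exact heb i j
  have hhead : ∀ x ∈ List.ofFn q, x.head ∈ V := by
    intro x hx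
    obtain ⟨i, rfl⟩ := List.mem_ofFn.1 hx
    exact (OPoint.edge_mem_edges.1 ((hq i).symm ▸ he i)).1
  rw [hmat, pfaffian_eq_pfL, ofFn_fusedPoints, pfL_congr _ hentries,
    pfL_fusionEntry t (List.ofFn q) [] (List.ofFn b) Even.zero hhead hnd, fused_eq V a hb_inj]
  congr 3
  · rw [List.nil_append, List.map_ofFn, List.prod_ofFn]; rfl
  · rw [List.nil_append, List.map_ofFn]
    congr 1
    funext ω
    rw [List.map_ofFn, List.prod_ofFn]
    refine Finset.prod_congr rfl fun i _ => ?_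
    simp only [Function.comp, ht, hq, fuseFactor]

/-! ### The Ising model -/

/-- The second face incident to an edge. -/
def otherFace (e : Edge) : Face := if e.2 then e.1 + (-1, 0) else e.1 + (0, -1)

/-- The edges of the domain that separate two spins of different signs. -/
def domainWall (V : Finset Vtx) (M : Finset Face) : Finset Edge :=
  (edges V).filter fun e => ¬(e.1 ∈ M ↔ otherFace e ∈ M)

lemma mem_faces {V : Finset Vtx} {f : Face} : f ∈ faces V ↔
    f ∈ V ∧ f + (1, 0) ∈ V ∧ f + (0, 1) ∈ V ∧ f + (1, 1) ∈ V := by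
  simp [faces]

lemma isBoundary_domainWall {V : Finset Vtx} {M : Finset Face} (hM : M ⊆ faces V) :
    IsBoundary M (domainWall V M) := by
  have hedge : ∀ e : Edge, e.1 ∈ faces V ∨ otherFace e ∈ faces V → e ∈ edges V := by
    rintro ⟨⟨x, y⟩, b⟩ h
    have hiff : ((x, y), b) ∈ edges V ↔ (x, y) ∈ V ∧ Edge.snd' ((x, y), b) ∈ V := by
      simp [edges]
    rw [hiff]
    simp only [mem_faces, otherFace, Edge.snd'] at h ⊢
    cases b <;> simp at h ⊢ <;> tauto
  intro e
  rw [domainWall, Finset.mem_filter]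
  refine ⟨fun h => h.2, fun h => ⟨hedge e ?_, h⟩⟩
  change ¬(e.1 ∈ M ↔ otherFace e ∈ M) at h
  by_cases h1 : e.1 ∈ M
  · exact Or.inl (hM h1)
  · exact Or.inr (hM (by tauto))

/-- The number of loops around a face determines its spin. -/
lemma IsBoundary.mem_iff_loops {M : Finset Face} {ω : Finset Edge} (h : IsBoundary M ω)
    (f : Face) : f ∈ M ↔ loops f ω = -1 := by
  have hs : sgn (f ∈ M) = loops f ω := by
    obtain ⟨B, -, hB⟩ := exists_bound ω
    obtain ⟨B', hB'⟩ := (M.image Prod.fst).exists_le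
    obtain ⟨k, n⟩ := f
    have aux : ∀ m : ℕ, ∀ k : ℤ, max B B' < k + m → sgn ((k, n) ∈ M) = loops (k, n) ω := by
      intro m
      induction m with
      | zero =>
        intro k hk
        rw [sgn, if_neg, loops_eq_one]
        · intro e he _
          have h1 := (hB e he).1
          have h2 := le_abs_self e.1.1
          simp only; simp at hk; omega
        · intro hf
          have := hB' k (Finset.mem_image.2 ⟨_, hf, rfl⟩)
          simp at hk; omega
      | succ m ih =>
        intro k hk
        have h1 := ih (k + 1) (by push_cast at hk; omega)
        have h2 := loops_vert ω (k + 1) n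
        have h3 := h ((k + 1, n), true)
        simp only [add_sub_cancel_right, if_true, Prod.mk_add_mk, add_zero,
          add_neg_cancel_right] at h2 h3
        rw [h2, ← h1]
        unfold sgn
        by_cases a1 : (k, n) ∈ M <;> by_cases a2 : (k + 1, n) ∈ M <;>
          simp [a1, a2] at h3 <;> simp [a1, a2, h3]
    exact aux (max B B' - k + 1).toNat k (by omega)
  rw [← hs, sgn]
  split_ifs with hf <;> simp [hf]

lemma even_domainWall {V : Finset Vtx} {M : Finset Face} (hM : M ⊆ faces V) :
    domainWall V M ∈ cfg V 1 [] :=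
  cfg_nil_iff.2 ⟨Finset.filter_subset _ _, (isBoundary_domainWall hM).edgesMono_eq.2⟩

/-- If the domain has no holes, then the loops of a configuration do not surround points outside
the domain. -/
lemma loops_eq_one_of_noHoles {V : Finset Vtx} (hV : NoHoles V) {ω : Finset Edge}
    (hω : ω ∈ cfg V 1 []) {u : Vtx} (hu : u ∉ V) {f : Face} (h1 : f.1 = u.1 ∨ f.1 = u.1 - 1)
    (h2 : f.2 = u.2 ∨ f.2 = u.2 - 1) : loops f ω = 1 := by
  obtain ⟨hωV, hev⟩ := cfg_nil_iff.1 hω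
  -- all the faces around a vertex outside the domain are surrounded by the same number of loops
  have hstar : ∀ p : Vtx, p ∉ V → ∀ f : Face, (f.1 = p.1 ∨ f.1 = p.1 - 1) →
      (f.2 = p.2 ∨ f.2 = p.2 - 1) → loops f ω = loops p ω := by
    rintro ⟨k, n⟩ hp ⟨i, j⟩ hi hj
    have hno : ∀ d, Half.edge ((k, n), d) ∉ ω := fun d hd =>
      hp (IsingSpinor.edge_mem_edges.1 (hωV hd)).1
    have hleft : ((k - 1, n), false) ∉ ω := by
      simpa [Half.edge, edgeOf, sub_eq_add_neg] using hno 2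
    have e1 : loops (k - 1, n) ω = loops (k, n) ω := by
      rw [loops_vert, sgn, if_neg (show ((k, n), true) ∉ ω from hno 1), mul_one]
    have e2 : loops (k, n - 1) ω = loops (k, n) ω := by
      rw [loops_horiz hev, sgn, if_neg (show ((k, n), false) ∉ ω from hno 0), mul_one]
    have e3 : loops (k - 1, n - 1) ω = loops (k - 1, n) ω := by
      rw [loops_horiz hev, sgn, if_neg hleft, mul_one]
    simp only at hi hj
    rcases hi with rfl | rfl <;> rcases hj with rfl | rfl
    · rfl
    · exact e2
    · exact e1
    · exact e3.trans e1
  obtain ⟨B, -, hB⟩ := exists_bound ω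
  obtain ⟨B', hB'⟩ := (V.image Prod.fst).exists_le
  set w : Vtx := (max B B' + 1, 0) with hw
  have hwV : w ∉ V := fun h => by
    have := hB' _ (Finset.mem_image.2 ⟨_, h, rfl⟩)
    simp only [hw] at this; omega
  have hw1 : loops w ω = 1 := by
    refine loops_eq_one ω _ fun e he _ => ?_
    have h1 := (hB e he).1
    have h2 := le_abs_self e.1.1
    simp only [hw]; omega
  have hchain : ∀ p, Relation.ReflTransGen
      (fun p q : Vtx => q ∉ V ∧ |q.1 - p.1| ≤ 1 ∧ |q.2 - p.2| ≤ 1) w p →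
      p ∉ V ∧ loops p ω = 1 := by
    intro p hp
    induction hp with
    | refl => exact ⟨hwV, hw1⟩
    | @tail p q _ hpq ih =>
      obtain ⟨hq, d1, d2⟩ := hpq
      rw [abs_le] at d1 d2
      refine ⟨hq, ?_⟩
      have a1 := hstar p ih.1 (min p.1 q.1, min p.2 q.2) (by simp only; omega) (by simp only; omega)
      have a2 := hstar q hq (min p.1 q.1, min p.2 q.2) (by simp only; omega) (by simp only; omega)
      rw [← a2, a1, ih.2]
  rw [hstar u hu f h1 h2]
  exact (hchain u (hV w hwV u hu)).2

lemma boundary_subset_faces {V : Finset Vtx} (hV : NoHoles V) {ω : Finset Edge}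
    (hω : ω ∈ cfg V 1 []) {M : Finset Face} (hM : IsBoundary M ω) : M ⊆ faces V := by
  intro f hf
  rw [hM.mem_iff_loops] at hf
  have key : ∀ u : Vtx, (f.1 = u.1 ∨ f.1 = u.1 - 1) → (f.2 = u.2 ∨ f.2 = u.2 - 1) → u ∈ V := by
    intro u h1 h2
    by_contra hu
    rw [loops_eq_one_of_noHoles hV hω hu h1 h2] at hf
    exact absurd hf (by decide)
  rw [mem_faces]
  refine ⟨key _ ?_ ?_, key _ ?_ ?_, key _ ?_ ?_, key _ ?_ ?_⟩ <;> simp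

/-- Low-temperature expansion: spin configurations correspond to their domain walls. -/
lemma sum_spins {V : Finset Vtx} (hV : NoHoles V) (g : Finset Face → ℝ) (f : Finset Edge → ℝ)
    (hgf : ∀ M ω, ω ∈ cfg V 1 [] → IsBoundary M ω → g M = f ω) :
    ∑ M ∈ (faces V).powerset, g M = ∑ ω ∈ cfg V 1 [], f ω := by
  refine Finset.sum_bij (fun M _ => domainWall V M) ?_ ?_ ?_ ?_
  · intro M hM
    exact even_domainWall (Finset.mem_powerset.1 hM)
  · intro M hM M' hM' h
    have h1 := isBoundary_domainWall (Finset.mem_powerset.1 hM)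
    have h2 := isBoundary_domainWall (Finset.mem_powerset.1 hM')
    ext x
    rw [h1.mem_iff_loops, h2.mem_iff_loops, h]
  · intro ω hω
    obtain ⟨M, -, hM⟩ := exists_boundary (cfg_nil_iff.1 hω).2
    have hMf := boundary_subset_faces hV hω hM
    refine ⟨M, Finset.mem_powerset.2 hMf, ?_⟩
    ext e
    have h1 := isBoundary_domainWall hMf e
    rw [h1, hM e]
  · intro M hM
    exact hgf M _ (even_domainWall (Finset.mem_powerset.1 hM))
      (isBoundary_domainWall (Finset.mem_powerset.1 hM))

/-- The spin of a face is the sign of the number of domain walls around it. -/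
lemma IsBoundary.spin_eq {M : Finset Face} {ω : Finset Edge} (h : IsBoundary M ω) (f : Face) :
    spin M f = ((loops f ω : ℤ) : ℝ) := by
  have := h.mem_iff_loops f
  rw [spin]
  split_ifs with hf
  · rw [this.1 hf]; simp
  · rcases Int.units_eq_one_or (loops f ω) with h1 | h1
    · rw [h1]; simp
    · exact absurd (this.2 h1) hf

lemma IsBoundary.edgeSpin_eq {M : Finset Face} {ω : Finset Edge} (h : IsBoundary M ω) (e : Edge) :
    edgeSpin M e = 1 - 2 * (if e ∈ ω then 1 else 0) := by
  have := h e
  rw [edgeSpin, spin, spin]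
  generalize (if e.2 then e.1 + (-1, 0) else e.1 + (0, -1)) = o at *
  split_ifs <;> first | (exfalso; tauto) | norm_num

/-- The Boltzmann weight in terms of the length of the domain walls. -/
lemma IsBoundary.boltzmann_eq {V : Finset Vtx} {M : Finset Face} {ω : Finset Edge}
    (h : IsBoundary M ω) (hω : ω ⊆ edges V) :
    boltzmann V M = Real.exp (betaC * (edges V).card) * alpha ^ ω.card := by
  have hsum : ∑ e ∈ edges V, edgeSpin M e = (edges V).card - 2 * (ω.card : ℝ) := by
    simp only [h.edgeSpin_eq]
    rw [Finset.sum_sub_distrib, ← Finset.mul_sum, Finset.sum_ite_mem,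
      Finset.inter_eq_right.2 hω]
    simp
  rw [boltzmann, hsum, alpha, ← Real.exp_nat_mul, ← Real.exp_add]
  congr 1; ring

/-- Expectations of functions of the domain walls, weighted by the spin of the face `a`. -/
lemma expect_spin_mul {V : Finset Vtx} (hV : NoHoles V) (a : Face) (g : Finset Face → ℝ)
    (f : Finset Edge → ℝ) (hgf : ∀ M ω, ω ∈ cfg V 1 [] → IsBoundary M ω → g M = f ω) :
    expect V (fun M => spin M a * g M) =
      Real.exp (betaC * (edges V).card) / (∑ M ∈ (faces V).powerset, boltzmann V M) *
        corrWith V a f [] := by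
  rw [expect, sum_spins hV (fun M => spin M a * g M * boltzmann V M)
    (fun ω => ((loops a ω : ℤ) : ℝ) * f ω * (Real.exp (betaC * (edges V).card) * alpha ^ ω.card))]
  · rw [corrWith, div_mul_eq_mul_div, Finset.mul_sum]
    congr 1
    refine Finset.sum_congr rfl fun ω hω => ?_
    rw [configMono_nil_sign hω, weight]
    push_cast; ring
  · intro M ω hω hM
    rw [hM.spin_eq, hgf M ω hω hM, hM.boltzmann_eq (cfg_nil_iff.1 hω).1]

lemma boltzmann_sum_pos (V : Finset Vtx) : 0 < ∑ M ∈ (faces V).powerset, boltzmann V M :=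
  Finset.sum_pos (fun _ _ => Real.exp_pos _) ⟨∅, by simp⟩

lemma expect_spin {V : Finset Vtx} (hV : NoHoles V) (a : Face) :
    expect V (fun M => spin M a) =
      Real.exp (betaC * (edges V).card) / (∑ M ∈ (faces V).powerset, boltzmann V M) *
        corr V a [] := by
  have := expect_spin_mul hV a (fun _ => 1) (fun _ => 1) fun _ _ _ _ => rfl
  simpa only [mul_one, corrWith_one] using this

theorem expect_spin_pos {V : Finset Vtx} (hV : NoHoles V) (a : Face) :
    0 < expect V (fun M => spin M a) := by
  rw [expect_spin hV]
  exact mul_pos (div_pos (Real.exp_pos _) (boltzmann_sum_pos V)) (corr_nil_pos V a)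

/-- The correlations of energy densities with a spin are fused spinors without points. -/
theorem expect_energies {V : Finset Vtx} (hV : NoHoles V) (a : Face) {m : ℕ} (e : Fin m → Edge)
    (b : Fin (2 * 0) → OPoint) :
    ((expect V (fun M => spin M a * ∏ i, (muTilde a (e i) - edgeSpin M (e i))) /
      expect V (fun M => spin M a) : ℝ) : ℂ) = (-1) ^ m * 2 ^ m * fused V a b m e [] := by
  have hZ := (corr_nil_pos V a).ne'
  have hB := (boltzmann_sum_pos V).ne'
  rw [fused_eq V a (fun i => i.elim0), expect_spin hV,
    expect_spin_mul hV a _ fun ω => (-2) ^ m * ∏ i, fuseFactor a (e i) ω]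
  · have h1 : corrWith V a (fun ω => (-2) ^ m * ∏ i, fuseFactor a (e i) ω) [] =
        (-2) ^ m * corrWith V a (fun ω => ∏ i, fuseFactor a (e i) ω) [] := by
      rw [corrWith, corrWith, Finset.mul_sum]
      exact Finset.sum_congr rfl fun ω _ => by ring
    have h2 : pointHalves b = [] := List.ofFn_zero
    have h3 : ∏ i, (b i).theta a = 1 := Fin.prod_univ_zero _
    have h4 : ((-1 : ℂ)) ^ m * 2 ^ m = (((-2) ^ m : ℝ) : ℂ) := by
      rw [← mul_pow]; push_cast; norm_num
    rw [h1, h2, h3, h4, ← Complex.ofReal_mul]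
    congr 1
    have := (Real.exp_pos (betaC * (edges V).card)).ne'
    field_simp
  · intro M ω _ hM
    have hc : ((-2 : ℝ)) ^ m = ∏ _i : Fin m, (-2 : ℝ) := by simp
    rw [hc, ← Finset.prod_mul_distrib]
    refine Finset.prod_congr rfl fun i _ => ?_
    rw [hM.edgeSpin_eq, fuseFactor]
    ring

end IsingSpinor

end

open IsingSpinor
theorem proposition3p20 (V : Finset Vtx) (a : Face) (ha : a ∈ faces V) (m n : ℕ)
    (e : Fin m → Edge) (he : ∀ i, e i ∈ edges V) (he_inj : Function.Injective e)
    (b : Fin (2 * n) → OPoint) (hb : ∀ j, Touches V (b j).edge)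
    (hb_inj : Function.Injective fun j => (b j).edge) (heb : ∀ i j, e i ≠ (b j).edge)
    (q : Fin m → OPoint) (hq : ∀ i, (q i).edge = e i) :
    fused V a b m e [] = pfaffian (spinorMatrix V a (fusedPoints q b)) ∧
    (NoHoles V →
      0 < expect V (fun M => spin M a) ∧
      ((expect V (fun M => spin M a * ∏ i, (muTilde a (e i) - edgeSpin M (e i))) /
          expect V (fun M => spin M a) : ℝ) : ℂ) =
        (-1) ^ m * 2 ^ m *
          pfaffian (spinorMatrix V a
            (fusedPoints q (fun j : Fin (2 * 0) => j.elim0)))) := by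
  refine ⟨fused_eq_pfaffian he he_inj hb_inj heb hq, fun hV => ⟨expect_spin_pos hV a, ?_⟩⟩
  rw [expect_energies hV a e fun j : Fin (2 * 0) => j.elim0,
    fused_eq_pfaffian he he_inj (fun j => j.elim0) (fun _ j => j.elim0) hq]
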